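/- Let $(X,D)$ be a non-empty compact metric space with $\mathrm{diam}(X;D)<1$; balls $B_t(x;D)$ are open. Let $\alpha,\eta\in(0,1)$ be sufficiently small: there are absolute constants $\alpha_0,\eta_0\in(0,1)$ such that the following holds whenever $0<\alpha\le\alpha_0$ and $0<\eta\le\eta_0$. *The filling.* Let $A_0\subset A_1\subset\cdots$ be finite subsets of $X$ such that $D(x,y)\ge\alpha^n$ for distinct $x,y\in A_n$ and $X=\bigcup_{x\in A_n}B_{\alpha^n}(x;D)$. Put $V_n=\{(x,n):x\in A_n\}$ and $V=\bigsqcup_{n\ge0}V_n$; then $V_0=\{o\}$. For $u=(x,n)$ and $v=(y,n)$ in $V_n$ write $u\sim v$ if $u=v$ or $B_{4\alpha^n}(x;D)\cap B_{4\alpha^n}(y;D)\ne\emptyset$. For each $v=(y,n+1)\in V_{n+1}$ choose a parent $g(v)=(x,n)\in V_n$ with $x$ a point of $A_n$ nearest to $y$. *The weight.* Let $\sigma:V\setminus\{o\}\to[0,\infty)$ be admissible: ($\star$) for all $n\ge1$, $(y,n-1)\in V_{n-1}$ and $(x_0,n)\sim(x_1,n)\sim\cdots\sim(x_N,n)$ in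 $V_n$ with $B_{\alpha^{n-1}}(y;D)\cap B_{4\alpha^n}(x_0;D)\neq\emptyset$ and $(X\setminus B_{2\alpha^{n-1}}(y;D))\cap B_{4\alpha^n}(x_N;D)\ne\emptyset$, one has $\sum_{j=0}^N\sigma(x_j,n)\ge1$. *The function $\pi$.* For $n\ge1$ and $u\in V_n$ let $\nu(u)=2\sup\{\sigma(w): v,w\in V_n,\ u\sim v\sim w\}$ and $\mu(u)=\max(\eta,\min(\nu(u),1-\eta))$. Put $\pi(o)=1$ and, inductively, for $u\in V_n$ with $n\ge1$ put $\pi'(u)=\pi(g(u))\mu(u)$; let $\pi(u)=\eta\sup\{\pi'(u'):u'\in V_n,\ u'\sim u,\ \pi'(u')>\eta^{-1}\pi'(u)\}$ if this set is non-empty, and $\pi(u)=\pi'(u)$ otherwise. Put $\varrho(u)=\pi(u)/\pi(g(u))$. *The metrics.* Let $(Z,d_\varrho)$ be the metric graph with vertex set $V$, with an edge of length $2\log(1/\eta)$ between any two distinct $u,v\in V_n$ with $u\sim v$, and an edge of length $\log(1/\varrho(u))$ between $g(u)$ and $u$ for each $u\in V\setminus\{o\}$. For $z,w\in Z$ let $d_1(z,w)=\inf_P\int_a^b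 e^{-d_\varrho(o,P(t))}\,dt$ over all paths $P:[a,b]\to Z$ from $z$ to $w$ parameterized by $d_\varrho$-length. Let $\partial_1Z$ be the completion of $(Z,d_1)$ minus $Z$, with the extended metric $d_1$. Let $(a,b)_\varrho\in[0,\infty]$ be the Gromov product with base point $o$ on the Gromov boundary $\partial_\infty(Z,d_\varrho)$, i.e. $(a,b)_\varrho=\inf\liminf_j(x_j,y_j)_\varrho$ over all sequences $(x_j)$, $(y_j)$ representing $a$, $b$. Then there is a constant $C\ge1$ depending only on $\alpha$ and $\eta$ such that the following hold. 1. $(Z,d_\varrho)$ is Gromov hyperbolic, and there are natural bijections $X\cong\partial_\infty(Z,d_\varrho)$ and $X\cong\partial_1Z$: if $u_j=(x_j,m_j)\in V$, $m_j\to\infty$ and $x_j\to x$ in $(X,D)$, then $(u_j)$ represents the point of $\partial_\infty(Z,d_\varrho)$ corresponding to $x$ and converges in the completion of $(Z,d_1)$ to the point of $\partial_1Z$ corresponding to $x$. Use them to regard $d_1$ as a metric on $X$ and $(\cdot,\cdot)_\varrho$ as a function on $X\times X$. 2. $d_1$ is a visual metric with parameter one: $C^{-1}e^{-(x,y)_\varrho}\le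 d_1(x,y)\le Ce^{-(x,y)_\varrho}$ for all $x,y\in X$. 3. The identity map $(X,D)\to(X,d_1)$ is quasisymmetric: it is a homeomorphism, and there is an increasing homeomorphism $\theta$ of $[0,\infty)$ with $\frac{d_1(x,z)}{d_1(y,z)}\le\theta\left(\frac{D(x,z)}{D(y,z)}\right)$ for all distinct $x,y,z\in X$. 4. $\mathrm{diam}(B_{\alpha^n}(x;D);d_1)\le C\,\pi(u)$ for all $n\ge 0$ and $u=(x,n)\in V_n$. 5. $\pi(u)\le(1-\eta)^n$ for all $n\ge0$ and $u\in V_n$. Consequently, if $p\in\mathbb R$ and $\sum_{u\in V_n}\pi(u)^p\to0$ as $n\to\infty$, then the Hausdorff dimension of $(X,d_1)$ is at most $p$, and hence so is the conformal dimension of $(X,D)$, that is, the infimum of the Hausdorff dimensions of all metric spaces quasisymmetrically equivalent to $(X,D)$. -/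

import Mathlib

open Set Filter Topology Metric MeasureTheory
open scoped NNReal ENNReal

universe u v

noncomputable section

/-! ### Quasisymmetric maps, Hausdorff dimension, conformal dimension -/

/-- A map `f : (X, mX) → (Y, mY)` is quasisymmetric if it is a homeomorphism and there is an
increasing homeomorphism `θ` of `[0, ∞)` (an order isomorphism of `ℝ≥0`) controlling the
distortion of ratios of distances. -/
def IsQuasisymmetric {X : Type u} {Y : Type v} (mX : MetricSpace X) (mY : MetricSpace Y)
    (f : X → Y) : Prop :=
  IsHomeomorph f ∧ ∃ θ : ℝ≥0 ≃o ℝ≥0, ∀ x y z : X, x ≠ y → y ≠ z → x ≠ z →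
    nndist (f x) (f z) / nndist (f y) (f z) ≤ θ (nndist x z / nndist y z)

/-- The Hausdorff dimension of the metric space `(X, m)`. -/
def hausdorffDim (X : Type u) (m : MetricSpace X) : ℝ≥0∞ := dimH (univ : Set X)

/-- The conformal dimension of `(X, m)`: the infimum of the Hausdorff dimensions of all metric
spaces that are quasisymmetrically equivalent to `(X, m)`. -/
def conformalDim (X : Type u) (m : MetricSpace X) : ℝ≥0∞ :=
  ⨅ (Y : Type u) (mY : MetricSpace Y) (_ : ∃ f : X → Y, IsQuasisymmetric m mY f),
    hausdorffDim Y mY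

/-! ### Gromov hyperbolicity, Gromov boundary, visual metrics

The ambient space `Z` carries a `ℝ≥0∞`-valued metric, so that metric graphs can be defined
without a connectedness assumption; the notions below are used for spaces in which all distances
are finite. -/

section Gromov

variable {Z : Type u} [PseudoEMetricSpace Z]

/-- The Gromov product `(x, y)_o`. -/
def gromovProd (o x y : Z) : ℝ :=
  ((edist x o).toReal + (edist y o).toReal - (edist x y).toReal) / 2

/-- All distances are finite, and the four point condition holds with some `δ ≥ 0`. -/
def IsGromovHyperbolic (Z : Type u) [PseudoEMetricSpace Z] : Prop :=
  (∀ x y : Z, edist x y ≠ ⊤) ∧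
  ∃ δ : ℝ, 0 ≤ δ ∧ ∀ o x y z : Z,
    min (gromovProd o x z) (gromovProd o y z) - δ ≤ gromovProd o x y

/-- `(s j, s k)_o → ∞` as `j, k → ∞`. -/
def IsGromovSeq (o : Z) (s : ℕ → Z) : Prop :=
  Tendsto (fun p : ℕ × ℕ => gromovProd o (s p.1) (s p.2)) atTop atTop

/-- The Gromov boundary: sequences converging to infinity, where `s` and `t` are identified if
`(s j, t j)_o → ∞`. (This relation is an equivalence relation in a Gromov hyperbolic space.) -/
def GromovBoundary (o : Z) : Type u :=
  Quot (fun s t : {s : ℕ → Z // IsGromovSeq o s} =>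
    Tendsto (fun j => gromovProd o (s.1 j) (t.1 j)) atTop atTop)

/-- The boundary point represented by a sequence converging to infinity. -/
def GromovBoundary.mk {o : Z} (s : ℕ → Z) (hs : IsGromovSeq o s) : GromovBoundary o :=
  Quot.mk _ ⟨s, hs⟩

/-- The Gromov product of two boundary points, with values in `[0, ∞]`. -/
def boundaryProd {o : Z} (a b : GromovBoundary o) : EReal :=
  ⨅ (s : ℕ → Z) (t : ℕ → Z) (hs : IsGromovSeq o s) (ht : IsGromovSeq o t)
    (_ : GromovBoundary.mk s hs = a) (_ : GromovBoundary.mk t ht = b),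
    liminf (fun j => ((gromovProd o (s j) (t j) : ℝ) : EReal)) atTop

/-- The function `d` on the Gromov boundary of the Gromov hyperbolic space `Z` is visual with
parameter `ε` and constant `C`:
`C⁻¹ exp (-ε (a, b)_o) ≤ d a b ≤ C exp (-ε (a, b)_o)`, where `exp (-∞) = 0`. -/
structure IsVisual (o : Z) (ε C : ℝ) (d : GromovBoundary o → GromovBoundary o → ℝ) : Prop where
  hyperbolic : IsGromovHyperbolic Z
  lower : ∀ a b, ENNReal.ofReal C⁻¹ * EReal.exp (-((ε : EReal) * boundaryProd a b))
    ≤ ENNReal.ofReal (d a b)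
  upper : ∀ a b, ENNReal.ofReal (d a b)
    ≤ ENNReal.ofReal C * EReal.exp (-((ε : EReal) * boundaryProd a b))

end Gromov

/-! ### Conformal deformation of a metric -/

section Deformation

variable {Z : Type u} [PseudoEMetricSpace Z]

/-- The density `φ_ε(z) = exp (-ε d(o, z))`. -/
def deformDensity (o : Z) (ε : ℝ) (z : Z) : ℝ≥0∞ :=
  ENNReal.ofReal (Real.exp (-ε * (edist o z).toReal))

/-- `P` restricted to `[a, b]` is a path from `x` to `y` parameterized by length. -/
def IsArcPath (x y : Z) (a b : ℝ) (P : ℝ → Z) : Prop :=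
  a ≤ b ∧ HasUnitSpeedOn P (Icc a b) ∧ P a = x ∧ P b = y

/-- `d_ε(x, y)`: the infimum of `∫_a^b φ_ε(P(t)) dt` over all paths `P : [a, b] → Z` from `x` to
`y` parameterized by length. -/
def deformDist (o : Z) (ε : ℝ) (x y : Z) : ℝ≥0∞ :=
  ⨅ (a : ℝ) (b : ℝ) (P : ℝ → Z) (_ : IsArcPath x y a b P),
    ∫⁻ t in Icc a b, deformDensity o ε (P t)

lemma IsArcPath.refl (x : Z) : IsArcPath x x 0 0 (fun _ => x) := by
  refine ⟨le_rfl, ?_, rfl, rfl⟩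
  unfold HasUnitSpeedOn
  rw [Icc_self]
  exact hasConstantSpeedOnWith_of_subsingleton (fun _ : ℝ => x) subsingleton_singleton 1

lemma HasUnitSpeedOn.comp_shift {P : ℝ → Z} {a b : ℝ} (hP : HasUnitSpeedOn P (Icc a b)) (c : ℝ) :
    HasUnitSpeedOn (fun t => P (t + c)) (Icc (a - c) (b - c)) := by
  intro x hx y hy
  have hx' : x + c ∈ Icc a b := ⟨by linarith [hx.1], by linarith [hx.2]⟩
  have hy' : y + c ∈ Icc a b := ⟨by linarith [hy.1], by linarith [hy.2]⟩
  have h := hP hx' hy'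
  have himg : (fun t : ℝ => t + c) '' (Icc (a - c) (b - c) ∩ Icc x y)
      = Icc a b ∩ Icc (x + c) (y + c) := by
    ext z
    constructor
    · rintro ⟨w, ⟨⟨h1, h2⟩, h3, h4⟩, rfl⟩
      exact ⟨⟨by simp only; linarith, by simp only; linarith⟩, by simp only; linarith,
        by simp only; linarith⟩
    · rintro ⟨⟨h1, h2⟩, h3, h4⟩
      exact ⟨z - c, ⟨⟨by linarith, by linarith⟩, by linarith, by linarith⟩, by simp⟩
  have hmono : MonotoneOn (fun t : ℝ => t + c) (Icc (a - c) (b - c) ∩ Icc x y) :=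
    fun _ _ _ _ h => by simpa using h
  have := eVariationOn.comp_eq_of_monotoneOn P (fun t : ℝ => t + c) hmono
  rw [himg, h] at this
  rw [show (fun t => P (t + c)) = P ∘ (fun t : ℝ => t + c) from rfl, this]
  congr 2
  ring

lemma HasUnitSpeedOn.comp_anti {P : ℝ → Z} {a b : ℝ} (hP : HasUnitSpeedOn P (Icc a b)) :
    HasUnitSpeedOn (fun t => P (-t)) (Icc (-b) (-a)) := by
  intro x hx y hy
  rcases le_total x y with hxy | hxy
  · have hx' : -x ∈ Icc a b := ⟨by linarith [hx.2], by linarith [hx.1]⟩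
    have hy' : -y ∈ Icc a b := ⟨by linarith [hy.2], by linarith [hy.1]⟩
    have h := hP hy' hx'
    have himg : (fun t : ℝ => -t) '' (Icc (-b) (-a) ∩ Icc x y)
        = Icc a b ∩ Icc (-y) (-x) := by
      ext z
      constructor
      · rintro ⟨w, ⟨⟨h1, h2⟩, h3, h4⟩, rfl⟩
        exact ⟨⟨by simp only; linarith, by simp only; linarith⟩, by simp only; linarith,
          by simp only; linarith⟩
      · rintro ⟨⟨h1, h2⟩, h3, h4⟩
        exact ⟨-z, ⟨⟨by linarith, by linarith⟩, by linarith, by linarith⟩, by simp⟩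
    have hanti : AntitoneOn (fun t : ℝ => -t) (Icc (-b) (-a) ∩ Icc x y) :=
      fun _ _ _ _ h => neg_le_neg h
    have := eVariationOn.comp_eq_of_antitoneOn P (fun t : ℝ => -t) hanti
    rw [himg, h] at this
    rw [show (fun t => P (-t)) = P ∘ (fun t : ℝ => -t) from rfl, this]
    congr 2
    ring
  · have hs : (Icc (-b) (-a) ∩ Icc x y).Subsingleton := by
      intro p hp q hq
      linarith [hp.2.1, hp.2.2, hq.2.1, hq.2.2]
    rw [eVariationOn.subsingleton _ hs, ENNReal.ofReal_eq_zero.2]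
    simp only [NNReal.coe_one, one_mul]
    linarith

lemma deformDist_self (o : Z) (ε : ℝ) (x : Z) : deformDist o ε x x = 0 := by
  refine le_antisymm ?_ bot_le
  refine iInf_le_of_le 0 (iInf_le_of_le 0 (iInf_le_of_le (fun _ => x)
    (iInf_le_of_le (IsArcPath.refl x) ?_)))
  simp

lemma deformDist_comm_le (o : Z) (ε : ℝ) (x y : Z) :
    deformDist o ε x y ≤ deformDist o ε y x := by
  refine le_iInf fun a => le_iInf fun b => le_iInf fun P => le_iInf fun hP => ?_
  obtain ⟨hab, hu, ha, hb⟩ := hP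
  refine iInf_le_of_le (-b) (iInf_le_of_le (-a) (iInf_le_of_le (fun t => P (-t))
    (iInf_le_of_le ⟨by linarith, hu.comp_anti, by simpa using hb, by simpa using ha⟩ ?_)))
  rw [← lintegral_indicator measurableSet_Icc, ← lintegral_indicator measurableSet_Icc,
    ← lintegral_neg_eq_self (μ := (volume : Measure ℝ))
      (f := (Icc a b).indicator fun t => deformDensity o ε (P t))]
  refine le_of_eq (lintegral_congr fun t => ?_)
  have : t ∈ Icc (-b) (-a) ↔ -t ∈ Icc a b := by
    simp only [mem_Icc]
    constructor <;> rintro ⟨h1, h2⟩ <;> constructor <;> linarith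
  by_cases h : -t ∈ Icc a b
  · rw [indicator_of_mem h, indicator_of_mem (this.2 h)]
  · rw [indicator_of_notMem h, indicator_of_notMem (fun h' => h (this.1 h'))]

lemma deformDist_triangle (o : Z) (ε : ℝ) (x y z : Z) :
    deformDist o ε x z ≤ deformDist o ε x y + deformDist o ε y z := by
  have key : ∀ (a b : ℝ) (P : ℝ → Z) (_ : IsArcPath x y a b P) (c d : ℝ) (Q : ℝ → Z)
      (_ : IsArcPath y z c d Q), deformDist o ε x z ≤
        (∫⁻ t in Icc a b, deformDensity o ε (P t)) +
          ∫⁻ t in Icc c d, deformDensity o ε (Q t) := by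
    rintro a b P ⟨hab, hP, hPa, hPb⟩ c d Q ⟨hcd, hQ, hQc, hQd⟩
    let R : ℝ → Z := fun t => if t ≤ b then P t else Q (t + (c - b))
    have hR1 : ∀ t ∈ Icc a b, R t = P t := fun t ht => if_pos ht.2
    have hR2 : ∀ t ∈ Icc b (d - (c - b)), R t = Q (t + (c - b)) := by
      intro t ht
      by_cases h : t ≤ b
      · obtain rfl : t = b := le_antisymm h ht.1
        simp [R, hPb, hQc]
      · exact if_neg h
    have hbe : b ≤ d - (c - b) := by linarith
    have hu1 : HasUnitSpeedOn R (Icc a b) := by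
      intro s hs t ht
      rw [← hP hs ht]
      exact eVariationOn.eq_of_eqOn fun w hw => hR1 w hw.1
    have hu2 : HasUnitSpeedOn R (Icc b (d - (c - b))) := by
      have h := hQ.comp_shift (c - b)
      rw [sub_sub_cancel] at h
      intro s hs t ht
      rw [← h hs ht]
      exact eVariationOn.eq_of_eqOn fun w hw => hR2 w hw.1
    refine iInf_le_of_le a (iInf_le_of_le (d - (c - b)) (iInf_le_of_le R
      (iInf_le_of_le ⟨hab.trans hbe, hu1.Icc_Icc hu2, ?_, ?_⟩ ?_)))
    · rw [hR1 a ⟨le_rfl, hab⟩, hPa]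
    · rw [hR2 _ ⟨hbe, le_rfl⟩, sub_add_cancel, hQd]
    · rw [← Icc_union_Icc_eq_Icc hab hbe]
      refine (lintegral_union_le _ _ _).trans (add_le_add (le_of_eq ?_) (le_of_eq ?_))
      · exact setLIntegral_congr_fun measurableSet_Icc fun t ht => by simp only [hR1 t ht]
      · rw [← lintegral_indicator measurableSet_Icc, ← lintegral_indicator measurableSet_Icc,
          ← lintegral_add_right_eq_self (μ := (volume : Measure ℝ))
            ((Icc c d).indicator fun t => deformDensity o ε (Q t)) (c - b)]
        refine lintegral_congr fun t => ?_
        have : t ∈ Icc b (d - (c - b)) ↔ t + (c - b) ∈ Icc c d := by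
          simp only [mem_Icc]
          constructor <;> rintro ⟨h1, h2⟩ <;> constructor <;> linarith
        by_cases h : t + (c - b) ∈ Icc c d
        · rw [indicator_of_mem h, indicator_of_mem (this.2 h), hR2 t (this.2 h)]
        · rw [indicator_of_notMem h, indicator_of_notMem (fun h' => h (this.1 h'))]
  rw [show deformDist o ε x y + deformDist o ε y z =
    (⨅ (a : ℝ) (b : ℝ) (P : ℝ → Z) (_ : IsArcPath x y a b P),
      ∫⁻ t in Icc a b, deformDensity o ε (P t)) +
    (⨅ (a : ℝ) (b : ℝ) (P : ℝ → Z) (_ : IsArcPath y z a b P),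
      ∫⁻ t in Icc a b, deformDensity o ε (P t)) from rfl]
  simp only [ENNReal.iInf_add, ENNReal.add_iInf]
  exact le_iInf fun c => le_iInf fun d => le_iInf fun Q => le_iInf fun hQ =>
    le_iInf fun a => le_iInf fun b => le_iInf fun P => le_iInf fun hP =>
      key a b P hP c d Q hQ

/-- The space `Z` equipped with the metric `d_ε`. -/
def Deformed (_o : Z) (_ε : ℝ) : Type u := Z

instance (o : Z) (ε : ℝ) : PseudoEMetricSpace (Deformed o ε) where
  edist x y := deformDist (Z := Z) o ε x y
  edist_self x := deformDist_self (Z := Z) o ε x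
  edist_comm x y := le_antisymm (deformDist_comm_le (Z := Z) o ε x y)
    (deformDist_comm_le (Z := Z) o ε y x)
  edist_triangle x y z := deformDist_triangle (Z := Z) o ε x y z

/-- A point of `Z`, seen in the completion of `(Z, d_ε)`. -/
def toCompletion (o : Z) (ε : ℝ) (z : Z) : UniformSpace.Completion (Deformed o ε) :=
  ((show Deformed o ε from z) : UniformSpace.Completion (Deformed o ε))

/-- `∂_ε Z`: the completion of `(Z, d_ε)` minus `Z`. -/
def DeformBoundary (o : Z) (ε : ℝ) : Type u :=
  {p : UniformSpace.Completion (Deformed o ε) // p ∉ range (toCompletion o ε)}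

/-- `m` is the metric `d_ε` on `∂_ε Z`, that is, the restriction to `∂_ε Z` of the continuous
extension of `d_ε` to the completion of `(Z, d_ε)`. -/
def IsBoundaryMetric (o : Z) (ε : ℝ) (m : MetricSpace (DeformBoundary o ε)) : Prop :=
  ∀ (p q : DeformBoundary o ε) (s t : ℕ → Z),
    Tendsto (fun j => toCompletion o ε (s j)) atTop (𝓝 p.1) →
    Tendsto (fun j => toCompletion o ε (t j)) atTop (𝓝 q.1) →
    Tendsto (fun j => deformDist o ε (s j) (t j)) atTop (𝓝 (ENNReal.ofReal (dist p q)))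

end Deformation

/-! ### Metric graphs -/

section MetricGraph

variable {V : Type u}

/-- Barycentric coordinates of the point at relative position `s ∈ [0, 1]` on the edge from `u`
to `v`. -/
def edgePoint (u v : V) (s : ℝ) : V →₀ ℝ := Finsupp.single u (1 - s) + Finsupp.single v s

/-- The geometric realization of the graph `Γ` (its vertices and the points of its edges, in
barycentric coordinates), whose edge between `u` and `v` is given the length `len u v`. -/
structure MetricGraph (Γ : SimpleGraph V) (len : V → V → ℝ) : Type u where
  coords : V →₀ ℝ
  mem : ∃ u v : V, ∃ s ∈ Icc (0 : ℝ) 1, (u = v ∨ Γ.Adj u v) ∧ coords = edgePoint u v s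

namespace MetricGraph

variable {Γ : SimpleGraph V} {len : V → V → ℝ}

/-- A vertex, as a point of the metric graph. -/
def vertex (Γ : SimpleGraph V) (len : V → V → ℝ) (v : V) : MetricGraph Γ len where
  coords := Finsupp.single v 1
  mem := ⟨v, v, 0, ⟨le_rfl, zero_le_one⟩, Or.inl rfl, by simp [edgePoint]⟩

/-- `p` and `q` lie on a common closed edge, and the part of that edge between them has
length `c`. -/
def Segment (p q : MetricGraph Γ len) (c : ℝ≥0∞) : Prop :=
  ∃ u v : V, Γ.Adj u v ∧ ∃ s ∈ Icc (0 : ℝ) 1, ∃ r ∈ Icc (0 : ℝ) 1,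
    p.coords = edgePoint u v s ∧ q.coords = edgePoint u v r ∧
      c = ENNReal.ofReal (len u v * |s - r|)

/-- `HasRoute p q c`: there is a piecewise linear path of total length `c` from `p` to `q`. -/
inductive HasRoute : MetricGraph Γ len → MetricGraph Γ len → ℝ≥0∞ → Prop
  | nil (p : MetricGraph Γ len) : HasRoute p p 0
  | cons {p q r : MetricGraph Γ len} {c d : ℝ≥0∞} (h : Segment p q c) (t : HasRoute q r d) :
      HasRoute p r (c + d)

lemma Segment.symm {p q : MetricGraph Γ len} {c : ℝ≥0∞} (h : Segment p q c) : Segment q p c := by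
  obtain ⟨u, v, ha, s, hs, r, hr, hp, hq, rfl⟩ := h
  exact ⟨u, v, ha, r, hr, s, hs, hq, hp, by rw [abs_sub_comm]⟩

lemma HasRoute.append {p q r : MetricGraph Γ len} {c d : ℝ≥0∞} (h : HasRoute p q c)
    (h' : HasRoute q r d) : HasRoute p r (c + d) := by
  induction h with
  | nil p => simpa using h'
  | cons hs _ ih => rw [add_assoc]; exact .cons hs (ih h')

lemma HasRoute.symm {p q : MetricGraph Γ len} {c : ℝ≥0∞} (h : HasRoute p q c) :
    HasRoute q p c := by
  induction h with
  | nil p => exact .nil p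
  | cons hs _ ih =>
    have h1 := ih.append (HasRoute.cons hs.symm (.nil _))
    rwa [add_zero, add_comm] at h1

/-- The path metric: the infimum of the lengths of the piecewise linear paths. -/
instance : PseudoEMetricSpace (MetricGraph Γ len) where
  edist p q := ⨅ (c : ℝ≥0∞) (_ : HasRoute p q c), c
  edist_self p := le_antisymm (iInf₂_le 0 (HasRoute.nil p)) bot_le
  edist_comm p q := le_antisymm (le_iInf₂ fun c h => iInf₂_le c h.symm)
    (le_iInf₂ fun c h => iInf₂_le c h.symm)
  edist_triangle p q r := by
    simp only [ENNReal.iInf_add, ENNReal.add_iInf]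
    exact le_iInf fun d => le_iInf fun h' => le_iInf fun c => le_iInf fun h =>
      iInf₂_le _ (h.append h')

end MetricGraph

end MetricGraph

/-! ### Hyperbolic fillings -/

/-- The vertex sets of a hyperbolic filling of `X` with parameter `α`: an increasing sequence of
finite maximal `α ^ n`-separated subsets `A n` of `X`. -/
structure Filling (X : Type u) [MetricSpace X] (α : ℝ) where
  A : ℕ → Finset X
  mono : ∀ n, A n ⊆ A (n + 1)
  separated : ∀ n, ∀ x ∈ A n, ∀ y ∈ A n, x ≠ y → α ^ n ≤ dist x y
  cover : ∀ n, ∀ x : X, ∃ a ∈ A n, x ∈ ball a (α ^ n)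

namespace Filling

variable {X : Type u} [MetricSpace X] {α : ℝ}

/-- The vertices of level `n`. -/
abbrev V (F : Filling X α) (n : ℕ) : Type u := {x : X // x ∈ F.A n}

/-- All vertices: pairs `(x, n)` with `x ∈ A n`. -/
abbrev Vertex (F : Filling X α) : Type u := Σ n : ℕ, F.V n

variable {F : Filling X α}

/-- Horizontal adjacency `(x, n) ∼ (y, n)`, with the convention `u ∼ u`. -/
def HAdj {n : ℕ} (u v : F.V n) : Prop :=
  u = v ∨ (ball u.1 (4 * α ^ n) ∩ ball v.1 (4 * α ^ n)).Nonempty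

/-- Vertical adjacency `(x, n) ∼ (y, n + 1)`. -/
def VAdj {n : ℕ} (u : F.V n) (v : F.V (n + 1)) : Prop :=
  (ball u.1 (α ^ n) ∩ ball v.1 (α ^ (n + 1))).Nonempty

variable (F) in
/-- A choice of the tree of vertical edges: every vertex `(y, n + 1)` is joined to exactly one
vertex `(x, n)`, its parent, where `x` is a point of `A n` nearest to `y`. -/
structure Parents where
  parent : ∀ {n : ℕ}, F.V (n + 1) → F.V n
  adj : ∀ {n : ℕ} (v : F.V (n + 1)), VAdj (parent v) v
  nearest : ∀ {n : ℕ} (v : F.V (n + 1)) (u : F.V n), dist (parent v).1 v.1 ≤ dist u.1 v.1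

variable (F) in
/-- Weights `σ : V ∖ {o} → [0, ∞)`; here `σ n` is the restriction of the weight to level
`n + 1`. -/
abbrev Weight : Type u := ∀ n : ℕ, F.V (n + 1) → ℝ≥0

/-- The admissibility condition: along every horizontal path `x 0 ∼ ⋯ ∼ x N` of level `n + 1`
that leads from `B(y, α ^ n)` out of `B(y, 2 α ^ n)`, the sum of the weights is at least `1`. -/
def Admissible (σ : F.Weight) : Prop :=
  ∀ (n : ℕ) (y : F.V n) (N : ℕ) (x : ℕ → F.V (n + 1)),
    (∀ j < N, HAdj (x j) (x (j + 1))) →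
    (ball y.1 (α ^ n) ∩ ball (x 0).1 (4 * α ^ (n + 1))).Nonempty →
    ((ball y.1 (2 * α ^ n))ᶜ ∩ ball (x N).1 (4 * α ^ (n + 1))).Nonempty →
    1 ≤ ∑ j ∈ Finset.range (N + 1), σ n (x j)

/-- `ν(u) = 2 sup {σ(w) : u ∼ v ∼ w}` for `u` of level `n + 1` (a supremum over a finite set). -/
def nu (σ : F.Weight) {n : ℕ} (u : F.V (n + 1)) : ℝ :=
  2 * sSup {r : ℝ | ∃ v w : F.V (n + 1), HAdj u v ∧ HAdj v w ∧ r = σ n w}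

/-- `μ(u) = η ∨ ν(u) ∧ (1 - η)`. -/
def mu (σ : F.Weight) (η : ℝ) {n : ℕ} (u : F.V (n + 1)) : ℝ := max η (min (nu σ u) (1 - η))

open Classical in
/-- The correction step at one level: `v` keeps the value `p v` unless some neighbour `v'` has
`p v' > η⁻¹ p v`; in that case the new value is `η` times the largest such `p v'`. -/
def adjust (η : ℝ) {n : ℕ} (p : F.V n → ℝ) (v : F.V n) : ℝ :=
  if ∃ v', HAdj v' v ∧ η⁻¹ * p v < p v' then
    η * sSup {r : ℝ | ∃ v', HAdj v' v ∧ η⁻¹ * p v < p v' ∧ r = p v'}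
  else p v

/-- The function `π`: it is `1` at the root, and at level `n + 1` it is the correction of
`π'(u) = π(parent of u) μ(u)`. -/
def piLevel (g : F.Parents) (σ : F.Weight) (η : ℝ) : ∀ n : ℕ, F.V n → ℝ
  | 0 => fun _ => 1
  | n + 1 => adjust η fun u => piLevel g σ η n (g.parent u) * mu σ η u

/-- `ϱ(u) = π(u) / π(parent of u)` (and `1` at the root, where it is not used). -/
def rho (g : F.Parents) (σ : F.Weight) (η : ℝ) : F.Vertex → ℝ
  | ⟨0, _⟩ => 1
  | ⟨n + 1, u⟩ => piLevel g σ η (n + 1) u / piLevel g σ η n (g.parent u)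

/-- The generating relation of the graph `(V, ∼_Z)`: all horizontal edges, and the edges from
the vertices to their parents. -/
inductive ZRel (g : F.Parents) : F.Vertex → F.Vertex → Prop
  | horizontal {n : ℕ} (u v : F.V n) (h : HAdj u v) : ZRel g ⟨n, u⟩ ⟨n, v⟩
  | vertical {n : ℕ} (v : F.V (n + 1)) : ZRel g ⟨n, g.parent v⟩ ⟨n + 1, v⟩

/-- The graph `(V, ∼_Z)` (without loops). -/
def ZGraph (g : F.Parents) : SimpleGraph F.Vertex := SimpleGraph.fromRel (ZRel g)

/-- Edge lengths: `2 log (1/η)` for horizontal edges, and `log (1/ϱ(u))` for the vertical edge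
from `u` to its parent. -/
def edgeLen (g : F.Parents) (σ : F.Weight) (η : ℝ) (u v : F.Vertex) : ℝ :=
  if u.1 = v.1 then 2 * Real.log (1 / η)
  else if u.1 < v.1 then Real.log (1 / rho g σ η v)
  else Real.log (1 / rho g σ η u)

/-- The metric graph `(Z, d_ϱ)`. -/
abbrev Z (g : F.Parents) (σ : F.Weight) (η : ℝ) : Type u :=
  MetricGraph (ZGraph g) (edgeLen g σ η)

/-- A vertex as a point of `Z`. -/
abbrev toZ (g : F.Parents) (σ : F.Weight) (η : ℝ) (u : F.Vertex) : Z g σ η :=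
  MetricGraph.vertex (ZGraph g) (edgeLen g σ η) u

/-- The bijections `Ψ : X → ∂_∞(Z, d_ϱ)` and `ι : X → ∂_ε Z` are the natural identifications:
if `u j = (x_j, m_j)` are vertices with `m_j → ∞` and `x_j → x` in `X`, then `(u j)` converges to
infinity and represents `Ψ x`, and `u j → ι x` in the completion of `(Z, d_ε)`. -/
def IsNatural (g : F.Parents) (σ : F.Weight) (η : ℝ) (o : F.Vertex) (ε : ℝ)
    (Ψ : X ≃ GromovBoundary (toZ g σ η o)) (ι : X ≃ DeformBoundary (toZ g σ η o) ε) : Prop :=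
  ∀ (x : X) (u : ℕ → F.Vertex), Tendsto (fun j => (u j).1) atTop atTop →
    Tendsto (fun j => (u j).2.1) atTop (𝓝 x) →
    (∃ hs : IsGromovSeq (toZ g σ η o) (fun j => toZ g σ η (u j)),
      GromovBoundary.mk _ hs = Ψ x) ∧
    Tendsto (fun j => toCompletion (toZ g σ η o) ε (toZ g σ η (u j))) atTop (𝓝 (ι x).1)

end Filling

end

/-!
# Conformal deformations of hyperbolic fillings

Write `V` for the vertices of the filling, `Z` for the metric graph, `o` for the root and `(·, ·)`
for the Gromov product at `o`. Everything is compared with the function `π` on `V`, for which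
`π u = e ^ (-d(o, u))` (`Filling.edist_root`): for a vertex `a` of level `n` and points `x`, `y` of
`X` close to `a` whose distance is about `α ^ n`, both `d₁(x, y)` and `e ^ (-(x, y))` are comparable
with `π a`. All four assertions about `d₁` follow from this.

*Elementary facts.* The correction step in the definition of `π` makes the values at neighbours
comparable with ratio at most `1 / η` (`Filling.piLevel_hAdj`), and `π` of a child is between `η`
and `1 - η` times `π` of its parent. Hence the values at the ancestors of a vertex form a sequence
between two geometric ones.

*Upper bounds.* The path that descends the tree from a vertex near `a` to level `n` and then uses
one horizontal edge has length at most a constant times `π a` in the metric `d₁`, by summing a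
geometric series (`Filling.deformDist_le_of_near`), and the same path bounds the distance in `Z`
and thus the Gromov product (`Filling.le_gromovProd_of_near`).

*Lower bounds.* This is where admissibility of the weight is used. For every vertex `w` there is
a function on `V` that vanishes at the descendants of `w`, is a constant of order `π w` at all
vertices far from `w` at the scale of `w` or above its level, and whose increment along every edge
at `u` is at most a multiple of `π u` (`Filling.exists_potential`). It is built level by level,
each time taking the largest extension with the required horizontal increments. Admissibility
enters through the fact that a horizontal chain of level `n + 1` that crosses an annulus around a
vertex `z` of level `n` has total weight at least the minimum of `π` over the neighbours of `z`
(`Filling.piMin_le_sum`), so that refining a chain does not make it shorter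
(`Filling.exists_le_chain_value`). The affine extension of this function to `Z` has the upper
gradient `K e ^ (-d(o, ·))`; its increment from `p` to `q` is therefore at most a multiple of
`d₁(p, q)`, and also of `e ^ (-(p, q))`, because the integral of `e ^ (-d(o, ·))` along a nearly
shortest path is of that order (`MetricGraph.IsControlled`).

*Hyperbolicity.* Given three vertices `u`, `v`, `t`, the deepest ancestor of `t` to which both `u`
and `v` are close gives the four point condition: the upper bounds apply to it, and the lower
bounds to its successor (`Filling.min_gromovProd_le`).

*Boundaries.* The two bounds show that sequences of vertices converging to `x` in `X` converge in
both senses, and that different points of `X` have different limits. Every point of either boundary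
arises, because `X` is compact and a sequence of points of `Z` that represents a boundary point has
levels tending to infinity: for the Gromov boundary since the distance from `o` is at most a
multiple of the level, and for `∂₁ Z` since finitely many vertices with their edges form a compact
set in the completion.

*Dimension.* The balls of level `n` cover `X`, and their `d₁`-diameters are at most `C π u`; hence
the Hausdorff measure of dimension `p` vanishes if the sums of `π ^ p` tend to zero. The exponent
`p` is then automatically positive.
-/

noncomputable section

/-! ### Geometry of metric graphs -/

/-- The variation of a map only depends on the distances between its values. -/
lemma eVariationOn_eq_of_edist_eq {E E' : Type*} [PseudoEMetricSpace E] [PseudoEMetricSpace E']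
    {f : ℝ → E} {f' : ℝ → E'} {s : Set ℝ}
    (h : ∀ x ∈ s, ∀ y ∈ s, edist (f x) (f y) = edist (f' x) (f' y)) :
    eVariationOn f s = eVariationOn f' s := by
  unfold eVariationOn
  refine iSup_congr fun p => Finset.sum_congr rfl fun i _ => ?_
  exact h _ (p.2.2.2 _) _ (p.2.2.2 _)

lemma hasUnitSpeedOn_of_edist_eq {E : Type*} [PseudoEMetricSpace E] {f : ℝ → E} {a b : ℝ}
    (h : ∀ x ∈ Icc a b, ∀ y ∈ Icc a b, edist (f x) (f y) = edist x y) :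
    HasUnitSpeedOn f (Icc a b) := by
  unfold HasUnitSpeedOn
  rw [hasConstantSpeedOnWith_iff_ordered]
  intro x hx y hy hxy
  have hsub : Icc a b ∩ Icc x y = Icc x y :=
    inter_eq_right.2 (Icc_subset_Icc hx.1 hy.2)
  rw [hsub, eVariationOn_eq_of_edist_eq (f' := (id : ℝ → ℝ))
    fun s hs t ht => h s ⟨hx.1.trans hs.1, hs.2.trans hy.2⟩ t ⟨hx.1.trans ht.1, ht.2.trans hy.2⟩]
  simp

namespace MetricGraph

variable {V : Type u} {Γ : SimpleGraph V} {len : V → V → ℝ}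

@[ext]
lemma ext_coords {p q : MetricGraph Γ len} (h : p.coords = q.coords) : p = q := by
  cases p; cases q; congr

lemma edist_le_of_route {p q : MetricGraph Γ len} {c : ℝ≥0∞} (h : HasRoute p q c) :
    edist p q ≤ c := iInf₂_le c h

lemma Segment.hasRoute {p q : MetricGraph Γ len} {c : ℝ≥0∞} (h : Segment p q c) :
    HasRoute p q c := by
  simpa using HasRoute.cons h (.nil q)

lemma edist_le_of_segment {p q : MetricGraph Γ len} {c : ℝ≥0∞} (h : Segment p q c) :
    edist p q ≤ c := edist_le_of_route h.hasRoute

lemma le_edist {p q : MetricGraph Γ len} {a : ℝ≥0∞} (h : ∀ c, HasRoute p q c → a ≤ c) :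
    a ≤ edist p q := le_iInf₂ h

/-- A function that is `1`-Lipschitz along segments is `1`-Lipschitz. -/
lemma ofReal_abs_sub_le_edist (f : MetricGraph Γ len → ℝ)
    (h : ∀ p q c, Segment p q c → ENNReal.ofReal |f p - f q| ≤ c) (p q : MetricGraph Γ len) :
    ENNReal.ofReal |f p - f q| ≤ edist p q := by
  refine le_edist fun c hc => ?_
  induction hc with
  | nil p => simp
  | @cons p q r c d hs _ ih =>
    calc ENNReal.ofReal |f p - f r|
        ≤ ENNReal.ofReal (|f p - f q| + |f q - f r|) :=
          ENNReal.ofReal_le_ofReal (abs_sub_le _ _ _)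
      _ ≤ c + d := by
          rw [ENNReal.ofReal_add (abs_nonneg _) (abs_nonneg _)]
          exact add_le_add (h _ _ _ hs) ih

lemma Segment.ne_top {p q : MetricGraph Γ len} {c : ℝ≥0∞} (h : Segment p q c) : c ≠ ⊤ := by
  obtain ⟨u, v, ha, s, hs, r, hr, hp, hq, rfl⟩ := h
  exact ENNReal.ofReal_ne_top

lemma HasRoute.ne_top {p q : MetricGraph Γ len} {c : ℝ≥0∞} (h : HasRoute p q c) : c ≠ ⊤ := by
  induction h with
  | nil p => simp
  | cons hs _ ih => exact ENNReal.add_ne_top.2 ⟨hs.ne_top, ih⟩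

/-- If all edges have length at most `M`, a route can be cut at every time `t`, up to an
error `M`. -/
lemma HasRoute.exists_cut {M : ℝ} (hM : 0 ≤ M)
    (hlen : ∀ (p q : MetricGraph Γ len) (c : ℝ≥0∞), Segment p q c → c ≤ ENNReal.ofReal M)
    {p q : MetricGraph Γ len} {c : ℝ≥0∞}
    (h : HasRoute p q c) : ∀ t : ℝ, 0 ≤ t → t ≤ c.toReal →
    ∃ (r : MetricGraph Γ len) (a b : ℝ≥0∞), HasRoute p r a ∧ HasRoute r q b ∧
      a.toReal ≤ t ∧ b.toReal ≤ c.toReal - t + M := by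
  induction h with
  | nil p =>
    intro t ht htc
    refine ⟨p, 0, 0, .nil p, .nil p, by simpa using ht, ?_⟩
    simp only [ENNReal.toReal_zero] at htc ⊢
    linarith
  | @cons p q r c d hs ht' ih =>
    intro t ht htc
    have hadd : (c + d).toReal = c.toReal + d.toReal :=
      ENNReal.toReal_add hs.ne_top ht'.ne_top
    rw [hadd] at htc ⊢
    rcases lt_or_ge t c.toReal with h1 | h1
    · refine ⟨p, 0, c + d, .nil p, .cons hs ht', by simpa using ht, ?_⟩
      have : c.toReal ≤ M := ENNReal.toReal_le_of_le_ofReal hM (hlen _ _ _ hs)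
      rw [hadd]
      linarith
    · obtain ⟨m, a, b, ha, hb, hat, hbt⟩ := ih (t - c.toReal) (by linarith) (by linarith)
      refine ⟨m, c + a, b, .cons hs ha, hb, ?_, by linarith⟩
      rw [ENNReal.toReal_add hs.ne_top ha.ne_top]
      linarith

/-- The point at relative position `s` (clamped to `[0, 1]`) on an edge. -/
def edgeAt (len : V → V → ℝ) {u v : V} (h : Γ.Adj u v) (s : ℝ) : MetricGraph Γ len where
  coords := edgePoint u v (projIcc 0 1 zero_le_one s)
  mem := ⟨u, v, projIcc 0 1 zero_le_one s, (projIcc 0 1 zero_le_one s).2, Or.inr h, rfl⟩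

lemma edgeAt_coords {u v : V} (h : Γ.Adj u v) {s : ℝ} (hs : s ∈ Icc (0 : ℝ) 1) :
    (edgeAt len h s).coords = edgePoint u v s := by
  simp only [edgeAt]
  rw [projIcc_of_mem zero_le_one hs]

lemma edgeAt_zero {u v : V} (h : Γ.Adj u v) : edgeAt len h 0 = vertex Γ len u := by
  ext1
  rw [edgeAt_coords h ⟨le_rfl, zero_le_one⟩]
  simp [edgePoint, vertex]

lemma edgeAt_one {u v : V} (h : Γ.Adj u v) : edgeAt len h 1 = vertex Γ len v := by
  ext1
  rw [edgeAt_coords h ⟨zero_le_one, le_rfl⟩]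
  simp [edgePoint, vertex]

lemma segment_edgeAt {u v : V} (h : Γ.Adj u v) {s r : ℝ} (hs : s ∈ Icc (0 : ℝ) 1)
    (hr : r ∈ Icc (0 : ℝ) 1) :
    Segment (edgeAt len h s) (edgeAt len h r) (ENNReal.ofReal (len u v * |s - r|)) :=
  ⟨u, v, h, s, hs, r, hr, edgeAt_coords h hs, edgeAt_coords h hr, rfl⟩

lemma Segment.exists_edgeAt {p q : MetricGraph Γ len} {c : ℝ≥0∞} (h : Segment p q c) :
    ∃ (u v : V) (ha : Γ.Adj u v) (s r : ℝ), s ∈ Icc (0 : ℝ) 1 ∧ r ∈ Icc (0 : ℝ) 1 ∧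
      p = edgeAt len ha s ∧ q = edgeAt len ha r ∧ c = ENNReal.ofReal (len u v * |s - r|) := by
  obtain ⟨u, v, ha, s, hs, r, hr, hp, hq, rfl⟩ := h
  exact ⟨u, v, ha, s, r, hs, hr, ext_coords (by rw [hp, edgeAt_coords ha hs]),
    ext_coords (by rw [hq, edgeAt_coords ha hr]), rfl⟩

/-- The tent function of the edge `u v`: the distance to the nearest endpoint on this edge, and
zero on all other edges. -/
def tent (u v : V) (p : MetricGraph Γ len) : ℝ := len u v * min (p.coords u) (p.coords v)

lemma abs_min_sub_min_le (s r : ℝ) : |min s (1 - s) - min r (1 - r)| ≤ |s - r| := by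
  rcases min_cases s (1 - s) with h | h <;> rcases min_cases r (1 - r) with h' | h' <;>
    rw [h.1, h'.1, abs_le] <;> rcases abs_cases (s - r) with h'' | h'' <;>
    constructor <;> linarith

lemma tent_edgeAt_of_ne {u v a b : V} (huv : u ≠ v) (hab : Γ.Adj a b)
    (h : ¬ ((a = u ∧ b = v) ∨ (a = v ∧ b = u))) {s : ℝ} (hs : s ∈ Icc (0 : ℝ) 1) :
    tent u v (edgeAt len hab s) = 0 := by
  classical
  have hne := hab.ne
  rw [tent, edgeAt_coords hab hs]
  have h0 : ∀ w, w ≠ a → w ≠ b → edgePoint a b s w = 0 := fun w h1 h2 => by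
    simp [edgePoint, h1.symm, h2.symm]
  have hnn : ∀ w, 0 ≤ edgePoint a b s w := fun w => by
    simp only [edgePoint, Finsupp.add_apply, Finsupp.single_apply]
    split_ifs <;> linarith [hs.1, hs.2]
  have : min (edgePoint a b s u) (edgePoint a b s v) = 0 := by
    by_cases hu : u ≠ a ∧ u ≠ b
    · rw [h0 u hu.1 hu.2]; exact min_eq_left (hnn v)
    · have hv : v ≠ a ∧ v ≠ b := by grind
      rw [h0 v hv.1 hv.2]; exact min_eq_right (hnn u)
  rw [this, mul_zero]

lemma tent_edgeAt {u v : V} (h : Γ.Adj u v) {s : ℝ} (hs : s ∈ Icc (0 : ℝ) 1) :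
    tent u v (edgeAt len h s) = len u v * min s (1 - s) := by
  rw [tent, edgeAt_coords h hs, min_comm]
  simp [edgePoint, h.ne, h.ne.symm]

lemma tent_comm (hsym : ∀ u v, len u v = len v u) (u v : V) (p : MetricGraph Γ len) :
    tent u v p = tent v u p := by
  rw [tent, tent, hsym u v, min_comm]

/-- The tent function is `1`-Lipschitz for the path metric. -/
lemma abs_tent_sub_le (hsym : ∀ u v, len u v = len v u) {u v : V} (h : Γ.Adj u v)
    (hlen : 0 ≤ len u v) (p q : MetricGraph Γ len) :
    ENNReal.ofReal |tent u v p - tent u v q| ≤ edist p q := by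
  refine ofReal_abs_sub_le_edist _ (fun p q c hc => ?_) p q
  obtain ⟨a, b, hab, s, r, hs, hr, rfl, rfl, rfl⟩ := hc.exists_edgeAt
  by_cases h1 : (a = u ∧ b = v) ∨ (a = v ∧ b = u)
  · refine ENNReal.ofReal_le_ofReal ?_
    rcases h1 with ⟨rfl, rfl⟩ | ⟨rfl, rfl⟩
    · rw [tent_edgeAt hab hs, tent_edgeAt hab hr, ← mul_sub, abs_mul, abs_of_nonneg hlen]
      exact mul_le_mul_of_nonneg_left (abs_min_sub_min_le s r) hlen
    · rw [tent_comm hsym, tent_comm hsym b a, tent_edgeAt hab hs, tent_edgeAt hab hr, ← mul_sub,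
        abs_mul, hsym a b, abs_of_nonneg hlen]
      exact mul_le_mul_of_nonneg_left (abs_min_sub_min_le s r) hlen
  · rw [tent_edgeAt_of_ne h.ne hab h1 hs, tent_edgeAt_of_ne h.ne hab h1 hr]
    simp

/-- Each half of an edge is embedded isometrically. (A whole edge need not be.) -/
lemma edist_edgeAt (hsym : ∀ u v, len u v = len v u) {u v : V} (h : Γ.Adj u v)
    (hlen : 0 ≤ len u v) {s r : ℝ} (hs : s ∈ Icc (0 : ℝ) 1) (hr : r ∈ Icc (0 : ℝ) 1)
    (hsr : (s ≤ 1 / 2 ∧ r ≤ 1 / 2) ∨ (1 / 2 ≤ s ∧ 1 / 2 ≤ r)) :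
    edist (edgeAt len h s) (edgeAt len h r) = ENNReal.ofReal (len u v * |s - r|) := by
  refine le_antisymm (edist_le_of_segment (segment_edgeAt h hs hr)) ?_
  have := abs_tent_sub_le hsym h hlen (edgeAt len h s) (edgeAt len h r)
  rw [tent_edgeAt h hs, tent_edgeAt h hr, ← mul_sub, abs_mul, abs_of_nonneg hlen] at this
  refine le_of_eq_of_le ?_ this
  congr 2
  rcases hsr with ⟨h1, h2⟩ | ⟨h1, h2⟩
  · rw [min_eq_left (by linarith), min_eq_left (by linarith)]
  · rw [min_eq_right (by linarith), min_eq_right (by linarith), ← abs_neg]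
    congr 1; ring

/-- On each half of an edge the parameterization of the edge is an admissible path for
`deformDist`. -/
lemma deformDist_half_edge_le (hsym : ∀ u v, len u v = len v u) {u v : V} (h : Γ.Adj u v)
    (hlen : 0 < len u v) {o : MetricGraph Γ len} {ε M : ℝ} (hM : 0 ≤ M)
    (hd : ∀ s, deformDensity o ε (edgeAt len h s) ≤ ENNReal.ofReal M) {s r : ℝ}
    (hs : s ∈ Icc (0 : ℝ) 1) (hr : r ∈ Icc (0 : ℝ) 1) (hle : s ≤ r)
    (hsr : (s ≤ 1 / 2 ∧ r ≤ 1 / 2) ∨ (1 / 2 ≤ s ∧ 1 / 2 ≤ r)) :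
    deformDist o ε (edgeAt len h s) (edgeAt len h r) ≤ ENNReal.ofReal (M * (len u v * (r - s))) := by
  refine iInf_le_of_le (len u v * s) (iInf_le_of_le (len u v * r)
    (iInf_le_of_le (fun t => edgeAt len h (t / len u v)) (iInf_le_of_le ⟨?_, ?_, ?_, ?_⟩ ?_)))
  · exact mul_le_mul_of_nonneg_left hle hlen.le
  · have key : ∀ x ∈ Icc (len u v * s) (len u v * r), s ≤ x / len u v ∧ x / len u v ≤ r := by
      rintro x ⟨h1, h2⟩
      rw [le_div_iff₀ hlen, div_le_iff₀ hlen]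
      constructor <;> linarith
    refine hasUnitSpeedOn_of_edist_eq fun x hx y hy => ?_
    obtain ⟨hx1, hx2⟩ := key x hx
    obtain ⟨hy1, hy2⟩ := key y hy
    rw [edist_edgeAt hsym h hlen.le ⟨by linarith [hs.1], by linarith [hr.2]⟩
      ⟨by linarith [hs.1], by linarith [hr.2]⟩ (by grind), edist_dist, Real.dist_eq, ← sub_div,
      abs_div, abs_of_pos hlen, mul_div_cancel₀ _ hlen.ne']
  · simp [mul_div_cancel_left₀ _ hlen.ne']
  · simp [mul_div_cancel_left₀ _ hlen.ne']
  · calc _ ≤ ∫⁻ _ in Icc (len u v * s) (len u v * r), ENNReal.ofReal M :=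
          lintegral_mono fun t => hd _
      _ = ENNReal.ofReal (M * (len u v * (r - s))) := by
          rw [setLIntegral_const, Real.volume_Icc, ← ENNReal.ofReal_mul hM, mul_sub (len u v)]

/-- A bound for `d_ε` on an edge in terms of a bound for the density. The parameterization of the
whole edge need not have unit speed, so it is split at the midpoint. -/
lemma deformDist_edge_le (hsym : ∀ u v, len u v = len v u) {u v : V} (h : Γ.Adj u v)
    (hlen : 0 < len u v) {o : MetricGraph Γ len} {ε M : ℝ} (hM : 0 ≤ M)
    (hd : ∀ s, deformDensity o ε (edgeAt len h s) ≤ ENNReal.ofReal M) {s r : ℝ}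
    (hs : s ∈ Icc (0 : ℝ) 1) (hr : r ∈ Icc (0 : ℝ) 1) :
    deformDist o ε (edgeAt len h s) (edgeAt len h r) ≤ ENNReal.ofReal (M * (len u v * |s - r|)) := by
  wlog hle : s ≤ r generalizing s r
  · rw [abs_sub_comm]
    exact (deformDist_comm_le _ _ _ _).trans (this hr hs (le_of_not_ge hle))
  rw [abs_sub_comm, abs_of_nonneg (sub_nonneg.2 hle)]
  by_cases hsr : (s ≤ 1 / 2 ∧ r ≤ 1 / 2) ∨ (1 / 2 ≤ s ∧ 1 / 2 ≤ r)
  · exact deformDist_half_edge_le hsym h hlen hM hd hs hr hle hsr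
  · have h1 : s < 1 / 2 ∧ 1 / 2 < r := by grind
    have hm : (1 / 2 : ℝ) ∈ Icc (0 : ℝ) 1 := by norm_num
    refine (deformDist_triangle o ε _ (edgeAt len h (1 / 2)) _).trans ?_
    refine (add_le_add
      (deformDist_half_edge_le hsym h hlen hM hd hs hm h1.1.le (Or.inl ⟨h1.1.le, le_rfl⟩))
      (deformDist_half_edge_le hsym h hlen hM hd hm hr h1.2.le (Or.inr ⟨le_rfl, h1.2.le⟩))).trans ?_
    rw [← ENNReal.ofReal_add]
    · exact ENNReal.ofReal_le_ofReal (by linarith)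
    · exact mul_nonneg hM (mul_nonneg hlen.le (by linarith))
    · exact mul_nonneg hM (mul_nonneg hlen.le (by linarith))

/-- The extension of a function on the vertices that is affine on the edges. -/
def affineExt (f : V → ℝ) (p : MetricGraph Γ len) : ℝ := Finsupp.linearCombination ℝ f p.coords

lemma affineExt_vertex (f : V → ℝ) (v : V) : affineExt f (vertex Γ len v) = f v := by
  simp [affineExt, vertex]

lemma affineExt_edgeAt (f : V → ℝ) {u v : V} (h : Γ.Adj u v) {s : ℝ} (hs : s ∈ Icc (0 : ℝ) 1) :
    affineExt f (edgeAt len h s) = (1 - s) * f u + s * f v := by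
  rw [affineExt, edgeAt_coords h hs, edgePoint, map_add, Finsupp.linearCombination_single,
    Finsupp.linearCombination_single, smul_eq_mul, smul_eq_mul]

lemma affineExt_edgeAt_sub (f : V → ℝ) {u v : V} (h : Γ.Adj u v) {s r : ℝ}
    (hs : s ∈ Icc (0 : ℝ) 1) (hr : r ∈ Icc (0 : ℝ) 1) :
    |affineExt f (edgeAt len h s) - affineExt f (edgeAt len h r)| = |s - r| * |f u - f v| := by
  rw [affineExt_edgeAt f h hs, affineExt_edgeAt f h hr, ← abs_mul, ← abs_neg]
  congr 1; ring

/-- Every point of a metric graph is a vertex or a point of an edge. -/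
lemma exists_eq_vertex_or_edgeAt (p : MetricGraph Γ len) :
    (∃ v, p = vertex Γ len v) ∨
      ∃ (u v : V) (h : Γ.Adj u v), ∃ s ∈ Icc (0 : ℝ) 1, p = edgeAt len h s := by
  obtain ⟨u, v, s, hs, h | h, hp⟩ := p.mem
  · refine Or.inl ⟨u, ext_coords ?_⟩
    subst h
    rw [hp, edgePoint, ← Finsupp.single_add]
    simp [vertex]
  · exact Or.inr ⟨u, v, h, s, hs, ext_coords (by rw [hp, edgeAt_coords h hs])⟩

end MetricGraph

/-! ### The weights `π` on a hyperbolic filling -/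

namespace Filling

variable {X : Type u} [MetricSpace X] {α η : ℝ} {F : Filling X α}

/-- The parameters `α` and `η` are positive and below the thresholds `1 / 100` and `1 / 4`. -/
structure IsSmall (α η : ℝ) : Prop where
  α_pos : 0 < α
  α_le : α ≤ 1 / 100
  η_pos : 0 < η
  η_le : η ≤ 1 / 4

lemma IsSmall.pow_pos (hs : IsSmall α η) (n : ℕ) : 0 < α ^ n := _root_.pow_pos hs.α_pos n

lemma IsSmall.pow_succ_le (hs : IsSmall α η) (n : ℕ) : α ^ (n + 1) ≤ α ^ n / 100 := by
  rw [pow_succ]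
  nlinarith [hs.pow_pos n, hs.α_le]

lemma IsSmall.pow_le_pow (hs : IsSmall α η) {m n : ℕ} (h : m ≤ n) : α ^ n ≤ α ^ m :=
  pow_le_pow_of_le_one hs.α_pos.le (by linarith [hs.α_le]) h

lemma HAdj.dist_lt (hs : IsSmall α η) {n : ℕ} {u v : F.V n} (h : HAdj u v) :
    dist u.1 v.1 < 8 * α ^ n := by
  have := hs.pow_pos n
  rcases h with rfl | ⟨z, hz, hz'⟩
  · simpa using this
  · rw [mem_ball] at hz hz'
    linarith [dist_triangle_left u.1 v.1 z]

lemma HAdj.refl {n : ℕ} (u : F.V n) : HAdj u u := Or.inl rfl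

lemma HAdj.symm {n : ℕ} {u v : F.V n} (h : HAdj u v) : HAdj v u := by
  rcases h with h | h
  · exact Or.inl h.symm
  · exact Or.inr (by rwa [inter_comm])

lemma hAdj_of_dist_lt {n : ℕ} {u v : F.V n} (h : dist u.1 v.1 < 4 * α ^ n) : HAdj u v :=
  Or.inr ⟨u.1, mem_ball_self (dist_nonneg.trans_lt h), h⟩

lemma dist_parent_lt (g : F.Parents) {n : ℕ} (v : F.V (n + 1)) :
    dist (g.parent v).1 v.1 < α ^ n := by
  obtain ⟨a, ha, hva⟩ := F.cover n v.1
  rw [mem_ball'] at hva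
  exact (g.nearest v ⟨a, ha⟩).trans_lt hva

lemma HAdj.parent (hs : IsSmall α η) (g : F.Parents) {n : ℕ} {u v w : F.V (n + 1)}
    (huv : HAdj u v) (hvw : HAdj v w) : HAdj (g.parent u) (g.parent w) := by
  refine hAdj_of_dist_lt ?_
  have h1 := huv.dist_lt hs
  have h2 := hvw.dist_lt hs
  have h3 := dist_parent_lt g u
  have h4 := dist_parent_lt g w
  have h5 := hs.pow_succ_le n
  have h6 := hs.pow_pos n
  have h7 := dist_triangle4 (g.parent u).1 u.1 w.1 (g.parent w).1
  have h8 := dist_triangle u.1 v.1 w.1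
  rw [dist_comm w.1] at h7
  linarith

section Adjust

variable {n : ℕ} {p : F.V n → ℝ}

lemma finite_adjust_set (p : F.V n → ℝ) (v : F.V n) :
    {r : ℝ | ∃ v', HAdj v' v ∧ η⁻¹ * p v < p v' ∧ r = p v'}.Finite :=
  (finite_range p).subset (by rintro r ⟨v', -, -, rfl⟩; exact ⟨v', rfl⟩)

lemma adjust_eq_or (η : ℝ) (p : F.V n → ℝ) (v : F.V n) :
    adjust η p v = p v ∨ ∃ v', HAdj v' v ∧ adjust η p v = η * p v' := by
  unfold adjust
  split_ifs with h
  · right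
    obtain ⟨v', h1, h2⟩ := h
    have hne : {r : ℝ | ∃ v', HAdj v' v ∧ η⁻¹ * p v < p v' ∧ r = p v'}.Nonempty :=
      ⟨p v', v', h1, h2, rfl⟩
    obtain ⟨w, hw, -, hw'⟩ := hne.csSup_mem (finite_adjust_set p v)
    exact ⟨w, hw, by rw [hw']⟩
  · exact Or.inl rfl

lemma le_adjust (hη : 0 < η) (p : F.V n → ℝ) (v : F.V n) : p v ≤ adjust η p v := by
  unfold adjust
  split_ifs with h
  · obtain ⟨v', h1, h2⟩ := h
    have h3 : p v' ≤ sSup {r : ℝ | ∃ v', HAdj v' v ∧ η⁻¹ * p v < p v' ∧ r = p v'} :=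
      le_csSup (finite_adjust_set p v).bddAbove ⟨v', h1, h2, rfl⟩
    rw [inv_mul_lt_iff₀ hη] at h2
    nlinarith
  · exact le_rfl

lemma mul_le_adjust (hη : 0 < η) (p : F.V n → ℝ) {v v' : F.V n} (h : HAdj v' v) :
    η * p v' ≤ adjust η p v := by
  by_cases h2 : η⁻¹ * p v < p v'
  · unfold adjust
    rw [if_pos ⟨v', h, h2⟩]
    exact mul_le_mul_of_nonneg_left
      (le_csSup (finite_adjust_set p v).bddAbove ⟨v', h, h2, rfl⟩) hη.le
  · rw [inv_mul_lt_iff₀ hη, not_lt] at h2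
    exact h2.trans (le_adjust hη p v)

end Adjust

section Pi

variable (g : F.Parents) (σ : F.Weight)

lemma le_mu {n : ℕ} (u : F.V (n + 1)) : η ≤ mu σ η u := le_max_left _ _

lemma mu_le (hs : IsSmall α η) {n : ℕ} (u : F.V (n + 1)) : mu σ η u ≤ 1 - η :=
  max_le (by linarith [hs.η_le]) (min_le_right _ _)

lemma le_nu {n : ℕ} {u w : F.V (n + 1)} (h : HAdj u w) : 2 * (σ n w : ℝ) ≤ nu σ u := by
  unfold nu
  refine mul_le_mul_of_nonneg_left (le_csSup ?_ ⟨w, w, h, .refl w, rfl⟩) zero_le_two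
  exact ((finite_range fun w => (σ n w : ℝ)).subset
    (by rintro r ⟨-, w, -, -, rfl⟩; exact ⟨w, rfl⟩)).bddAbove

lemma piLevel_pos (hs : IsSmall α η) : ∀ (n : ℕ) (u : F.V n), 0 < piLevel g σ η n u
  | 0, _ => one_pos
  | n + 1, u => (mul_pos (piLevel_pos hs n _) (hs.η_pos.trans_le (le_mu σ u))).trans_le
      (le_adjust hs.η_pos (fun u => piLevel g σ η n (g.parent u) * mu σ η u) u)

lemma mul_piLevel_parent_le (hs : IsSmall α η) {n : ℕ} (u : F.V (n + 1)) :
    piLevel g σ η n (g.parent u) * mu σ η u ≤ piLevel g σ η (n + 1) u :=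
  le_adjust hs.η_pos (fun u => piLevel g σ η n (g.parent u) * mu σ η u) u

/-- The correction step makes the values of `π` at neighbours comparable: one correction
suffices, because the parents of two vertices at distance two are neighbours. -/
lemma piLevel_hAdj (hs : IsSmall α η) : ∀ (n : ℕ) (u v : F.V n), HAdj u v →
    η * piLevel g σ η n u ≤ piLevel g σ η n v
  | 0, _, _, _ => by simp only [piLevel]; linarith [hs.η_le]
  | n + 1, u, v, h => by
    rcases adjust_eq_or η (fun u => piLevel g σ η n (g.parent u) * mu σ η u) u with h1 | ⟨u', h1, h2⟩
    · simp only [piLevel]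
      rw [h1]
      exact mul_le_adjust hs.η_pos (fun u => piLevel g σ η n (g.parent u) * mu σ η u) h
    · refine le_trans ?_ (mul_piLevel_parent_le g σ hs v)
      simp only [piLevel]
      rw [h2]
      have h3 := piLevel_hAdj hs n _ _ (h1.parent hs g h)
      have h4 := mu_le σ hs u'
      have h5 := le_mu (η := η) σ v
      have h6 := piLevel_pos g σ hs n (g.parent u')
      have h7 := piLevel_pos g σ hs n (g.parent v)
      have h8 := hs.η_pos
      calc η * (η * (piLevel g σ η n (g.parent u') * mu σ η u'))
          = η * (η * piLevel g σ η n (g.parent u')) * mu σ η u' := by ring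
        _ ≤ η * (η * piLevel g σ η n (g.parent u')) * 1 := by
            refine mul_le_mul_of_nonneg_left (by linarith) (by positivity)
        _ ≤ mu σ η v * piLevel g σ η n (g.parent v) := by
            rw [mul_one]
            exact mul_le_mul h5 h3 (by positivity) (h8.le.trans h5)
        _ = _ := mul_comm _ _

lemma piLevel_succ_le (hs : IsSmall α η) {n : ℕ} (u : F.V (n + 1)) :
    piLevel g σ η (n + 1) u ≤ (1 - η) * piLevel g σ η n (g.parent u) := by
  rcases adjust_eq_or η (fun u => piLevel g σ η n (g.parent u) * mu σ η u) u with h1 | ⟨u', h1, h2⟩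
  · simp only [piLevel]
    rw [h1, mul_comm]
    exact mul_le_mul_of_nonneg_right (mu_le σ hs u) (piLevel_pos g σ hs n _).le
  · simp only [piLevel]
    rw [h2]
    have h3 := piLevel_hAdj g σ hs n _ _ (h1.parent hs g (HAdj.refl u))
    have h4 := mu_le σ hs u'
    have h5 := piLevel_pos g σ hs n (g.parent u')
    have h6 := hs.η_le
    have h7 := hs.η_pos
    calc η * (piLevel g σ η n (g.parent u') * mu σ η u')
        = (η * piLevel g σ η n (g.parent u')) * mu σ η u' := by ring
      _ ≤ (η * piLevel g σ η n (g.parent u')) * (1 - η) :=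
          mul_le_mul_of_nonneg_left h4 (by positivity)
      _ ≤ _ := by
          rw [mul_comm]
          exact mul_le_mul_of_nonneg_left h3 (by linarith)

lemma mul_parent_le_piLevel (hs : IsSmall α η) {n : ℕ} (u : F.V (n + 1)) :
    η * piLevel g σ η n (g.parent u) ≤ piLevel g σ η (n + 1) u := by
  refine le_trans ?_ (mul_piLevel_parent_le g σ hs u)
  rw [mul_comm]
  exact mul_le_mul_of_nonneg_left (le_mu σ u) (piLevel_pos g σ hs n _).le

lemma piLevel_le_pow (hs : IsSmall α η) : ∀ (n : ℕ) (u : F.V n), piLevel g σ η n u ≤ (1 - η) ^ n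
  | 0, _ => by simp [piLevel]
  | n + 1, u => by
    refine (piLevel_succ_le g σ hs u).trans ?_
    rw [pow_succ']
    exact mul_le_mul_of_nonneg_left (piLevel_le_pow hs n _) (by linarith [hs.η_le])

lemma pow_le_piLevel (hs : IsSmall α η) : ∀ (n : ℕ) (u : F.V n), η ^ n ≤ piLevel g σ η n u
  | 0, _ => by simp [piLevel]
  | n + 1, u => by
    refine le_trans ?_ (mul_parent_le_piLevel g σ hs u)
    rw [pow_succ']
    exact mul_le_mul_of_nonneg_left (pow_le_piLevel hs n _) hs.η_pos.le

/-! ### Ancestors -/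

/-- The function `π` on the set of all vertices. -/
def pv (η : ℝ) (u : F.Vertex) : ℝ := piLevel g σ η u.1 u.2

/-- The parent of a vertex; the root is its own parent. -/
def par : F.Vertex → F.Vertex
  | ⟨0, u⟩ => ⟨0, u⟩
  | ⟨n + 1, u⟩ => ⟨n, g.parent u⟩

/-- The ancestor of level `k` of a vertex `u` (and `u` itself if its level is at most `k`). -/
def anc (k : ℕ) (u : F.Vertex) : F.Vertex := (par g)^[u.1 - k] u

variable {g σ}

lemma par_fst (u : F.Vertex) : (par g u).1 = u.1 - 1 := by
  rcases u with ⟨_ | n, u⟩ <;> rfl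

lemma anc_of_le {k : ℕ} {u : F.Vertex} (h : u.1 ≤ k) : anc g k u = u := by
  simp [anc, Nat.sub_eq_zero_of_le h]

lemma anc_of_lt {k : ℕ} {u : F.Vertex} (h : k < u.1) : anc g k u = anc g k (par g u) := by
  rw [anc, anc, par_fst, ← Function.iterate_succ_apply]
  congr 2
  omega

lemma par_anc {k : ℕ} {u : F.Vertex} (h : k < u.1) : par g (anc g (k + 1) u) = anc g k u := by
  rw [anc, anc, show u.1 - k = (u.1 - (k + 1)) + 1 by omega, Function.iterate_succ_apply']

/-- Induction on the level of a vertex, starting at level `k`. -/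
lemma level_induction (g : F.Parents) {k : ℕ} {P : F.Vertex → Prop} (h0 : ∀ u, u.1 = k → P u)
    (h1 : ∀ u, k < u.1 → P (par g u) → P u) (u : F.Vertex) (hu : k ≤ u.1) : P u := by
  induction hn : u.1 - k generalizing u with
  | zero => exact h0 u (by omega)
  | succ n ih =>
    refine h1 u (by omega) (ih _ ?_ ?_) <;> rw [par_fst] <;> omega

lemma anc_fst {k : ℕ} {u : F.Vertex} (h : k ≤ u.1) : (anc g k u).1 = k := by
  refine level_induction g (P := fun u => (anc g k u).1 = k) (fun u hu => ?_) (fun u hu ih => ?_) u h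
  · rw [anc_of_le hu.le, hu]
  · rw [anc_of_lt hu, ih]

lemma dist_par_lt {u : F.Vertex} (h : 0 < u.1) :
    dist (par g u).2.1 u.2.1 < α ^ (u.1 - 1) := by
  rcases u with ⟨_ | n, u⟩
  · simp at h
  · exact dist_parent_lt g u

/-- The sum of the distances along the tree, in the sharp form needed for the induction. -/
lemma dist_anc_le' (hs : IsSmall α η) {k : ℕ} {u : F.Vertex} (h : k ≤ u.1) :
    dist (anc g k u).2.1 u.2.1 ≤ 11 / 10 * (α ^ k - α ^ u.1) := by
  refine level_induction g (P := fun u => dist (anc g k u).2.1 u.2.1 ≤ 11 / 10 * (α ^ k - α ^ u.1))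
    (fun u hu => ?_) (fun u hu ih => ?_) u h
  · rw [anc_of_le hu.le, dist_self, hu, sub_self, mul_zero]
  · rw [anc_of_lt hu]
    have h0 : α ^ (par g u).1 = α ^ (u.1 - 1) := by rw [par_fst]
    have h1 := dist_par_lt (g := g) (u := u) (by omega)
    have h2 := hs.pow_succ_le (u.1 - 1)
    rw [Nat.sub_add_cancel (by omega)] at h2
    linarith [dist_triangle (anc g k (par g u)).2.1 (par g u).2.1 u.2.1, hs.pow_pos (u.1 - 1)]

lemma dist_anc_le (hs : IsSmall α η) {k : ℕ} {u : F.Vertex} (h : k ≤ u.1) :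
    dist (anc g k u).2.1 u.2.1 ≤ 11 / 10 * α ^ k := by
  linarith [dist_anc_le' (g := g) hs h, hs.pow_pos u.1]

lemma pv_pos (hs : IsSmall α η) (u : F.Vertex) : 0 < pv g σ η u := piLevel_pos g σ hs _ _

lemma pv_le_one (hs : IsSmall α η) (u : F.Vertex) : pv g σ η u ≤ 1 :=
  (piLevel_le_pow g σ hs _ _).trans
    (pow_le_one₀ (by linarith [hs.η_le]) (by linarith [hs.η_pos]))

lemma pv_of_near (hs : IsSmall α η) {u v : F.Vertex} (h : u.1 = v.1)
    (hd : dist u.2.1 v.2.1 < 4 * α ^ u.1) : η * pv g σ η u ≤ pv g σ η v := by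
  obtain ⟨n, u⟩ := u
  obtain ⟨m, v⟩ := v
  obtain rfl : n = m := h
  exact piLevel_hAdj g σ hs n u v (hAdj_of_dist_lt hd)

lemma pv_le_par (hs : IsSmall α η) {u : F.Vertex} (h : 0 < u.1) :
    pv g σ η u ≤ (1 - η) * pv g σ η (par g u) := by
  rcases u with ⟨_ | n, u⟩
  · simp at h
  · exact piLevel_succ_le g σ hs u

lemma mul_par_le_pv (hs : IsSmall α η) (u : F.Vertex) :
    η * pv g σ η (par g u) ≤ pv g σ η u := by
  rcases u with ⟨_ | n, u⟩
  · simp only [par, pv, piLevel]; linarith [hs.η_le]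
  · exact mul_parent_le_piLevel g σ hs u

lemma pv_le_anc (hs : IsSmall α η) {k : ℕ} {u : F.Vertex} (h : k ≤ u.1) :
    pv g σ η u ≤ (1 - η) ^ (u.1 - k) * pv g σ η (anc g k u) := by
  refine level_induction g
    (P := fun u => pv g σ η u ≤ (1 - η) ^ (u.1 - k) * pv g σ η (anc g k u))
    (fun u hu => ?_) (fun u hu ih => ?_) u h
  · rw [anc_of_le hu.le, hu]; simp
  · rw [anc_of_lt hu]
    rw [par_fst] at ih
    refine (pv_le_par (g := g) hs (by omega)).trans ?_
    rw [show u.1 - k = (u.1 - 1 - k) + 1 by omega, pow_succ', mul_assoc]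
    exact mul_le_mul_of_nonneg_left ih (by linarith [hs.η_le])

lemma mul_anc_le_pv (hs : IsSmall α η) {k : ℕ} {u : F.Vertex} (h : k ≤ u.1) :
    η ^ (u.1 - k) * pv g σ η (anc g k u) ≤ pv g σ η u := by
  refine level_induction g
    (P := fun u => η ^ (u.1 - k) * pv g σ η (anc g k u) ≤ pv g σ η u)
    (fun u hu => ?_) (fun u hu ih => ?_) u h
  · rw [anc_of_le hu.le, hu]; simp
  · rw [anc_of_lt hu]
    rw [par_fst] at ih
    refine le_trans ?_ (mul_par_le_pv (g := g) hs u)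
    rw [show u.1 - k = (u.1 - 1 - k) + 1 by omega, pow_succ', mul_assoc]
    exact mul_le_mul_of_nonneg_left ih hs.η_pos.le

end Pi

/-! ### A potential separating a vertex from the vertices far away -/

section Potential

variable (g : F.Parents) (σ : F.Weight)

/-- The minimum of `π` over the neighbours of a vertex. It serves as the cost of a vertex in a
horizontal chain: being bounded by all neighbouring values of `π`, it may be compared between
different vertices of a chain. -/
def piMin (η : ℝ) {n : ℕ} (u : F.V n) : ℝ := sInf (piLevel g σ η n '' {v | HAdj v u})

lemma piMin_le {n : ℕ} {u v : F.V n} (h : HAdj v u) : piMin g σ η u ≤ piLevel g σ η n v :=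
  csInf_le (toFinite _).bddBelow (mem_image_of_mem _ h)

lemma le_piMin {n : ℕ} {u : F.V n} {a : ℝ} (h : ∀ v, HAdj v u → a ≤ piLevel g σ η n v) :
    a ≤ piMin g σ η u :=
  le_csInf ⟨_, mem_image_of_mem _ (HAdj.refl u)⟩ (by rintro _ ⟨v, hv, rfl⟩; exact h v hv)

lemma mul_le_piMin (hs : IsSmall α η) {n : ℕ} (u : F.V n) :
    η * piLevel g σ η n u ≤ piMin g σ η u :=
  le_piMin g σ fun v hv => piLevel_hAdj g σ hs n u v hv.symm

lemma piMin_pos (hs : IsSmall α η) {n : ℕ} (u : F.V n) : 0 < piMin g σ η u :=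
  (mul_pos hs.η_pos (piLevel_pos g σ hs n u)).trans_le (mul_le_piMin g σ hs u)

/-- The values used to extend a function `h` from level `n` to the vertex `x` of level `n + 1`:
a chain of neighbours ending at `x` contributes the value of `h` at the parent of its first
vertex plus the sum of the weights of all its vertices but the last one. -/
def chainValues (η : ℝ) {n : ℕ} (h : F.V n → ℝ) (x : F.V (n + 1)) : Set ℝ :=
  {r | ∃ (N : ℕ) (y : ℕ → F.V (n + 1)), (∀ j < N, HAdj (y j) (y (j + 1))) ∧ y N = x ∧
    r = h (g.parent (y 0)) + ∑ j ∈ Finset.range N, piMin g σ η (y j)}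

/-- The largest extension of `h` to level `n + 1` that is at most `h` of the parent and whose
increment along a horizontal edge from `x` is at most `piMin x`. -/
def extend (η : ℝ) {n : ℕ} (h : F.V n → ℝ) (x : F.V (n + 1)) : ℝ :=
  sInf (chainValues g σ η h x)

variable {g σ}

lemma chainValues_nonneg (hs : IsSmall α η) {n : ℕ} {h : F.V n → ℝ} (hh : ∀ z, 0 ≤ h z)
    {x : F.V (n + 1)} {r : ℝ} (hr : r ∈ chainValues g σ η h x) : 0 ≤ r := by
  obtain ⟨N, y, -, -, rfl⟩ := hr
  exact add_nonneg (hh _) (Finset.sum_nonneg fun j _ => (piMin_pos g σ hs _).le)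

lemma parent_mem_chainValues {n : ℕ} (h : F.V n → ℝ) (x : F.V (n + 1)) :
    h (g.parent x) ∈ chainValues g σ η h x :=
  ⟨0, fun _ => x, by simp, rfl, by simp⟩

lemma extend_le_parent (hs : IsSmall α η) {n : ℕ} {h : F.V n → ℝ} (hh : ∀ z, 0 ≤ h z)
    (x : F.V (n + 1)) : extend g σ η h x ≤ h (g.parent x) :=
  csInf_le ⟨0, fun _ hr => chainValues_nonneg hs hh hr⟩ (parent_mem_chainValues h x)

lemma extend_nonneg (hs : IsSmall α η) {n : ℕ} {h : F.V n → ℝ} (hh : ∀ z, 0 ≤ h z)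
    (x : F.V (n + 1)) : 0 ≤ extend g σ η h x :=
  le_csInf ⟨_, parent_mem_chainValues h x⟩ fun _ hr => chainValues_nonneg hs hh hr

lemma extend_le_add (hs : IsSmall α η) {n : ℕ} {h : F.V n → ℝ} (hh : ∀ z, 0 ≤ h z)
    {x x' : F.V (n + 1)} (hx : HAdj x x') :
    extend g σ η h x' ≤ extend g σ η h x + piMin g σ η x := by
  rw [← sub_le_iff_le_add]
  refine le_csInf ⟨_, parent_mem_chainValues h x⟩ ?_
  rintro r ⟨N, y, hy, hN, rfl⟩
  rw [sub_le_iff_le_add]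
  refine csInf_le ⟨0, fun _ hr => chainValues_nonneg hs hh hr⟩
    ⟨N + 1, fun j => if j ≤ N then y j else x', fun j hj => ?_, by simp, ?_⟩
  · rcases Nat.lt_succ_iff_lt_or_eq.1 hj with h1 | rfl
    · simpa [h1.le, Nat.succ_le_iff.2 h1] using hy j h1
    · simpa [hN] using hx
  · rw [Finset.sum_range_succ, ← add_assoc]
    congr 1
    · congr 1
      refine Finset.sum_congr rfl fun j hj => ?_
      simp [(Finset.mem_range.1 hj).le]
    · simp [hN]

/-- Along a chain that leaves the double of the ball of `z`, the weights `piMin` add up to at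
least `piMin z`: this is where admissibility enters. -/
lemma piMin_le_sum (hs : IsSmall α η) (hσ : Admissible σ) {n : ℕ} (z : F.V n) {M : ℕ}
    {y : ℕ → F.V (n + 1)} (hy : ∀ j < M, HAdj (y j) (y (j + 1)))
    (h0 : dist z.1 (y 0).1 < α ^ n)
    (hin : ∀ j < M, ball (y j).1 (4 * α ^ (n + 1)) ⊆ ball z.1 (2 * α ^ n))
    (hout : ¬ ball (y M).1 (4 * α ^ (n + 1)) ⊆ ball z.1 (2 * α ^ n)) :
    piMin g σ η z ≤ ∑ j ∈ Finset.range (M + 1), piMin g σ η (y j) := by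
  have hpn := hs.pow_pos n
  have hpn1 := hs.pow_pos (n + 1)
  have hp := hs.pow_succ_le n
  have hM : 1 ≤ M := by
    by_contra hM
    obtain rfl : M = 0 := by omega
    refine hout (ball_subset_ball' ?_)
    rw [dist_comm]
    linarith
  -- all vertices of the chain stay in a slightly larger ball
  have hdist : ∀ j ≤ M, dist (y j).1 z.1 < 2 * α ^ n + 8 * α ^ (n + 1) := by
    have hlt : ∀ j < M, dist (y j).1 z.1 < 2 * α ^ n := fun j hj =>
      hin j hj (mem_ball_self (by positivity))
    intro j hj
    rcases hj.lt_or_eq with h | rfl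
    · linarith [hlt j h]
    · have h1 := hlt (j - 1) (by omega)
      have h2 := (hy (j - 1) (by omega)).dist_lt hs
      rw [Nat.sub_add_cancel hM] at h2
      linarith [dist_triangle_left (y j).1 z.1 (y (j - 1)).1]
  -- every neighbour of `y j` has a parent next to `z`, and sees the weight `σ (y j)`
  have hterm : ∀ j ≤ M, piMin g σ η z * max η (min (2 * (σ n (y j) : ℝ)) (1 - η)) ≤
      piMin g σ η (y j) := by
    intro j hj
    refine le_piMin g σ fun v hv => ?_
    refine le_trans ?_ (mul_piLevel_parent_le g σ hs v)
    have hnear : HAdj (g.parent v) z := by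
      refine hAdj_of_dist_lt ?_
      have h1 := dist_parent_lt g v
      have h2 := hv.dist_lt hs
      linarith [dist_triangle4 (g.parent v).1 v.1 (y j).1 z.1, hdist j hj]
    refine mul_le_mul (piMin_le g σ hnear) ?_ ?_ (piLevel_pos g σ hs _ _).le
    · exact max_le_max le_rfl (min_le_min (le_nu σ hv) le_rfl)
    · exact hs.η_pos.le.trans (le_max_left _ _)
  have hone : 1 ≤ ∑ j ∈ Finset.range (M + 1), max η (min (2 * (σ n (y j) : ℝ)) (1 - η)) := by
    have hnn : ∀ j ∈ Finset.range (M + 1), 0 ≤ max η (min (2 * (σ n (y j) : ℝ)) (1 - η)) :=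
      fun j _ => hs.η_pos.le.trans (le_max_left _ _)
    by_cases hbig : ∃ i ≤ M, 1 - η ≤ 2 * (σ n (y i) : ℝ)
    · -- one large term, and another one that is at least `η`
      obtain ⟨i, hi, hbig⟩ := hbig
      obtain ⟨i', hi', hne⟩ : ∃ i' ≤ M, i ≠ i' := by
        rcases Nat.eq_zero_or_pos i with rfl | h
        · exact ⟨1, hM, by omega⟩
        · exact ⟨0, by omega, by omega⟩
      have h1 : 1 - η ≤ max η (min (2 * (σ n (y i) : ℝ)) (1 - η)) :=
        le_max_of_le_right (le_min hbig le_rfl)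
      have h2 : η ≤ max η (min (2 * (σ n (y i') : ℝ)) (1 - η)) := le_max_left _ _
      have h3 := Finset.add_le_sum hnn (Finset.mem_range.2 (Nat.lt_succ_iff.2 hi))
        (Finset.mem_range.2 (Nat.lt_succ_iff.2 hi')) hne
      linarith
    · -- otherwise each term is at least the weight, and admissibility applies
      push Not at hbig
      have h1 := hσ n z M y hy ⟨(y 0).1, by rwa [mem_ball'], mem_ball_self (by positivity)⟩ (by
        obtain ⟨x, hx, hx'⟩ := not_subset.1 hout
        exact ⟨x, hx', hx⟩)
      have h2 : (1 : ℝ) ≤ ∑ j ∈ Finset.range (M + 1), (σ n (y j) : ℝ) := by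
        exact_mod_cast h1
      refine h2.trans (Finset.sum_le_sum fun j hj => ?_)
      have h3 := hbig j (Nat.lt_succ_iff.1 (Finset.mem_range.1 hj))
      refine le_max_of_le_right (le_min ?_ ?_) <;> linarith [(σ n (y j)).2]
  calc piMin g σ η z = piMin g σ η z * 1 := (mul_one _).symm
    _ ≤ piMin g σ η z * ∑ j ∈ Finset.range (M + 1), max η (min (2 * (σ n (y j) : ℝ)) (1 - η)) :=
        mul_le_mul_of_nonneg_left hone (piMin_pos g σ hs z).le
    _ ≤ _ := by
        rw [Finset.mul_sum]
        exact Finset.sum_le_sum fun j hj => hterm j (Nat.lt_succ_iff.1 (Finset.mem_range.1 hj))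

/-- A chain of level `n + 1` can be replaced by a chain of level `n` that is not longer: cut it
whenever it has left the double of the ball of the current vertex of level `n`. -/
lemma exists_le_chain_value (hs : IsSmall α η) (hσ : Admissible σ) {n : ℕ} {h : F.V n → ℝ}
    (hlip : ∀ z z', HAdj z z' → h z' ≤ h z + piMin g σ η z) (N : ℕ) :
    ∀ y : ℕ → F.V (n + 1), (∀ j < N, HAdj (y j) (y (j + 1))) →
    ∃ z : F.V n, dist z.1 (y N).1 < 2 * α ^ n + 8 * α ^ (n + 1) ∧
      h z ≤ h (g.parent (y 0)) + ∑ j ∈ Finset.range N, piMin g σ η (y j) := by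
  induction N using Nat.strong_induction_on with
  | _ N ih =>
  intro y hy
  have hpn := hs.pow_pos n
  have hpn1 := hs.pow_pos (n + 1)
  have hp := hs.pow_succ_le n
  have hsum : ∀ (M : ℕ) (y : ℕ → F.V (n + 1)), 0 ≤ ∑ j ∈ Finset.range M, piMin g σ η (y j) :=
    fun M y => Finset.sum_nonneg fun j _ => (piMin_pos g σ hs _).le
  set z := g.parent (y 0) with hz
  by_cases hex : ∃ M, ¬ ball (y M).1 (4 * α ^ (n + 1)) ⊆ ball z.1 (2 * α ^ n)
  · classical
    have hout := Nat.find_spec hex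
    have hin : ∀ j < Nat.find hex, ball (y j).1 (4 * α ^ (n + 1)) ⊆ ball z.1 (2 * α ^ n) :=
      fun j hj => not_not.1 (Nat.find_min hex hj)
    have h0 : dist z.1 (y 0).1 < α ^ n := dist_parent_lt g (y 0)
    generalize Nat.find hex = M at hout hin
    have hM : 1 ≤ M := by
      by_contra hM
      obtain rfl : M = 0 := by omega
      refine hout (ball_subset_ball' ?_)
      rw [dist_comm]
      linarith
    have hprev := hin (M - 1) (by omega) (mem_ball_self (by positivity))
    rw [mem_ball'] at hprev
    rcases le_or_gt N M with hNM | hMN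
    · -- the chain ends before, or when, it leaves the ball
      refine ⟨z, ?_, le_add_of_nonneg_right (hsum _ _)⟩
      rcases hNM.lt_or_eq with h1 | rfl
      · have := hin N h1 (mem_ball_self (by positivity))
        rw [mem_ball'] at this
        linarith
      · have h2 := (hy (N - 1) (by omega)).dist_lt hs
        rw [Nat.sub_add_cancel hM] at h2
        linarith [dist_triangle z.1 (y (N - 1)).1 (y N).1]
    · have hcross := piMin_le_sum (g := g) hs hσ z (fun j hj => hy j (by omega)) h0 hin hout
      obtain ⟨z', hz', hle⟩ := ih (N - (M + 1)) (by omega) (fun j => y (j + (M + 1)))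
        (fun j hj => by
          have := hy (j + (M + 1)) (by omega)
          rwa [show j + (M + 1) + 1 = j + 1 + (M + 1) by omega] at this)
      simp only [Nat.sub_add_cancel (Nat.succ_le_iff.2 hMN), zero_add] at hz' hle
      refine ⟨z', hz', hle.trans ?_⟩
      have hadj : HAdj z (g.parent (y (M + 1))) := by
        refine hAdj_of_dist_lt ?_
        have h1 := (hy (M - 1) (by omega)).dist_lt hs
        rw [Nat.sub_add_cancel hM] at h1
        have h2 := (hy M hMN).dist_lt hs
        have h3 := dist_parent_lt g (y (M + 1))
        rw [dist_comm] at h3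
        linarith [dist_triangle4 z.1 (y (M - 1)).1 (y M).1 (y (M + 1)).1,
          dist_triangle z.1 (y (M + 1)).1 (g.parent (y (M + 1))).1]
      have hsplit : ∑ j ∈ Finset.range N, piMin g σ η (y j) =
          ∑ j ∈ Finset.range (M + 1), piMin g σ η (y j) +
          ∑ j ∈ Finset.range (N - (M + 1)), piMin g σ η (y (j + (M + 1))) := by
        rw [← Finset.sum_range_add_sum_Ico _ (Nat.succ_le_iff.2 hMN), Finset.sum_Ico_eq_sum_range]
        simp only [add_comm]
      linarith [hlip _ _ hadj]
  · push Not at hex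
    refine ⟨z, ?_, le_add_of_nonneg_right (hsum _ _)⟩
    have := hex N (mem_ball_self (by positivity))
    rw [mem_ball'] at this
    linarith

open Classical in
/-- The potential of the vertex `w`: up to the level of `w` it is `0` at `w` and constant
elsewhere, and it is extended to higher levels by `extend`. -/
def potential (g : F.Parents) (σ : F.Weight) (η : ℝ) (w : F.Vertex) : ∀ n : ℕ, F.V n → ℝ
  | 0 => fun x => if (⟨0, x⟩ : F.Vertex) = w then 0 else piMin g σ η w.2
  | n + 1 => fun x => if n + 1 ≤ w.1 then
      (if (⟨n + 1, x⟩ : F.Vertex) = w then 0 else piMin g σ η w.2)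
      else extend g σ η (potential g σ η w n) x

lemma potential_of_le {w : F.Vertex} {n : ℕ} (h : n ≤ w.1) (x : F.V n) :
    ((⟨n, x⟩ : F.Vertex) = w ∧ potential g σ η w n x = 0) ∨
      ((⟨n, x⟩ : F.Vertex) ≠ w ∧ potential g σ η w n x = piMin g σ η w.2) := by
  rcases n with _ | n
  · simp only [potential]
    split_ifs with h1
    · exact Or.inl ⟨h1, rfl⟩
    · exact Or.inr ⟨h1, rfl⟩
  · simp only [potential, if_pos h]
    split_ifs with h1
    · exact Or.inl ⟨h1, rfl⟩
    · exact Or.inr ⟨h1, rfl⟩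

lemma potential_of_gt {w : F.Vertex} {n : ℕ} (h : w.1 ≤ n) (x : F.V (n + 1)) :
    potential g σ η w (n + 1) x = extend g σ η (potential g σ η w n) x := by
  simp only [potential, if_neg (show ¬ n + 1 ≤ w.1 by omega)]

lemma potential_nonneg (hs : IsSmall α η) (w : F.Vertex) (n : ℕ) (x : F.V n) :
    0 ≤ potential g σ η w n x := by
  induction n with
  | zero =>
    rcases potential_of_le (g := g) (σ := σ) (η := η) (Nat.zero_le w.1) x with h | h <;> rw [h.2]
    exact (piMin_pos g σ hs _).le
  | succ n ih =>
    rcases le_or_gt (n + 1) w.1 with h1 | h1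
    · rcases potential_of_le (g := g) (σ := σ) (η := η) h1 x with h | h <;> rw [h.2]
      exact (piMin_pos g σ hs _).le
    · rw [potential_of_gt (by omega)]
      exact extend_nonneg hs ih x

lemma potential_le (hs : IsSmall α η) (w : F.Vertex) (n : ℕ) (x : F.V n) :
    potential g σ η w n x ≤ piMin g σ η w.2 := by
  have hle : ∀ {n : ℕ}, n ≤ w.1 → ∀ x : F.V n, potential g σ η w n x ≤ piMin g σ η w.2 := by
    intro n hn x
    rcases potential_of_le (g := g) (σ := σ) (η := η) hn x with h | h <;> rw [h.2]
    exact (piMin_pos g σ hs _).le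
  induction n with
  | zero => exact hle (Nat.zero_le _) x
  | succ n ih =>
    rcases le_or_gt (n + 1) w.1 with h1 | h1
    · exact hle h1 x
    · rw [potential_of_gt (by omega)]
      exact (extend_le_parent hs (potential_nonneg hs w n) x).trans (ih _)

lemma potential_le_add (hs : IsSmall α η) (w : F.Vertex) (n : ℕ) (x x' : F.V n) (h : HAdj x x') :
    potential g σ η w n x' ≤ potential g σ η w n x + piMin g σ η x := by
  have hle : ∀ {n : ℕ}, n ≤ w.1 → ∀ x x' : F.V n,
      potential g σ η w n x' ≤ potential g σ η w n x + piMin g σ η x := by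
    intro n hn x x'
    refine (potential_le hs w n x').trans ?_
    rcases potential_of_le (g := g) (σ := σ) (η := η) hn x with ⟨rfl, h2⟩ | h
    · rw [h2, zero_add]
    · rw [h.2]; exact le_add_of_nonneg_right (piMin_pos g σ hs _).le
  cases n with
  | zero => exact hle (Nat.zero_le _) x x'
  | succ n =>
    rcases le_or_gt (n + 1) w.1 with h1 | h1
    · exact hle h1 x x'
    · rw [potential_of_gt (by omega), potential_of_gt (by omega)]
      exact extend_le_add hs (potential_nonneg hs w n) h

/-- The increment along a vertical edge. In one direction it is built into the extension; in the
other, every chain ending at `x` can be replaced by a vertex near the parent of `x`. -/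
lemma abs_potential_sub_parent_le (hs : IsSmall α η) (hσ : Admissible σ) (w : F.Vertex) (n : ℕ)
    (x : F.V (n + 1)) : |potential g σ η w (n + 1) x - potential g σ η w n (g.parent x)| ≤
      piLevel g σ η n (g.parent x) := by
  rcases le_or_gt (n + 1) w.1 with h1 | h1
  · rcases potential_of_le (g := g) (σ := σ) (η := η) (show n ≤ w.1 by omega) (g.parent x)
      with ⟨rfl, h2⟩ | h2
    · simp at h1
    rcases potential_of_le (g := g) (σ := σ) (η := η) h1 x with ⟨rfl, h3⟩ | h3
    · rw [h2.2, h3, zero_sub, abs_neg, abs_of_pos (piMin_pos g σ hs _)]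
      refine (piMin_le g σ (HAdj.refl x)).trans ((piLevel_succ_le g σ hs x).trans ?_)
      nlinarith [piLevel_pos g σ hs n (g.parent x), hs.η_pos]
    · rw [h2.2, h3.2, sub_self, abs_zero]
      exact (piLevel_pos g σ hs _ _).le
  · rw [potential_of_gt (by omega), abs_le]
    have hpos := piLevel_pos g σ hs n (g.parent x)
    constructor
    · rw [neg_le_sub_iff_le_add, ← sub_le_iff_le_add]
      refine le_csInf ⟨_, parent_mem_chainValues _ x⟩ ?_
      rintro r ⟨N, y, hy, rfl, rfl⟩
      obtain ⟨z, hz, hle⟩ := exists_le_chain_value (g := g) hs hσ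
        (potential_le_add (g := g) (σ := σ) hs w n) N y hy
      have hadj : HAdj z (g.parent (y N)) := by
        refine hAdj_of_dist_lt ?_
        have h2 := dist_parent_lt g (y N)
        linarith [dist_triangle_right z.1 (g.parent (y N)).1 (y N).1, hs.pow_succ_le n,
          hs.pow_pos n]
      linarith [potential_le_add (g := g) (σ := σ) hs w n _ _ hadj, piMin_le g σ (η := η) hadj.symm]
    · linarith [extend_le_parent (g := g) (σ := σ) hs
        (potential_nonneg (g := g) (σ := σ) hs w n) x]

/-- The potential is constant away from `w`: the set where it is smaller grows from level to level
by a distance comparable to the scale only. -/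
lemma dist_le_of_potential_lt (hs : IsSmall α η) (hσ : Admissible σ) (w : F.Vertex) (n : ℕ)
    (hn : w.1 ≤ n) (x : F.V n) (h : potential g σ η w n x < piMin g σ η w.2) :
    dist x.1 w.2.1 ≤ 5 / 2 * (α ^ w.1 - α ^ n) := by
  induction n, hn using Nat.le_induction with
  | base =>
    rcases potential_of_le (g := g) (σ := σ) (η := η) le_rfl x with ⟨h2, -⟩ | h2
    · have h3 : x.1 = w.2.1 := congrArg (fun u : F.Vertex => u.2.1) h2
      rw [h3, dist_self, sub_self, mul_zero]
    · exact absurd h2.2 h.ne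
  | succ n hn ih =>
    rw [potential_of_gt hn] at h
    obtain ⟨r, ⟨N, y, hy, rfl, rfl⟩, hr⟩ := exists_lt_of_csInf_lt ⟨_, parent_mem_chainValues _ x⟩ h
    obtain ⟨z, hz, hle⟩ := exists_le_chain_value (g := g) hs hσ
      (potential_le_add (g := g) (σ := σ) hs w n) N y hy
    have := ih z (hle.trans_lt hr)
    linarith [dist_triangle_left (y N).1 w.2.1 z.1, hs.pow_succ_le n, hs.pow_pos n]

/-- A function on the vertices that vanishes below `w`, takes a constant value comparable with
`π w` far away from `w`, and whose increments along edges are controlled by `π`. -/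
theorem exists_potential (hs : IsSmall α η) (hσ : Admissible σ) (g : F.Parents) (w : F.Vertex) :
    ∃ (f : F.Vertex → ℝ) (c : ℝ), η * pv g σ η w ≤ c ∧
      (∀ u : F.Vertex, w.1 ≤ u.1 → anc g w.1 u = w → f u = 0) ∧
      (∀ u : F.Vertex, u.1 < w.1 → f u = c) ∧
      (∀ u : F.Vertex, w.1 ≤ u.1 → 5 / 2 * α ^ w.1 < dist u.2.1 w.2.1 → f u = c) ∧
      ∀ u v : F.Vertex, (ZGraph g).Adj u v → |f u - f v| ≤ η⁻¹ * pv g σ η u := by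
  refine ⟨fun u => potential g σ η w u.1 u.2, piMin g σ η w.2, mul_le_piMin g σ hs _, ?_, ?_, ?_, ?_⟩
  · refine level_induction g (fun u hu h => ?_) (fun u hu ih h => ?_)
    · rw [anc_of_le hu.le] at h
      rcases potential_of_le (g := g) (σ := σ) (η := η) hu.le u.2 with h2 | h2
      · exact h2.2
      · exact absurd h h2.1
    · rw [anc_of_lt hu] at h
      have h1 := ih h
      rcases u with ⟨_ | n, u⟩
      · simp at hu
      · refine le_antisymm ?_ (potential_nonneg hs w _ _)
        dsimp only
        rw [potential_of_gt (Nat.lt_succ_iff.1 hu), ← h1]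
        exact extend_le_parent hs (potential_nonneg hs w n) u
  · intro u hu
    rcases potential_of_le (g := g) (σ := σ) (η := η) hu.le u.2 with ⟨rfl, -⟩ | h2
    · simp at hu
    · exact h2.2
  · intro u hu hd
    by_contra hne
    have := dist_le_of_potential_lt (g := g) hs hσ w u.1 hu u.2
      (lt_of_le_of_ne (potential_le hs w _ _) hne)
    linarith [hs.pow_pos u.1]
  · have hη := hs.η_pos
    have hη1 : 1 ≤ η⁻¹ := (one_le_inv₀ hη).2 (by linarith [hs.η_le])
    have key : ∀ u v : F.Vertex, ZRel g u v →
        |potential g σ η w u.1 u.2 - potential g σ η w v.1 v.2| ≤ η⁻¹ * pv g σ η u ∧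
        |potential g σ η w u.1 u.2 - potential g σ η w v.1 v.2| ≤ η⁻¹ * pv g σ η v := by
      rintro u v (⟨u, v, h⟩ | ⟨v⟩)
      · rename_i n
        have h1 : piMin g σ η u ≤ piLevel g σ η n u := piMin_le g σ (HAdj.refl u)
        have h2 : piMin g σ η v ≤ piLevel g σ η n v := piMin_le g σ (HAdj.refl v)
        have h3 : piMin g σ η u ≤ piLevel g σ η n v := piMin_le g σ h.symm
        have h4 : piMin g σ η v ≤ piLevel g σ η n u := piMin_le g σ h
        have h5 := potential_le_add (g := g) (σ := σ) hs w n _ _ h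
        have h6 := potential_le_add (g := g) (σ := σ) hs w n _ _ h.symm
        have h7 := le_mul_of_one_le_left (piLevel_pos g σ hs n u).le hη1
        have h8 := le_mul_of_one_le_left (piLevel_pos g σ hs n v).le hη1
        simp only [pv, abs_le]
        refine ⟨⟨?_, ?_⟩, ?_, ?_⟩ <;> linarith
      · rename_i n
        have h1 := abs_potential_sub_parent_le (g := g) hs hσ w n v
        rw [abs_sub_comm] at h1
        refine ⟨h1.trans (le_mul_of_one_le_left (piLevel_pos g σ hs n _).le hη1), h1.trans ?_⟩
        rw [le_inv_mul_iff₀ hη]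
        exact mul_parent_le_piLevel g σ hs v
    intro u v huv
    rcases (SimpleGraph.fromRel_adj _ _ _).1 huv with ⟨-, h | h⟩
    · exact (key u v h).1
    · rw [abs_sub_comm]; exact (key v u h).2

end Potential

end Filling

/-! ### Functions whose increments are controlled by the deformed metric -/

lemma toReal_edist_triangle {Z : Type u} [PseudoEMetricSpace Z] (hfin : ∀ x y : Z, edist x y ≠ ⊤)
    (x y z : Z) : (edist x z).toReal ≤ (edist x y).toReal + (edist y z).toReal := by
  rw [← ENNReal.toReal_add (hfin _ _) (hfin _ _)]
  exact ENNReal.toReal_mono (ENNReal.add_ne_top.2 ⟨hfin _ _, hfin _ _⟩) (edist_triangle _ _ _)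

lemma IsArcPath.edist_le {Z : Type u} [PseudoEMetricSpace Z] {x y : Z} {a b : ℝ} {P : ℝ → Z}
    (h : IsArcPath x y a b P) {s t : ℝ} (hs : s ∈ Icc a b) (ht : t ∈ Icc a b) (hst : s ≤ t) :
    edist (P s) (P t) ≤ ENNReal.ofReal (t - s) := by
  have h1 := h.2.1 hs ht
  have h2 := eVariationOn.edist_le P (s := Icc a b ∩ Icc s t) ⟨hs, left_mem_Icc.2 hst⟩
    ⟨ht, right_mem_Icc.2 hst⟩
  rw [h1] at h2
  simpa using h2

namespace MetricGraph

variable {V : Type u} {Γ : SimpleGraph V} {len : V → V → ℝ}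
  {o : MetricGraph Γ len} {K : ℝ} {f : MetricGraph Γ len → ℝ}

/-- `K e^{-d(o, ·)}` is an upper gradient of `f` along segments. -/
def IsControlled (o : MetricGraph Γ len) (K : ℝ) (f : MetricGraph Γ len → ℝ) : Prop :=
  ∀ p q c, Segment p q c → |f p - f q| ≤ K * Real.exp (-(edist p o).toReal) * c.toReal

/-- Along a route the distance from `o` decreases at most at unit speed, so that the density is at
most `e^{-d(p, o)} e^t` at time `t`. -/
lemma IsControlled.le_of_route (hK : 0 < K) (hf : IsControlled o K f)
    (hfin : ∀ p q : MetricGraph Γ len, edist p q ≠ ⊤) {p q : MetricGraph Γ len} {c : ℝ≥0∞}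
    (h : HasRoute p q c) :
    |f p - f q| ≤ K * Real.exp (-(edist p o).toReal) * (Real.exp c.toReal - 1) := by
  induction h with
  | nil p => simp
  | @cons p q r c d hs ht ih =>
    rw [ENNReal.toReal_add hs.ne_top ht.ne_top, Real.exp_add]
    have h1 : (edist p o).toReal ≤ c.toReal + (edist q o).toReal :=
      (toReal_edist_triangle hfin p q o).trans (add_le_add
        (ENNReal.toReal_mono hs.ne_top (edist_le_of_segment hs)) le_rfl)
    have h2 : Real.exp (-(edist q o).toReal) ≤
        Real.exp (-(edist p o).toReal) * Real.exp c.toReal := by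
      rw [← Real.exp_add]
      exact Real.exp_le_exp.2 (by linarith)
    have h3 := Real.add_one_le_exp c.toReal
    have h4 : 0 ≤ Real.exp d.toReal - 1 := by
      linarith [Real.add_one_le_exp d.toReal, ENNReal.toReal_nonneg (a := d)]
    have h5 := Real.exp_pos (-(edist p o).toReal)
    calc |f p - f r| ≤ |f p - f q| + |f q - f r| := abs_sub_le _ _ _
      _ ≤ K * Real.exp (-(edist p o).toReal) * (Real.exp c.toReal - 1) +
          K * (Real.exp (-(edist p o).toReal) * Real.exp c.toReal) * (Real.exp d.toReal - 1) := by
          refine add_le_add ((hf _ _ _ hs).trans ?_) (ih.trans ?_)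
          · exact mul_le_mul_of_nonneg_left (by linarith) (by positivity)
          · exact mul_le_mul_of_nonneg_right (mul_le_mul_of_nonneg_left h2 hK.le) h4
      _ = _ := by ring

lemma IsControlled.le_of_edist (hK : 0 < K) (hf : IsControlled o K f)
    (hfin : ∀ p q : MetricGraph Γ len, edist p q ≠ ⊤) (p q : MetricGraph Γ len) :
    |f p - f q| ≤ K * Real.exp (-(edist p o).toReal) * (Real.exp (edist p q).toReal - 1) := by
  set A := K * Real.exp (-(edist p o).toReal) with hA
  have hApos : 0 < A := by positivity
  have h0 : 0 < |f p - f q| / A + 1 := by positivity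
  have h1 : ENNReal.ofReal (Real.log (|f p - f q| / A + 1)) ≤ edist p q := by
    refine le_edist fun c hc => ENNReal.ofReal_le_of_le_toReal ?_
    rw [Real.log_le_iff_le_exp h0, ← le_sub_iff_add_le, div_le_iff₀ hApos, mul_comm]
    exact hf.le_of_route hK hfin hc
  have h2 := (ENNReal.ofReal_le_iff_le_toReal (hfin p q)).1 h1
  rwa [Real.log_le_iff_le_exp h0, ← le_sub_iff_add_le, div_le_iff₀ hApos, mul_comm] at h2

/-- Along a nearly shortest path from `p` to `q`, the density `e^{-d(o, ·)}` has an integral of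
order at most `e^{-(p, q)_o}`; hence so has the increment of a controlled function. -/
lemma IsControlled.le_gromovProd (hK : 0 < K) (hf : IsControlled o K f)
    (hfin : ∀ p q : MetricGraph Γ len, edist p q ≠ ⊤) {M : ℝ} (hM : 0 ≤ M)
    (hlen : ∀ (p q : MetricGraph Γ len) (c : ℝ≥0∞), Segment p q c → c ≤ ENNReal.ofReal M)
    (p q : MetricGraph Γ len) :
    |f p - f q| ≤ 2 * K * (1 + Real.exp M) * Real.exp (-gromovProd o p q) := by
  obtain ⟨c, hc, hlt⟩ : ∃ c, HasRoute p q c ∧ c < edist p q + 1 := by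
    have h : edist p q < edist p q + 1 := ENNReal.lt_add_right (hfin p q) one_ne_zero
    by_contra! hcon
    exact absurd (le_edist (hcon)) (not_le.2 h)
  have hc1 : c.toReal ≤ (edist p q).toReal + 1 := by
    rw [← ENNReal.toReal_one, ← ENNReal.toReal_add (hfin _ _) ENNReal.one_ne_top]
    exact ENNReal.toReal_mono (ENNReal.add_ne_top.2 ⟨hfin _ _, ENNReal.one_ne_top⟩) hlt.le
  have hc2 : (edist p q).toReal ≤ c.toReal :=
    ENNReal.toReal_mono hc.ne_top (edist_le_of_route hc)
  have ht1 := toReal_edist_triangle hfin p q o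
  have ht2 := toReal_edist_triangle hfin q p o
  rw [edist_comm q p] at ht2
  -- cut the route where the two lower bounds for the distance from `o` agree
  obtain ⟨r, a, b, ha, hb, hat, hbt⟩ := hc.exists_cut hM hlen
    (((edist p o).toReal - (edist q o).toReal + c.toReal) / 2) (by linarith) (by linarith)
  have h1 := hf.le_of_route hK hfin ha
  have h2 := hf.le_of_route hK hfin hb.symm
  -- the route is longer than the distance by less than one, which costs the factor `e ^ (1 / 2)`
  have hE : Real.exp (1 / 2) ≤ 2 := by
    have h3 : Real.exp (1 / 2) * Real.exp (1 / 2) = Real.exp 1 := by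
      rw [← Real.exp_add]; norm_num
    nlinarith [Real.exp_one_lt_d9, Real.exp_pos (1 / 2)]
  have key : ∀ (z : MetricGraph Γ len) (e : ℝ≥0∞) (m : ℝ),
      -(edist z o).toReal + e.toReal ≤ -gromovProd o p q + 1 / 2 + m →
      K * Real.exp (-(edist z o).toReal) * (Real.exp e.toReal - 1) ≤
        K * (Real.exp (-gromovProd o p q) * 2 * Real.exp m) := by
    intro z e m h
    rw [mul_assoc]
    refine mul_le_mul_of_nonneg_left ?_ hK.le
    calc _ ≤ Real.exp (-(edist z o).toReal) * Real.exp e.toReal :=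
          mul_le_mul_of_nonneg_left (by linarith) (Real.exp_pos _).le
      _ ≤ Real.exp (-gromovProd o p q) * Real.exp (1 / 2) * Real.exp m := by
          rw [← Real.exp_add, ← Real.exp_add, ← Real.exp_add]
          exact Real.exp_le_exp.2 h
      _ ≤ _ := by gcongr
  have h3 := key p a 0 (by unfold gromovProd; linarith)
  have h4 := key q b M (by unfold gromovProd; linarith)
  rw [Real.exp_zero, mul_one] at h3
  calc |f p - f q| ≤ |f p - f r| + |f q - f r| := by
        rw [abs_sub_comm (f q)]; exact abs_sub_le _ _ _
    _ ≤ K * (Real.exp (-gromovProd o p q) * 2) +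
        K * (Real.exp (-gromovProd o p q) * 2 * Real.exp M) :=
        add_le_add (h1.trans h3) (h2.trans h4)
    _ = _ := by ring

/-- The increment of a controlled function along a path of unit speed is at most a multiple of
the integral of the density. -/
lemma IsControlled.le_lintegral (hK : 0 < K) (hf : IsControlled o K f)
    (hfin : ∀ p q : MetricGraph Γ len, edist p q ≠ ⊤) (N : ℕ) :
    ∀ (a b : ℝ) (P : ℝ → MetricGraph Γ len), a ≤ b → b - a ≤ N →
    (∀ s ∈ Icc a b, ∀ t ∈ Icc a b, s ≤ t → edist (P s) (P t) ≤ ENNReal.ofReal (t - s)) →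
    ENNReal.ofReal |f (P a) - f (P b)| ≤
      ENNReal.ofReal (9 * K) * ∫⁻ t in Ioc a b, deformDensity o 1 (P t) := by
  induction N with
  | zero =>
    intro a b P hab hN hP
    obtain rfl : a = b := le_antisymm hab (by simpa using hN)
    simp
  | succ N ih =>
    intro a b P hab hN hP
    push_cast at hN
    -- a piece of length at most one, on which the density is nearly constant
    have hshort : ∀ m ∈ Icc a b, m ≤ a + 1 → ENNReal.ofReal |f (P a) - f (P m)| ≤
        ENNReal.ofReal (9 * K) * ∫⁻ t in Ioc a m, deformDensity o 1 (P t) := by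
      intro m hm hm1
      have ha : a ∈ Icc a b := left_mem_Icc.2 hab
      set φ := (edist (P a) o).toReal with hφ
      have h1 : ENNReal.ofReal (Real.exp (-φ - 1) * (m - a)) ≤
          ∫⁻ t in Ioc a m, deformDensity o 1 (P t) := by
        calc _ = ∫⁻ _ in Ioc a m, ENNReal.ofReal (Real.exp (-φ - 1)) := by
              rw [setLIntegral_const, Real.volume_Ioc, ENNReal.ofReal_mul (Real.exp_pos _).le]
          _ ≤ _ := by
              refine setLIntegral_mono' measurableSet_Ioc fun t ht => ?_
              refine ENNReal.ofReal_le_ofReal (Real.exp_le_exp.2 ?_)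
              have h2 := hP a ha t ⟨ht.1.le, ht.2.trans hm.2⟩ ht.1.le
              have h3 := ENNReal.toReal_le_of_le_ofReal (by linarith [ht.1]) h2
              have h4 := toReal_edist_triangle hfin (P t) (P a) o
              rw [edist_comm (P t) (P a)] at h4
              rw [edist_comm o (P t)]
              linarith [ht.2]
      refine le_trans ?_ (mul_le_mul_right h1 _)
      rw [← ENNReal.ofReal_mul (by positivity)]
      refine ENNReal.ofReal_le_ofReal ?_
      have h2 := hf.le_of_edist hK hfin (P a) (P m)
      have h3 : (edist (P a) (P m)).toReal ≤ m - a :=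
        ENNReal.toReal_le_of_le_ofReal (by linarith [hm.1]) (hP a ha m hm hm.1)
      have h4 : Real.exp (edist (P a) (P m)).toReal ≤ Real.exp (m - a) := Real.exp_le_exp.2 h3
      have h5 : Real.exp (m - a) ≤ Real.exp 1 := Real.exp_le_exp.2 (by linarith)
      have h6 : Real.exp (m - a) - 1 ≤ 3 * (m - a) := by
        have h7 := Real.add_one_le_exp (-(m - a))
        have h8 : Real.exp (-(m - a)) * Real.exp (m - a) = 1 := by
          rw [← Real.exp_add]; simp
        nlinarith [Real.exp_pos (m - a), Real.exp_one_lt_d9, hm.1]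
      have h7 : Real.exp (-φ) ≤ 3 * Real.exp (-φ - 1) := by
        have : Real.exp (-φ) = Real.exp (-φ - 1) * Real.exp 1 := by
          rw [← Real.exp_add]; ring_nf
        rw [this]
        nlinarith [Real.exp_pos (-φ - 1), Real.exp_one_lt_d9]
      calc |f (P a) - f (P m)| ≤ K * Real.exp (-φ) * (3 * (m - a)) :=
            h2.trans (mul_le_mul_of_nonneg_left (by linarith) (by positivity))
        _ ≤ K * (3 * Real.exp (-φ - 1)) * (3 * (m - a)) :=
            mul_le_mul_of_nonneg_right (mul_le_mul_of_nonneg_left h7 hK.le) (by linarith [hm.1])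
        _ = _ := by ring
    rcases le_total b (a + 1) with hb | hb
    · exact hshort b (right_mem_Icc.2 hab) hb
    · have hm : a + 1 ∈ Icc a b := ⟨by linarith, hb⟩
      have h1 := ih (a + 1) b P hb (by linarith) fun s hs t ht hst =>
        hP s ⟨hm.1.trans hs.1, hs.2⟩ t ⟨hm.1.trans ht.1, ht.2⟩ hst
      rw [← Ioc_union_Ioc_eq_Ioc hm.1 hb, lintegral_union measurableSet_Ioc
        (Ioc_disjoint_Ioc_of_le le_rfl), mul_add]
      refine le_trans ?_ (add_le_add (hshort _ hm le_rfl) h1)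
      rw [← ENNReal.ofReal_add (abs_nonneg _) (abs_nonneg _)]
      exact ENNReal.ofReal_le_ofReal (abs_sub_le _ _ _)

lemma IsControlled.le_deformDist (hK : 0 < K) (hf : IsControlled o K f)
    (hfin : ∀ p q : MetricGraph Γ len, edist p q ≠ ⊤) (p q : MetricGraph Γ len) :
    ENNReal.ofReal |f p - f q| ≤ ENNReal.ofReal (9 * K) * deformDist o 1 p q := by
  have h0 : ENNReal.ofReal (9 * K) ≠ 0 := by
    rw [Ne, ENNReal.ofReal_eq_zero]; linarith
  rw [mul_comm, ← ENNReal.div_le_iff h0 ENNReal.ofReal_ne_top]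
  refine le_iInf fun a => le_iInf fun b => le_iInf fun P => le_iInf fun hP => ?_
  rw [ENNReal.div_le_iff h0 ENNReal.ofReal_ne_top, mul_comm]
  obtain ⟨N, hN⟩ := exists_nat_ge (b - a)
  have h := hf.le_lintegral hK hfin N a b P hP.1 hN fun s hs t ht hst => hP.edist_le hs ht hst
  rw [hP.2.2.1, hP.2.2.2] at h
  refine h.trans (mul_le_mul_right ?_ _)
  exact lintegral_mono_set Ioc_subset_Icc_self

end MetricGraph

/-! ### Distances in the filling -/

namespace Filling

open MetricGraph

variable {X : Type u} [MetricSpace X] {α η : ℝ} {F : Filling X α} {g : F.Parents} {σ : F.Weight}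
  {o : F.Vertex}

/-- `o` is the only vertex of level `0`. -/
def IsRoot (o : F.Vertex) : Prop := ∀ u : F.Vertex, u.1 = 0 ↔ u = o

lemma isRoot_of_diam_lt [CompactSpace X] (hd : diam (univ : Set X) < 1) {o : F.Vertex}
    (ho : o.1 = 0) : IsRoot o := by
  refine fun u => ⟨fun hu => ?_, fun hu => by rw [hu, ho]⟩
  obtain ⟨n, x⟩ := u
  obtain ⟨m, y⟩ := o
  obtain rfl : n = 0 := hu
  obtain rfl : m = 0 := ho
  have hxy : x = y := by
    by_contra hne
    have h1 := F.separated 0 x.1 x.2 y.1 y.2 fun h => hne (Subtype.ext h)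
    have h2 := dist_le_diam_of_mem (isCompact_univ (X := X)).isBounded (mem_univ x.1)
      (mem_univ y.1)
    rw [pow_zero] at h1
    linarith
  rw [hxy]

/-- The height of a vertex; by `edist_root` it is the distance from the root. -/
def ht (g : F.Parents) (σ : F.Weight) (η : ℝ) (u : F.Vertex) : ℝ := -Real.log (pv g σ η u)

lemma exp_neg_ht (hs : IsSmall α η) (u : F.Vertex) : Real.exp (-ht g σ η u) = pv g σ η u := by
  rw [ht, neg_neg, Real.exp_log (pv_pos hs u)]

lemma ht_nonneg (hs : IsSmall α η) (u : F.Vertex) : 0 ≤ ht g σ η u :=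
  neg_nonneg.2 (Real.log_nonpos (pv_pos hs u).le (pv_le_one hs u))

lemma ht_root (ho : IsRoot o) : ht g σ η o = 0 := by
  have h : o.1 = 0 := (ho o).2 rfl
  obtain ⟨n, x⟩ := o
  obtain rfl : n = 0 := h
  simp [ht, pv, piLevel]

/-- The half length `log (1 / η)` of horizontal edges. -/
def logInv (η : ℝ) : ℝ := Real.log (1 / η)

lemma logInv_eq (η : ℝ) : logInv η = -Real.log η := by rw [logInv, one_div, Real.log_inv]

lemma exp_logInv (hs : IsSmall α η) : Real.exp (logInv η) = η⁻¹ := by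
  rw [logInv, one_div, Real.exp_log (inv_pos.2 hs.η_pos)]

lemma half_le_logInv (hs : IsSmall α η) : 1 / 2 ≤ logInv η := by
  have h := Real.one_sub_inv_le_log_of_pos (x := 1 / η) (by have := hs.η_pos; positivity)
  rw [one_div, inv_inv, ← one_div] at h
  rw [logInv]
  linarith [hs.η_le]

lemma ht_le_add_of_mul_le (hs : IsSmall α η) {u v : F.Vertex}
    (h : η * pv g σ η u ≤ pv g σ η v) : ht g σ η v ≤ ht g σ η u + logInv η := by
  have := Real.log_le_log (mul_pos hs.η_pos (pv_pos hs u)) h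
  rw [Real.log_mul hs.η_pos.ne' (pv_pos hs u).ne'] at this
  rw [ht, ht, logInv_eq]
  linarith

lemma ht_par_le (hs : IsSmall α η) (u : F.Vertex) : ht g σ η u ≤ ht g σ η (par g u) + logInv η :=
  ht_le_add_of_mul_le hs (mul_par_le_pv hs u)

lemma ht_par_add_le (hs : IsSmall α η) {u : F.Vertex} (h : 0 < u.1) :
    ht g σ η (par g u) + η ≤ ht g σ η u := by
  have h1 : 0 < 1 - η := by linarith [hs.η_le]
  have h2 := Real.log_le_log (pv_pos hs u) (pv_le_par (g := g) (σ := σ) hs h)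
  rw [Real.log_mul h1.ne' (pv_pos hs _).ne'] at h2
  have h3 := Real.log_le_sub_one_of_pos h1
  rw [ht, ht]
  linarith

lemma ht_le_mul_level (hs : IsSmall α η) (u : F.Vertex) : ht g σ η u ≤ u.1 * logInv η := by
  have := Real.log_le_log (pow_pos hs.η_pos _) (pow_le_piLevel g σ hs u.1 u.2)
  rw [Real.log_pow] at this
  rw [ht, logInv_eq, pv]
  linarith

/-- The two kinds of edges, with the properties of `π` along horizontal ones. -/
lemma zRel_cases (hs : IsSmall α η) {u v : F.Vertex} (h : ZRel g u v) :
    (u.1 = v.1 ∧ η * pv g σ η u ≤ pv g σ η v ∧ η * pv g σ η v ≤ pv g σ η u) ∨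
      (0 < v.1 ∧ u = par g v) := by
  rcases h with ⟨u, v, h⟩ | ⟨v⟩
  · exact Or.inl ⟨rfl, piLevel_hAdj g σ hs _ _ _ h, piLevel_hAdj g σ hs _ _ _ h.symm⟩
  · exact Or.inr ⟨Nat.succ_pos _, rfl⟩

lemma edgeLen_symm (u v : F.Vertex) : edgeLen g σ η u v = edgeLen g σ η v u := by
  unfold edgeLen
  rcases lt_trichotomy u.1 v.1 with h | h | h
  · rw [if_neg h.ne, if_pos h, if_neg h.ne', if_neg h.not_gt]
  · rw [if_pos h, if_pos h.symm]
  · rw [if_neg h.ne', if_neg h.not_gt, if_neg h.ne, if_pos h]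

lemma edgeLen_of_eq {u v : F.Vertex} (h : u.1 = v.1) : edgeLen g σ η u v = 2 * logInv η := by
  rw [edgeLen, if_pos h, logInv]

lemma edgeLen_par (hs : IsSmall α η) {v : F.Vertex} (h : 0 < v.1) :
    edgeLen g σ η (par g v) v = ht g σ η v - ht g σ η (par g v) := by
  have h1 : (par g v).1 < v.1 := by rw [par_fst]; omega
  rw [edgeLen, if_neg h1.ne, if_pos h1]
  have h2 : rho g σ η v = pv g σ η v / pv g σ η (par g v) := by
    rcases v with ⟨_ | n, v⟩
    · simp at h
    · rfl
  rw [h2, one_div, Real.log_inv, Real.log_div (pv_pos hs _).ne' (pv_pos hs _).ne', ht, ht]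
  ring

lemma edgeLen_bounds (hs : IsSmall α η) {u v : F.Vertex} (h : (ZGraph g).Adj u v) :
    η ≤ edgeLen g σ η u v ∧ edgeLen g σ η u v ≤ 2 * logInv η ∧
      |ht g σ η u - ht g σ η v| ≤ edgeLen g σ η u v := by
  have hL := half_le_logInv hs
  have hη := hs.η_le
  have key : ∀ u v : F.Vertex, ZRel g u v → η ≤ edgeLen g σ η u v ∧
      edgeLen g σ η u v ≤ 2 * logInv η ∧ |ht g σ η u - ht g σ η v| ≤ edgeLen g σ η u v := by
    intro u v huv
    rcases zRel_cases (σ := σ) hs huv with ⟨h1, h2, h3⟩ | ⟨h1, rfl⟩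
    · have h4 := ht_le_add_of_mul_le hs h2
      have h5 := ht_le_add_of_mul_le hs h3
      rw [edgeLen_of_eq h1, abs_le]
      refine ⟨by linarith, le_rfl, ?_, ?_⟩ <;> linarith
    · have h4 := ht_par_le (g := g) (σ := σ) hs v
      have h5 := ht_par_add_le (g := g) (σ := σ) hs h1
      rw [edgeLen_par hs h1, abs_sub_comm, abs_of_nonneg (by linarith [hs.η_pos])]
      refine ⟨by linarith, by linarith, le_rfl⟩
  rcases (SimpleGraph.fromRel_adj _ _ _).1 h with ⟨-, h | h⟩
  · exact key u v h
  · rw [edgeLen_symm, abs_sub_comm]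
    exact key v u h

lemma edgeLen_pos (hs : IsSmall α η) {u v : F.Vertex} (h : (ZGraph g).Adj u v) :
    0 < edgeLen g σ η u v := hs.η_pos.trans_le (edgeLen_bounds hs h).1

lemma adj_par {u : F.Vertex} (h : 0 < u.1) : (ZGraph g).Adj (par g u) u := by
  refine (SimpleGraph.fromRel_adj _ _ _).2 ⟨fun h1 => ?_, Or.inl ?_⟩
  · have := par_fst (g := g) u
    rw [h1] at this
    omega
  · rcases u with ⟨_ | n, u⟩
    · simp at h
    · exact ZRel.vertical u

lemma adj_of_near {u v : F.Vertex} (h : u.1 = v.1) (hd : dist u.2.1 v.2.1 < 4 * α ^ u.1)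
    (hne : u ≠ v) : (ZGraph g).Adj u v := by
  refine (SimpleGraph.fromRel_adj _ _ _).2 ⟨hne, Or.inl ?_⟩
  obtain ⟨n, u⟩ := u
  obtain ⟨m, v⟩ := v
  obtain rfl : n = m := h
  exact ZRel.horizontal u v (hAdj_of_dist_lt hd)

lemma segment_le (hs : IsSmall α η) {p q : Z g σ η} {c : ℝ≥0∞} (h : Segment p q c) :
    c ≤ ENNReal.ofReal (2 * logInv η) := by
  obtain ⟨u, v, ha, s, hs', r, hr, -, -, rfl⟩ := h
  refine ENNReal.ofReal_le_ofReal ?_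
  have h1 : |s - r| ≤ 1 := by rw [abs_le]; constructor <;> linarith [hs'.1, hs'.2, hr.1, hr.2]
  have h2 := edgeLen_bounds (σ := σ) hs ha
  nlinarith [edgeLen_pos (σ := σ) hs ha]

lemma edist_edge_le (hs : IsSmall α η) {u v : F.Vertex} (h : (ZGraph g).Adj u v) {s r : ℝ}
    (hs' : s ∈ Icc (0 : ℝ) 1) (hr : r ∈ Icc (0 : ℝ) 1) :
    edist (edgeAt (edgeLen g σ η) h s) (edgeAt (edgeLen g σ η) h r) ≤
      ENNReal.ofReal (2 * logInv η) :=
  (edist_le_of_segment (segment_edgeAt h hs' hr)).trans (segment_le hs (segment_edgeAt h hs' hr))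

lemma edist_toZ_le_of_adj {u v : F.Vertex} (h : (ZGraph g).Adj u v) :
    edist (toZ g σ η u) (toZ g σ η v) ≤ ENNReal.ofReal (edgeLen g σ η u v) := by
  have := edist_le_of_segment (segment_edgeAt (len := edgeLen g σ η) h
    (left_mem_Icc.2 zero_le_one) (right_mem_Icc.2 zero_le_one))
  rw [edgeAt_zero, edgeAt_one] at this
  simpa using this

/-- The distance from a vertex to an ancestor is at most the difference of the heights. -/
lemma edist_anc_le (hs : IsSmall α η) {k : ℕ} {u : F.Vertex} (h : k ≤ u.1) :
    edist (toZ g σ η u) (toZ g σ η (anc g k u)) ≤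
      ENNReal.ofReal (ht g σ η u - ht g σ η (anc g k u)) ∧
      ht g σ η (anc g k u) ≤ ht g σ η u := by
  refine level_induction g (P := fun u => edist (toZ g σ η u) (toZ g σ η (anc g k u)) ≤
      ENNReal.ofReal (ht g σ η u - ht g σ η (anc g k u)) ∧
      ht g σ η (anc g k u) ≤ ht g σ η u) (fun u hu => ?_) (fun u hu ih => ?_) u h
  · rw [anc_of_le hu.le]; simp
  · rw [anc_of_lt hu]
    have h1 := ht_par_add_le (g := g) (σ := σ) hs (show 0 < u.1 by omega)
    refine ⟨?_, by linarith [ih.2, hs.η_pos]⟩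
    have h2 := edist_toZ_le_of_adj (σ := σ) (η := η) (adj_par (g := g) (show 0 < u.1 by omega)).symm
    rw [edgeLen_symm, edgeLen_par hs (by omega)] at h2
    refine (edist_triangle _ (toZ g σ η (par g u)) _).trans ((add_le_add h2 ih.1).trans ?_)
    rw [← ENNReal.ofReal_add (by linarith [hs.η_pos]) (by linarith [ih.2])]
    exact ENNReal.ofReal_le_ofReal (by linarith)

lemma anc_zero (ho : IsRoot o) (u : F.Vertex) : anc g 0 u = o :=
  (ho _).1 (anc_fst (Nat.zero_le _))

/-- The distance from the root is `log (1 / π)`: going down the tree is a shortest path, since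
horizontal edges are longer than the variation of `log π` along them. -/
lemma edist_root (hs : IsSmall α η) (ho : IsRoot o) (u : F.Vertex) :
    edist (toZ g σ η u) (toZ g σ η o) = ENNReal.ofReal (ht g σ η u) := by
  refine le_antisymm ?_ ?_
  · have := (edist_anc_le (g := g) (σ := σ) hs (Nat.zero_le u.1)).1
    rwa [anc_zero ho, ht_root ho, sub_zero] at this
  · have h := ofReal_abs_sub_le_edist (affineExt (Γ := ZGraph g) (len := edgeLen g σ η) (ht g σ η))
      (fun p q c hc => ?_) (toZ g σ η u) (toZ g σ η o)
    · rwa [affineExt_vertex, affineExt_vertex, ht_root ho, sub_zero,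
        abs_of_nonneg (ht_nonneg hs u)] at h
    · obtain ⟨a, b, hab, s, r, hs', hr, rfl, rfl, rfl⟩ := hc.exists_edgeAt
      rw [affineExt_edgeAt_sub _ hab hs' hr, mul_comm]
      exact ENNReal.ofReal_le_ofReal
        (mul_le_mul_of_nonneg_right (edgeLen_bounds hs hab).2.2 (abs_nonneg _))

lemma toReal_edist_root (hs : IsSmall α η) (ho : IsRoot o) (u : F.Vertex) :
    (edist (toZ g σ η u) (toZ g σ η o)).toReal = ht g σ η u := by
  rw [edist_root hs ho, ENNReal.toReal_ofReal (ht_nonneg hs u)]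

/-- Every point is within `2 log (1 / η)` of a vertex. -/
lemma exists_vertex_near (hs : IsSmall α η) (p : Z g σ η) :
    ∃ u : F.Vertex, edist p (toZ g σ η u) ≤ ENNReal.ofReal (2 * logInv η) := by
  rcases exists_eq_vertex_or_edgeAt p with ⟨v, rfl⟩ | ⟨u, v, h, s, hs', rfl⟩
  · exact ⟨v, by rw [edist_self]; exact bot_le⟩
  · refine ⟨u, ?_⟩
    rw [toZ, ← edgeAt_zero h]
    exact edist_edge_le hs h hs' (left_mem_Icc.2 zero_le_one)

lemma edist_ne_top (hs : IsSmall α η) (ho : IsRoot o) (p q : Z g σ η) : edist p q ≠ ⊤ := by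
  have key : ∀ p : Z g σ η, edist p (toZ g σ η o) ≠ ⊤ := by
    intro p
    obtain ⟨u, hu⟩ := exists_vertex_near hs p
    refine ne_top_of_le_ne_top ?_ (edist_triangle p (toZ g σ η u) _)
    rw [edist_root hs ho]
    exact ENNReal.add_ne_top.2 ⟨ne_top_of_le_ne_top ENNReal.ofReal_ne_top hu,
      ENNReal.ofReal_ne_top⟩
  refine ne_top_of_le_ne_top ?_ (edist_triangle_right p q (toZ g σ η o))
  exact ENNReal.add_ne_top.2 ⟨key p, key q⟩

lemma deformDensity_edge_le (hs : IsSmall α η) (ho : IsRoot o) {u v : F.Vertex}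
    (h : (ZGraph g).Adj u v) (s : ℝ) :
    deformDensity (toZ g σ η o) 1 (edgeAt (edgeLen g σ η) h s) ≤
      ENNReal.ofReal (η⁻¹ ^ 2 * pv g σ η u) := by
  refine ENNReal.ofReal_le_ofReal ?_
  have h0 : edgeAt (edgeLen g σ η) h s = edgeAt (edgeLen g σ η) h (projIcc 0 1 zero_le_one s) := by
    simp [edgeAt]
  have h1 := edist_edge_le (σ := σ) hs h (left_mem_Icc.2 zero_le_one)
    (projIcc (0 : ℝ) 1 zero_le_one s).2
  rw [← h0, edgeAt_zero] at h1
  have h2 := ENNReal.toReal_le_of_le_ofReal (by linarith [half_le_logInv hs]) h1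
  have h3 := toReal_edist_triangle (edist_ne_top (σ := σ) (g := g) hs ho) (toZ g σ η u)
    (edgeAt (edgeLen g σ η) h s) (toZ g σ η o)
  rw [toReal_edist_root hs ho, edist_comm _ (toZ g σ η o)] at h3
  rw [← exp_logInv hs, ← exp_neg_ht hs, ← Real.exp_nat_mul, ← Real.exp_add]
  refine Real.exp_le_exp.2 ?_
  push_cast
  linarith

lemma le_exp_neg_edist (hs : IsSmall α η) (ho : IsRoot o) {u v : F.Vertex}
    (h : (ZGraph g).Adj u v) {s : ℝ} (hs' : s ∈ Icc (0 : ℝ) 1) :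
    η ^ 2 * pv g σ η u ≤
      Real.exp (-(edist (edgeAt (edgeLen g σ η) h s) (toZ g σ η o)).toReal) := by
  have h1 := edist_edge_le (σ := σ) hs h hs' (left_mem_Icc.2 zero_le_one)
  rw [edgeAt_zero] at h1
  have h2 := ENNReal.toReal_le_of_le_ofReal (by linarith [half_le_logInv hs]) h1
  have h3 := toReal_edist_triangle (edist_ne_top (σ := σ) (g := g) hs ho)
    (edgeAt (edgeLen g σ η) h s) (toZ g σ η u) (toZ g σ η o)
  rw [toReal_edist_root hs ho] at h3
  rw [← exp_neg_ht hs, ← Real.exp_log hs.η_pos, ← Real.exp_nat_mul, ← Real.exp_add]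
  refine Real.exp_le_exp.2 ?_
  rw [Real.exp_log hs.η_pos]
  push_cast
  linarith [logInv_eq η]

/-! ### Lower bounds: separated vertices -/

/-- The constant controlling the affine extension of a potential. -/
def ctrlConst (η : ℝ) : ℝ := η⁻¹ ^ 4

lemma isControlled_affineExt (hs : IsSmall α η) (ho : IsRoot o) {f : F.Vertex → ℝ}
    (hf : ∀ u v : F.Vertex, (ZGraph g).Adj u v → |f u - f v| ≤ η⁻¹ * pv g σ η u) :
    IsControlled (toZ g σ η o) (ctrlConst η)
      (affineExt (Γ := ZGraph g) (len := edgeLen g σ η) f) := by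
  intro p q c hc
  obtain ⟨u, v, h, s, r, hs', hr, rfl, rfl, rfl⟩ := hc.exists_edgeAt
  have hη := hs.η_pos
  have h1 := (edgeLen_bounds (σ := σ) hs h).1
  rw [affineExt_edgeAt_sub _ h hs' hr, ENNReal.toReal_ofReal
    (mul_nonneg (edgeLen_pos hs h).le (abs_nonneg _))]
  have h2 := le_exp_neg_edist (σ := σ) hs ho h hs'
  have h3 := pv_pos (g := g) (σ := σ) hs u
  calc |s - r| * |f u - f v| ≤ |s - r| * (η⁻¹ * pv g σ η u) :=
        mul_le_mul_of_nonneg_left (hf u v h) (abs_nonneg _)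
    _ = ctrlConst η * (η ^ 2 * pv g σ η u) * (η * |s - r|) := by
        rw [ctrlConst]; field_simp
    _ ≤ _ := by
        have : 0 ≤ ctrlConst η := by unfold ctrlConst; positivity
        gcongr

/-- The vertex `v` is separated from the vertex `w` at the scale of `w`: it lies above the level of
`w`, or its position has distance more than `5 / 2` times this scale from that of `w`. -/
def IsFar (v w : F.Vertex) : Prop :=
  v.1 < w.1 ∨ (w.1 ≤ v.1 ∧ 5 / 2 * α ^ w.1 < dist v.2.1 w.2.1)

/-- The constant in the bounds from below for a descendant of a vertex and a point far from it; the
two summands come from the estimates by the Gromov product and by `d₁`. -/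
def lowConst (η : ℝ) : ℝ := 2 * ctrlConst η * (1 + η⁻¹ ^ 2) * η⁻¹ + 9 * ctrlConst η * η⁻¹

lemma ctrlConst_pos (hs : IsSmall α η) : 0 < ctrlConst η := by
  have := hs.η_pos
  unfold ctrlConst; positivity

lemma lowConst_pos (hs : IsSmall α η) : 0 < lowConst η := by
  have := hs.η_pos
  have := ctrlConst_pos hs
  unfold lowConst; positivity

/-- If `u` is a descendant of `w` and `v` is far from `w`, then `(u, v)_o` is at most the height of
`w`, up to an additive constant. -/
lemma pv_le_exp_gromovProd (hs : IsSmall α η) (hσ : Admissible σ) (ho : IsRoot o)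
    {u v w : F.Vertex} (hu : w.1 ≤ u.1) (hw : anc g w.1 u = w) (hv : IsFar v w) :
    pv g σ η w ≤ lowConst η *
      Real.exp (-gromovProd (toZ g σ η o) (toZ g σ η u) (toZ g σ η v)) := by
  obtain ⟨f, c, hc, h0, h1, h2, h3⟩ := exists_potential (η := η) hs hσ g w
  have hη := hs.η_pos
  have h4 := (isControlled_affineExt (σ := σ) hs ho h3).le_gromovProd (ctrlConst_pos hs)
    (edist_ne_top hs ho) (M := 2 * logInv η) (by linarith [half_le_logInv hs])
    (fun _ _ _ => segment_le hs) (toZ g σ η u) (toZ g σ η v)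
  have hfv : f v = c := hv.elim (h1 v) fun h => h2 v h.1 h.2
  have hexp : Real.exp (2 * logInv η) = η⁻¹ ^ 2 := by
    rw [← exp_logInv hs, ← Real.exp_nat_mul]; norm_cast
  rw [affineExt_vertex, affineExt_vertex, h0 u hu hw, hfv, zero_sub, abs_neg, hexp] at h4
  have h5 := hc.trans ((le_abs_self c).trans h4)
  rw [mul_comm η, ← le_div_iff₀ hη] at h5
  refine h5.trans ?_
  rw [div_eq_mul_inv, mul_right_comm]
  refine mul_le_mul_of_nonneg_right ?_ (Real.exp_pos _).le
  have := ctrlConst_pos hs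
  rw [lowConst]
  exact le_add_of_nonneg_right (by positivity)

/-- The lower bound for `d₁` between a descendant of `w` and a vertex, or a point of an edge, that
is far from `w`. -/
lemma pv_le_deformDist (hs : IsSmall α η) (hσ : Admissible σ) (ho : IsRoot o)
    {u w : F.Vertex} (hu : w.1 ≤ u.1) (hw : anc g w.1 u = w) {q : Z g σ η}
    (hq : (∃ v, q = toZ g σ η v ∧ IsFar v w) ∨ ∃ (v v' : F.Vertex) (h : (ZGraph g).Adj v v') (s : ℝ),
      s ∈ Icc (0 : ℝ) 1 ∧ q = edgeAt _ h s ∧ IsFar v w ∧ IsFar v' w) :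
    ENNReal.ofReal (pv g σ η w) ≤ ENNReal.ofReal (lowConst η) *
      deformDist (toZ g σ η o) 1 (toZ g σ η u) q := by
  obtain ⟨f, c, hc, h0, h1, h2, h3⟩ := exists_potential (η := η) hs hσ g w
  have hη := hs.η_pos
  have hK := ctrlConst_pos hs
  have hL := lowConst_pos hs
  have h4 := (isControlled_affineExt (σ := σ) hs ho h3).le_deformDist hK
    (edist_ne_top hs ho) (toZ g σ η u) q
  have hfar : ∀ v, IsFar v w → f v = c := fun v hv => hv.elim (h1 v) fun h => h2 v h.1 h.2
  have hfq : affineExt (Γ := ZGraph g) (len := edgeLen g σ η) f q = c := by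
    rcases hq with ⟨v, rfl, hv⟩ | ⟨v, v', h, s, hs', rfl, hv, hv'⟩
    · rw [affineExt_vertex, hfar v hv]
    · rw [affineExt_edgeAt f h hs', hfar v hv, hfar v' hv']; ring
  rw [affineExt_vertex, h0 u hu hw, hfq, zero_sub, abs_neg] at h4
  have h5 : ENNReal.ofReal (η * pv g σ η w) ≤ _ :=
    (ENNReal.ofReal_le_ofReal (hc.trans (le_abs_self c))).trans h4
  have h6 : pv g σ η w = η⁻¹ * (η * pv g σ η w) := by field_simp
  rw [h6, ENNReal.ofReal_mul (by positivity)]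
  refine (mul_le_mul_right h5 _).trans ?_
  rw [← mul_assoc, ← ENNReal.ofReal_mul (by positivity)]
  refine mul_le_mul_left (ENNReal.ofReal_le_ofReal ?_) _
  rw [lowConst, mul_comm η⁻¹]
  exact le_add_of_nonneg_left (by positivity)

/-! ### Upper bounds: vertices close to each other -/

/-- A bound for the diameter of an edge `u v` in the deformed metric, divided by `π u`. -/
def edgeConst (η : ℝ) : ℝ := η⁻¹ ^ 2 * (2 * logInv η)

lemma edgeConst_pos (hs : IsSmall α η) : 0 < edgeConst η := by
  have := hs.η_pos
  have := half_le_logInv hs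
  unfold edgeConst
  have : 0 < 2 * logInv η := by linarith
  positivity

lemma deformDist_edge_le_abs (hs : IsSmall α η) (ho : IsRoot o) {u v : F.Vertex}
    (h : (ZGraph g).Adj u v) {s r : ℝ} (hs' : s ∈ Icc (0 : ℝ) 1) (hr : r ∈ Icc (0 : ℝ) 1) :
    deformDist (toZ g σ η o) 1 (edgeAt _ h s) (edgeAt _ h r) ≤
      ENNReal.ofReal (edgeConst η * pv g σ η u * |s - r|) := by
  have hη := hs.η_pos
  have h1 := pv_pos (g := g) (σ := σ) hs u
  refine (deformDist_edge_le edgeLen_symm h (edgeLen_pos hs h)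
    (M := η⁻¹ ^ 2 * pv g σ η u) (by positivity)
    (deformDensity_edge_le hs ho h) hs' hr).trans (ENNReal.ofReal_le_ofReal ?_)
  calc _ ≤ η⁻¹ ^ 2 * pv g σ η u * (2 * logInv η * |s - r|) := by
        gcongr
        exact (edgeLen_bounds hs h).2.1
    _ = _ := by unfold edgeConst; ring

lemma deformDist_edge_le_pv (hs : IsSmall α η) (ho : IsRoot o) {u v : F.Vertex}
    (h : (ZGraph g).Adj u v) {s r : ℝ} (hs' : s ∈ Icc (0 : ℝ) 1) (hr : r ∈ Icc (0 : ℝ) 1) :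
    deformDist (toZ g σ η o) 1 (edgeAt _ h s) (edgeAt _ h r) ≤
      ENNReal.ofReal (edgeConst η * pv g σ η u) := by
  refine (deformDist_edge_le_abs hs ho h hs' hr).trans (ENNReal.ofReal_le_ofReal ?_)
  have h1 : |s - r| ≤ 1 := by rw [abs_le]; constructor <;> linarith [hs'.1, hs'.2, hr.1, hr.2]
  exact mul_le_of_le_one_right (mul_nonneg (edgeConst_pos hs).le (pv_pos hs u).le) h1

lemma deformDist_adj_le (hs : IsSmall α η) (ho : IsRoot o) {u v : F.Vertex}
    (h : (ZGraph g).Adj u v) :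
    deformDist (toZ g σ η o) 1 (toZ g σ η u) (toZ g σ η v) ≤
      ENNReal.ofReal (edgeConst η * pv g σ η u) := by
  have := deformDist_edge_le_pv (σ := σ) hs ho h (left_mem_Icc.2 zero_le_one)
    (right_mem_Icc.2 zero_le_one)
  rwa [edgeAt_zero, edgeAt_one] at this

/-- The length of a descending path is a geometric sum. -/
lemma deformDist_anc_le (hs : IsSmall α η) (ho : IsRoot o) {k : ℕ} {u : F.Vertex} (h : k ≤ u.1) :
    deformDist (toZ g σ η o) 1 (toZ g σ η u) (toZ g σ η (anc g k u)) ≤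
      ENNReal.ofReal (edgeConst η * η⁻¹ * (pv g σ η (anc g k u) - pv g σ η u)) ∧
      pv g σ η u ≤ pv g σ η (anc g k u) := by
  have hη := hs.η_pos
  have hB := edgeConst_pos hs
  refine level_induction g (P := fun u => deformDist (toZ g σ η o) 1 (toZ g σ η u)
      (toZ g σ η (anc g k u)) ≤
      ENNReal.ofReal (edgeConst η * η⁻¹ * (pv g σ η (anc g k u) - pv g σ η u)) ∧
      pv g σ η u ≤ pv g σ η (anc g k u)) (fun u hu => ?_) (fun u hu ih => ?_) u h
  · rw [anc_of_le hu.le, deformDist_self]; simp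
  · rw [anc_of_lt hu]
    have h1 := pv_le_par (g := g) (σ := σ) hs (show 0 < u.1 by omega)
    have h2 := pv_pos (g := g) (σ := σ) hs (par g u)
    have h3 := deformDist_adj_le (σ := σ) hs ho (adj_par (g := g) (show 0 < u.1 by omega))
    refine ⟨?_, by nlinarith [ih.2]⟩
    refine (deformDist_triangle _ _ _ (toZ g σ η (par g u)) _).trans ?_
    refine (add_le_add ((deformDist_comm_le _ _ _ _).trans h3) ih.1).trans ?_
    rw [← ENNReal.ofReal_add (by positivity)
      (mul_nonneg (by positivity) (sub_nonneg.2 ih.2))]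
    refine ENNReal.ofReal_le_ofReal ?_
    have h4 : pv g σ η (par g u) ≤ η⁻¹ * (pv g σ η (par g u) - pv g σ η u) := by
      rw [le_inv_mul_iff₀ hη]; linarith
    calc _ ≤ edgeConst η * (η⁻¹ * (pv g σ η (par g u) - pv g σ η u)) +
          edgeConst η * η⁻¹ * (pv g σ η (anc g k (par g u)) - pv g σ η (par g u)) := by gcongr
      _ = _ := by ring

/-- The constant in the bound of `d₁` between a vertex and the vertices below it. -/
def upConst (η : ℝ) : ℝ := edgeConst η * η⁻¹ ^ 2 + edgeConst η

lemma upConst_pos (hs : IsSmall α η) : 0 < upConst η := by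
  have hη := hs.η_pos
  have hB := edgeConst_pos hs
  unfold upConst; positivity

/-- The constant `29 / 10` leaves room for the drift `11 / 10` along the tree below the radius `4`
that guarantees adjacency, and exceeds the constant `5 / 2` of separation. -/
lemma dist_anc_lt (hs : IsSmall α η) {u a : F.Vertex} (h : a.1 ≤ u.1)
    (hd : dist u.2.1 a.2.1 < 29 / 10 * α ^ a.1) :
    dist (anc g a.1 u).2.1 a.2.1 < 4 * α ^ (anc g a.1 u).1 := by
  have : α ^ (anc g a.1 u).1 = α ^ a.1 := by rw [anc_fst h]
  linarith [dist_anc_le (g := g) hs h, dist_triangle (anc g a.1 u).2.1 u.2.1 a.2.1]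

lemma deformDist_le_of_near (hs : IsSmall α η) (ho : IsRoot o) {u a : F.Vertex} (h : a.1 ≤ u.1)
    (hd : dist u.2.1 a.2.1 < 29 / 10 * α ^ a.1) :
    deformDist (toZ g σ η o) 1 (toZ g σ η u) (toZ g σ η a) ≤
      ENNReal.ofReal (upConst η * pv g σ η a) := by
  have hη := hs.η_pos
  have hB := edgeConst_pos hs
  have hlt := dist_anc_lt (g := g) hs h hd
  have hfst := anc_fst (g := g) h
  have h1 := (deformDist_anc_le (g := g) (σ := σ) hs ho h).1
  have ha := pv_pos (g := g) (σ := σ) hs a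
  have hu := pv_pos (g := g) (σ := σ) hs u
  have h2 : deformDist (toZ g σ η o) 1 (toZ g σ η (anc g a.1 u)) (toZ g σ η a) ≤
      ENNReal.ofReal (edgeConst η * pv g σ η a) := by
    by_cases hne : anc g a.1 u = a
    · rw [hne, deformDist_self]; exact bot_le
    · refine (deformDist_comm_le _ _ _ _).trans (deformDist_adj_le hs ho ?_)
      exact (adj_of_near hfst hlt hne).symm
  have h3 : pv g σ η (anc g a.1 u) ≤ η⁻¹ * pv g σ η a := by
    rw [le_inv_mul_iff₀ hη]
    exact pv_of_near hs hfst hlt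
  refine (deformDist_triangle _ _ _ (toZ g σ η (anc g a.1 u)) _).trans ((add_le_add h1 h2).trans ?_)
  refine (add_le_add_left (ENNReal.ofReal_le_ofReal (q := edgeConst η * η⁻¹ * (η⁻¹ * pv g σ η a))
    (by gcongr; linarith)) _).trans ?_
  rw [← ENNReal.ofReal_add (by positivity) (by positivity)]
  refine ENNReal.ofReal_le_ofReal (le_of_eq ?_)
  unfold upConst; ring

lemma edist_le_of_near (hs : IsSmall α η) {u a : F.Vertex} (h : a.1 ≤ u.1)
    (hd : dist u.2.1 a.2.1 < 29 / 10 * α ^ a.1) :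
    edist (toZ g σ η u) (toZ g σ η a) ≤
      ENNReal.ofReal (ht g σ η u - ht g σ η a + 3 * logInv η) := by
  have hL := half_le_logInv hs
  have hlt := dist_anc_lt (g := g) hs h hd
  have hfst := anc_fst (g := g) h
  obtain ⟨h1, h1'⟩ := edist_anc_le (g := g) (σ := σ) hs h
  have h2 : edist (toZ g σ η (anc g a.1 u)) (toZ g σ η a) ≤ ENNReal.ofReal (2 * logInv η) := by
    by_cases hne : anc g a.1 u = a
    · rw [hne, edist_self]; exact bot_le
    · have := edist_toZ_le_of_adj (σ := σ) (η := η)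
        (adj_of_near (g := g) hfst hlt hne)
      rwa [edgeLen_of_eq hfst] at this
  have h3 : ht g σ η a ≤ ht g σ η (anc g a.1 u) + logInv η :=
    ht_le_add_of_mul_le hs (pv_of_near hs hfst hlt)
  refine (edist_triangle _ (toZ g σ η (anc g a.1 u)) _).trans ((add_le_add h1 h2).trans ?_)
  rw [← ENNReal.ofReal_add (by linarith) (by linarith)]
  exact ENNReal.ofReal_le_ofReal (by linarith)

lemma le_gromovProd_of_near (hs : IsSmall α η) (ho : IsRoot o) {u v a : F.Vertex}
    (hu : a.1 ≤ u.1) (hdu : dist u.2.1 a.2.1 < 29 / 10 * α ^ a.1)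
    (hv : a.1 ≤ v.1) (hdv : dist v.2.1 a.2.1 < 29 / 10 * α ^ a.1) :
    ht g σ η a - 3 * logInv η ≤ gromovProd (toZ g σ η o) (toZ g σ η u) (toZ g σ η v) := by
  have key : ∀ u : F.Vertex, a.1 ≤ u.1 → dist u.2.1 a.2.1 < 29 / 10 * α ^ a.1 →
      (edist (toZ g σ η u) (toZ g σ η a)).toReal ≤ ht g σ η u - ht g σ η a + 3 * logInv η := by
    intro u hu hdu
    have h1 := edist_le_of_near (g := g) (σ := σ) (η := η) hs hu hdu
    by_contra! hcon
    have h2 := ENNReal.toReal_mono ENNReal.ofReal_ne_top h1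
    rcases le_total 0 (ht g σ η u - ht g σ η a + 3 * logInv η) with h3 | h3
    · rw [ENNReal.toReal_ofReal h3] at h2; linarith
    · have h4 : ht g σ η a ≤ ht g σ η u + 3 * logInv η := by
        have hfst := anc_fst (g := g) hu
        have h5 : ht g σ η a ≤ ht g σ η (anc g a.1 u) + logInv η :=
          ht_le_add_of_mul_le hs (pv_of_near hs hfst (dist_anc_lt hs hu hdu))
        linarith [(edist_anc_le (g := g) (σ := σ) hs hu).2, half_le_logInv hs]
      have h5 : ht g σ η u - ht g σ η a + 3 * logInv η = 0 := le_antisymm h3 (by linarith)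
      rw [h5, ENNReal.ofReal_zero, ENNReal.toReal_zero] at h2
      linarith
  have h1 := toReal_edist_triangle (edist_ne_top (g := g) (σ := σ) hs ho) (toZ g σ η u)
    (toZ g σ η a) (toZ g σ η v)
  rw [edist_comm (toZ g σ η a)] at h1
  rw [gromovProd, toReal_edist_root hs ho, toReal_edist_root hs ho]
  linarith [key u hu hdu, key v hv hdv]

end Filling

/-! ### Gromov products -/

section GromovProd

variable {Z : Type u} [PseudoEMetricSpace Z] {o : Z}

lemma gromovProd_comm (o x y : Z) : gromovProd o x y = gromovProd o y x := by
  rw [gromovProd, gromovProd, edist_comm x y]; ring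

lemma gromovProd_le (hfin : ∀ x y : Z, edist x y ≠ ⊤) (x y : Z) :
    gromovProd o x y ≤ (edist x o).toReal := by
  have := toReal_edist_triangle hfin y x o
  rw [edist_comm y x] at this
  rw [gromovProd]; linarith

lemma gromovProd_le_add (hfin : ∀ x y : Z, edist x y ≠ ⊤) {x x' y y' : Z} {M : ℝ}
    (hx : (edist x x').toReal ≤ M) (hy : (edist y y').toReal ≤ M) :
    gromovProd o x y ≤ gromovProd o x' y' + 2 * M := by
  have h1 := toReal_edist_triangle hfin x x' o
  have h2 := toReal_edist_triangle hfin y y' o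
  have h3 := toReal_edist_triangle hfin x' x y'
  have h4 := toReal_edist_triangle hfin x y y'
  rw [edist_comm x' x] at h3
  rw [gromovProd, gromovProd]; linarith

/-- The four point condition at one base point. -/
def FourPoint (o : Z) (δ : ℝ) : Prop :=
  ∀ x y z : Z, min (gromovProd o x z) (gromovProd o z y) - δ ≤ gromovProd o x y

/-- The four point condition at one base point implies the condition at all base points. -/
lemma FourPoint.isGromovHyperbolic (hfin : ∀ x y : Z, edist x y ≠ ⊤) {δ : ℝ} (hδ : 0 ≤ δ)
    (h : FourPoint o δ) : IsGromovHyperbolic Z := by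
  refine ⟨hfin, 2 * δ, by positivity, fun w x y z => ?_⟩
  have key : ∀ a b : Z, gromovProd w a b =
      gromovProd o a b - gromovProd o a w - gromovProd o b w + (edist w o).toReal := by
    intro a b
    simp only [gromovProd]; ring
  have h1 := h x y z
  have h2 := h z w x
  have h3 := h z w y
  have h4 := h x y w
  rw [gromovProd_comm o z y] at h1
  rw [gromovProd_comm o z x] at h2
  rw [gromovProd_comm o z y] at h3
  rw [gromovProd_comm o w y] at h4
  rw [key, key, key]
  generalize gromovProd o x z = xz at *
  generalize gromovProd o y z = yz at *
  generalize gromovProd o x w = xw at *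
  generalize gromovProd o y w = yw at *
  generalize gromovProd o x y = xy at *
  generalize gromovProd o z w = zw at *
  have h5 : min (xz + yw) (yz + xw) - 2 * δ ≤ xy + zw := by
    rw [sub_le_iff_le_add, min_le_iff] at *
    by_contra! hcon
    rcases h1 with h1 | h1 <;> rcases h2 with h2 | h2 <;> rcases h3 with h3 | h3 <;>
      rcases h4 with h4 | h4 <;> linarith
  rcases le_total (xz + yw) (yz + xw) with h6 | h6
  · rw [min_eq_left h6] at h5
    linarith [min_le_left (xz - xw - zw + (edist w o).toReal) (yz - yw - zw + (edist w o).toReal)]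
  · rw [min_eq_right h6] at h5
    linarith [min_le_right (xz - xw - zw + (edist w o).toReal) (yz - yw - zw + (edist w o).toReal)]

/-- The relation that defines the Gromov boundary; under the four point condition it is an
equivalence relation on the sequences converging to infinity. -/
def GromovRel (o : Z) (s t : ℕ → Z) : Prop :=
  Tendsto (fun j => gromovProd o (s j) (t j)) atTop atTop

lemma GromovRel.symm {s t : ℕ → Z} (h : GromovRel o s t) : GromovRel o t s := by
  simpa only [GromovRel, gromovProd_comm] using h

lemma GromovRel.trans {δ : ℝ} (hδ : FourPoint o δ) {r s t : ℕ → Z} (h : GromovRel o r s)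
    (h' : GromovRel o s t) : GromovRel o r t := by
  refine tendsto_atTop.2 fun b => ?_
  filter_upwards [tendsto_atTop.1 h (b + δ), tendsto_atTop.1 h' (b + δ)] with j h1 h2
  linarith [hδ (r j) (t j) (s j), le_min h1 h2]

lemma IsGromovSeq.rel_comp {s : ℕ → Z} (hs : IsGromovSeq o s) {a b : ℕ → ℕ}
    (ha : Tendsto a atTop atTop) (hb : Tendsto b atTop atTop) :
    GromovRel o (s ∘ a) (s ∘ b) := by
  have h : Tendsto (fun j => (a j, b j)) atTop (atTop : Filter (ℕ × ℕ)) := by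
    rw [← prod_atTop_atTop_eq]
    exact ha.prodMk hb
  have h' := Tendsto.comp (show Tendsto _ _ _ from hs) h
  simpa only [GromovRel, Function.comp_def] using h'

lemma GromovBoundary.mk_eq_mk {δ : ℝ} (hδ : FourPoint o δ) {s t : ℕ → Z} {hs : IsGromovSeq o s}
    {ht : IsGromovSeq o t} :
    (GromovBoundary.mk s hs : GromovBoundary o) = GromovBoundary.mk t ht ↔ GromovRel o s t := by
  refine ⟨fun h => ?_, fun h => Quot.sound (by exact h)⟩
  have key : ∀ a b : {s : ℕ → Z // IsGromovSeq o s},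
      Relation.EqvGen (fun s t : {s : ℕ → Z // IsGromovSeq o s} =>
        Tendsto (fun j => gromovProd o (s.1 j) (t.1 j)) atTop atTop) a b →
      GromovRel o a.1 b.1 := by
    intro a b hab
    induction hab with
    | rel a b h => exact h
    | refl a => exact IsGromovSeq.rel_comp (s := a.1) a.2 (a := id) (b := id) tendsto_id tendsto_id
    | symm a b _ ih => exact ih.symm
    | trans a b c _ _ ih1 ih2 => exact ih1.trans hδ ih2
  exact key ⟨s, hs⟩ ⟨t, ht⟩ (Quot.eqvGen_exact h)

end GromovProd

namespace Filling

open MetricGraph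

variable {X : Type u} [MetricSpace X] {α η : ℝ} {F : Filling X α} {g : F.Parents} {σ : F.Weight}
  {o : F.Vertex}

/-! ### Hyperbolicity of the filling -/

lemma dist_root_lt (ho : IsRoot o) (x : X) : dist x o.2.1 < 1 := by
  obtain ⟨a, ha, hxa⟩ := F.cover 0 x
  obtain rfl := (ho ⟨0, a, ha⟩).1 rfl
  simpa using hxa

/-- The additive error in the upper bound for Gromov products. -/
def gapConst (η : ℝ) : ℝ := Real.log (lowConst η)

lemma gapConst_nonneg (hs : IsSmall α η) : 0 ≤ gapConst η := by
  have hη := hs.η_pos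
  have h1 : 1 ≤ η⁻¹ := (one_le_inv₀ hη).2 (by linarith [hs.η_le])
  have h2 : 1 ≤ ctrlConst η * η⁻¹ := by
    unfold ctrlConst
    exact one_le_mul_of_one_le_of_one_le (one_le_pow₀ h1) h1
  refine Real.log_nonneg ?_
  have h3 := ctrlConst_pos hs
  have h4 : 0 ≤ 2 * ctrlConst η * (1 + η⁻¹ ^ 2) * η⁻¹ := by positivity
  unfold lowConst
  linarith

lemma le_add_of_pv_le (hs : IsSmall α η) {w : F.Vertex} {C r : ℝ} (hC : 0 < C)
    (h : pv g σ η w ≤ C * Real.exp (-r)) : r ≤ ht g σ η w + Real.log C := by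
  have := Real.log_le_log (pv_pos hs w) h
  rw [Real.log_mul hC.ne' (Real.exp_pos _).ne', Real.log_exp] at this
  rw [ht]
  linarith

lemma gromovProd_le_of_isFar (hs : IsSmall α η) (hσ : Admissible σ) (ho : IsRoot o)
    {u v : F.Vertex} {k : ℕ} (hk : k ≤ u.1) (hv : IsFar v (anc g k u)) :
    gromovProd (toZ g σ η o) (toZ g σ η u) (toZ g σ η v) ≤
      ht g σ η (anc g k u) + gapConst η := by
  have h := anc_fst (g := g) hk
  exact le_add_of_pv_le hs (lowConst_pos hs)
    (pv_le_exp_gromovProd hs hσ ho (by rw [h]; exact hk) (by rw [h]) hv)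

lemma not_isFar_iff {v w : F.Vertex} :
    ¬ IsFar v w ↔ w.1 ≤ v.1 ∧ dist v.2.1 w.2.1 ≤ 5 / 2 * α ^ w.1 := by
  rw [IsFar, not_or, not_lt]
  constructor
  · rintro ⟨h1, h2⟩
    exact ⟨h1, not_lt.1 fun h3 => h2 ⟨h1, h3⟩⟩
  · rintro ⟨h1, h2⟩
    exact ⟨h1, fun h3 => absurd h3.2 (not_lt.2 h2)⟩

/-- The four point condition for vertices: consider the deepest ancestor of `t` to which both
`u` and `v` are close. -/
lemma min_gromovProd_le (hs : IsSmall α η) (hσ : Admissible σ) (ho : IsRoot o)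
    (u v t : F.Vertex) :
    min (gromovProd (toZ g σ η o) (toZ g σ η t) (toZ g σ η u))
      (gromovProd (toZ g σ η o) (toZ g σ η t) (toZ g σ η v)) - (4 * logInv η + gapConst η) ≤
      gromovProd (toZ g σ η o) (toZ g σ η u) (toZ g σ η v) := by
  classical
  have hL := half_le_logInv hs
  have hG := gapConst_nonneg hs
  let P : ℕ → Prop := fun k => ¬ IsFar u (anc g k t) ∧ ¬ IsFar v (anc g k t)
  have h0 : P 0 := by
    have h1 : o.1 = 0 := (ho o).2 rfl
    have h2 : ∀ u : F.Vertex, ¬ IsFar u (anc g 0 t) := by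
      intro u
      have h3 : α ^ o.1 = 1 := by rw [h1, pow_zero]
      rw [anc_zero ho, not_isFar_iff, h3]
      exact ⟨by omega, by linarith [dist_root_lt ho u.2.1]⟩
    exact ⟨h2 u, h2 v⟩
  set k := Nat.findGreatest P t.1 with hk
  have hkt : k ≤ t.1 := Nat.findGreatest_le _
  have hPk : P k := Nat.findGreatest_spec (Nat.zero_le _) h0
  obtain ⟨h1, h2⟩ := hPk
  rw [not_isFar_iff] at h1 h2
  have hpos : 0 < α ^ (anc g k t).1 := hs.pow_pos _
  have h3 := le_gromovProd_of_near (g := g) (σ := σ) hs ho h1.1 (by linarith) h2.1 (by linarith)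
  rcases hkt.lt_or_eq with hlt | heq
  · have h4 : ¬ P (k + 1) := Nat.findGreatest_is_greatest (Nat.lt_succ_self _) hlt
    have h5 : ht g σ η (anc g (k + 1) t) ≤ ht g σ η (anc g k t) + logInv η := by
      have := ht_par_le (g := g) (σ := σ) hs (anc g (k + 1) t)
      rwa [par_anc hlt] at this
    have h6 : min (gromovProd (toZ g σ η o) (toZ g σ η t) (toZ g σ η u))
        (gromovProd (toZ g σ η o) (toZ g σ η t) (toZ g σ η v)) ≤
        ht g σ η (anc g (k + 1) t) + gapConst η := by
      by_cases hu : IsFar u (anc g (k + 1) t)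
      · exact (min_le_left _ _).trans (gromovProd_le_of_isFar hs hσ ho hlt hu)
      · by_cases hv : IsFar v (anc g (k + 1) t)
        · exact (min_le_right _ _).trans (gromovProd_le_of_isFar hs hσ ho hlt hv)
        · exact absurd ⟨hu, hv⟩ h4
    linarith
  · -- here `anc g k t` is `t` itself, and the height of `t` bounds its Gromov products
    have h4 := gromovProd_le (o := toZ g σ η o) (edist_ne_top (σ := σ) (g := g) hs ho) (toZ g σ η t)
      (toZ g σ η u)
    rw [toReal_edist_root hs ho] at h4
    rw [anc_of_le heq.ge] at h3
    linarith [min_le_left (gromovProd (toZ g σ η o) (toZ g σ η t) (toZ g σ η u))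
        (gromovProd (toZ g σ η o) (toZ g σ η t) (toZ g σ η v))]

/-- The constant in the four point condition. -/
def hypConst (η : ℝ) : ℝ := 12 * logInv η + gapConst η

lemma toReal_edist_le (hs : IsSmall α η) {p q : Z g σ η}
    (h : edist p q ≤ ENNReal.ofReal (2 * logInv η)) : (edist p q).toReal ≤ 2 * logInv η :=
  ENNReal.toReal_le_of_le_ofReal (by linarith [half_le_logInv hs]) h

lemma hypConst_nonneg (hs : IsSmall α η) : 0 ≤ hypConst η := by
  unfold hypConst
  linarith [half_le_logInv hs, gapConst_nonneg hs]

/-- The four point condition for all points, by replacing each point by a vertex nearby. -/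
lemma fourPoint (hs : IsSmall α η) (hσ : Admissible σ) (ho : IsRoot o) :
    FourPoint (toZ g σ η o) (hypConst η) := by
  intro p q r
  have hfin := edist_ne_top (σ := σ) (g := g) hs ho
  obtain ⟨u, hu⟩ := exists_vertex_near hs p
  obtain ⟨v, hv⟩ := exists_vertex_near hs q
  obtain ⟨t, ht⟩ := exists_vertex_near hs r
  have hu' := toReal_edist_le hs hu
  have hv' := toReal_edist_le hs hv
  have ht' := toReal_edist_le hs ht
  have h1 := min_gromovProd_le (g := g) hs hσ ho u v t
  have h2 := gromovProd_le_add (o := toZ g σ η o) hfin hu' ht'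
  have h3 := gromovProd_le_add (o := toZ g σ η o) hfin ht' hv'
  rw [edist_comm] at hu' hv'
  have h4 := gromovProd_le_add (o := toZ g σ η o) hfin hu' hv'
  rw [gromovProd_comm _ (toZ g σ η t) (toZ g σ η u)] at h1
  have h5 := min_le_min h2 h3
  rw [min_add_add_right] at h5
  rw [hypConst]
  linarith

end Filling

/-! ### Sequences of vertices converging to a point -/

namespace Filling

open MetricGraph

variable {X : Type u} [MetricSpace X] {α η : ℝ} {F : Filling X α} {g : F.Parents} {σ : F.Weight}
  {o : F.Vertex}

/-- A sequence of vertices converges to the point `x` if the levels tend to infinity and the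
positions tend to `x`. -/
structure TendsToPoint (u : ℕ → F.Vertex) (x : X) : Prop where
  level : Tendsto (fun j => (u j).1) atTop atTop
  pos : Tendsto (fun j => (u j).2.1) atTop (𝓝 x)

variable (F) in
/-- A vertex of level `n` whose ball of radius `α ^ n` contains `x`, by the covering property. -/
def nearVertex (x : X) (n : ℕ) : F.Vertex :=
  ⟨n, (F.cover n x).choose, (F.cover n x).choose_spec.1⟩

lemma dist_nearVertex (x : X) (n : ℕ) : dist x (nearVertex F x n).2.1 < α ^ n :=
  (F.cover n x).choose_spec.2

lemma dist_nearVertex_lt (hs : IsSmall α η) (x : X) (n : ℕ) :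
    dist x (nearVertex F x n).2.1 < 29 / 10 * α ^ (nearVertex F x n).1 := by
  refine (dist_nearVertex x n).trans_le ?_
  change α ^ n ≤ 29 / 10 * α ^ n
  linarith [hs.pow_pos n]

lemma IsSmall.tendsto_pow (hs : IsSmall α η) : Tendsto (fun n : ℕ => α ^ n) atTop (𝓝 0) :=
  tendsto_pow_atTop_nhds_zero_of_lt_one hs.α_pos.le (by linarith [hs.α_le])

lemma tendsToPoint_nearVertex (hs : IsSmall α η) (x : X) : TendsToPoint (nearVertex F x) x := by
  refine ⟨tendsto_id, ?_⟩
  rw [tendsto_iff_dist_tendsto_zero]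
  refine squeeze_zero (fun _ => dist_nonneg) (fun n => ?_) hs.tendsto_pow
  rw [dist_comm]
  exact (dist_nearVertex x n).le

lemma TendsToPoint.eventually {u : ℕ → F.Vertex} {x : X} (h : TendsToPoint u x) (n : ℕ) {z : X}
    {r : ℝ} (hz : dist x z < r) : ∀ᶠ j in atTop, n ≤ (u j).1 ∧ dist (u j).2.1 z < r :=
  (h.level.eventually_ge_atTop n).and (h.pos (isOpen_ball.mem_nhds hz))

lemma exists_forall_ge_and {P Q : ℕ → Prop} (hP : ∀ᶠ j in atTop, P j) (hQ : ∀ᶠ j in atTop, Q j) :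
    ∃ N, ∀ j ≥ N, P j ∧ Q j := eventually_atTop.1 (hP.and hQ)

lemma mul_le_ht (hs : IsSmall α η) (u : F.Vertex) : u.1 * η ≤ ht g σ η u := by
  have h1 : 0 < 1 - η := by linarith [hs.η_le]
  have h2 := Real.log_le_log (pv_pos hs u) (piLevel_le_pow g σ hs u.1 u.2)
  rw [Real.log_pow] at h2
  have h3 := Real.log_le_sub_one_of_pos h1
  rw [ht]
  have : (u.1 : ℝ) * Real.log (1 - η) ≤ u.1 * (-η) :=
    mul_le_mul_of_nonneg_left (by linarith) (Nat.cast_nonneg _)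
  linarith

lemma exists_le_gromovProd (hs : IsSmall α η) (ho : IsRoot o) {u v : ℕ → F.Vertex} {x y : X}
    (hu : TendsToPoint u x) (hv : TendsToPoint v y) {a : F.Vertex}
    (hx : dist x a.2.1 < 29 / 10 * α ^ a.1) (hy : dist y a.2.1 < 29 / 10 * α ^ a.1) :
    ∃ N, ∀ j ≥ N, ∀ k ≥ N, ht g σ η a - 3 * logInv η ≤
      gromovProd (toZ g σ η o) (toZ g σ η (u j)) (toZ g σ η (v k)) := by
  obtain ⟨N, hN⟩ := exists_forall_ge_and (hu.eventually a.1 hx) (hv.eventually a.1 hy)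
  exact ⟨N, fun j hj k hk => le_gromovProd_of_near hs ho (hN j hj).1.1 (hN j hj).1.2
    (hN k hk).2.1 (hN k hk).2.2⟩

lemma exists_forall_le_gromovProd (hs : IsSmall α η) (ho : IsRoot o) {u v : ℕ → F.Vertex} {x : X}
    (hu : TendsToPoint u x) (hv : TendsToPoint v x) (b : ℝ) :
    ∃ N, ∀ j ≥ N, ∀ k ≥ N, b ≤
      gromovProd (toZ g σ η o) (toZ g σ η (u j)) (toZ g σ η (v k)) := by
  obtain ⟨n, hn⟩ := exists_nat_ge ((b + 3 * logInv η) / η)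
  rw [div_le_iff₀ hs.η_pos] at hn
  have hx := dist_nearVertex_lt (F := F) hs x n
  obtain ⟨N, hN⟩ := exists_le_gromovProd (g := g) (σ := σ) hs ho hu hv hx hx
  refine ⟨N, fun j hj k hk => le_trans ?_ (hN j hj k hk)⟩
  have h1 := mul_le_ht (g := g) (σ := σ) hs (nearVertex F x n)
  change (n : ℝ) * η ≤ _ at h1
  linarith

lemma TendsToPoint.isGromovSeq (hs : IsSmall α η) (ho : IsRoot o) {u : ℕ → F.Vertex} {x : X}
    (hu : TendsToPoint u x) : IsGromovSeq (toZ g σ η o) (fun j => toZ g σ η (u j)) := by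
  unfold IsGromovSeq
  rw [Filter.tendsto_atTop]
  intro b
  obtain ⟨N, hN⟩ := exists_forall_le_gromovProd (g := g) (σ := σ) hs ho hu hu b
  exact eventually_atTop.2 ⟨(N, N), fun p hp => hN p.1 hp.1 p.2 hp.2⟩

lemma TendsToPoint.gromovRel (hs : IsSmall α η) (ho : IsRoot o) {u v : ℕ → F.Vertex} {x : X}
    (hu : TendsToPoint u x) (hv : TendsToPoint v x) :
    GromovRel (toZ g σ η o) (fun j => toZ g σ η (u j)) (fun j => toZ g σ η (v j)) := by
  unfold GromovRel
  rw [Filter.tendsto_atTop]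
  intro b
  obtain ⟨N, hN⟩ := exists_forall_le_gromovProd (g := g) (σ := σ) hs ho hu hv b
  exact eventually_atTop.2 ⟨N, fun j hj => hN j hj j hj⟩

/-- Sequences converging to different points are eventually separated at a scale comparable to
the distance of the two points, namely two levels below that distance. -/
lemma exists_isFar (hs : IsSmall α η) {u v : ℕ → F.Vertex} {x y : X}
    (hu : TendsToPoint u x) (hv : TendsToPoint v y) {a : F.Vertex}
    (hx : dist x a.2.1 < α ^ a.1) (hxy : α ^ (a.1 + 1) < dist x y) :
    ∃ N, ∀ j ≥ N, ∀ k ≥ N, ∃ w : F.Vertex, w.1 ≤ (u j).1 ∧ anc g w.1 (u j) = w ∧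
      IsFar (v k) w ∧ η ^ 3 * pv g σ η a ≤ pv g σ η w := by
  have hp := hs.pow_pos (a.1 + 2)
  have hp1 := hs.pow_succ_le (a.1 + 1)
  have hp2 := hs.pow_succ_le a.1
  obtain ⟨N, hN⟩ := exists_forall_ge_and
    (hu.eventually (a.1 + 2) (z := x) (r := α ^ (a.1 + 2)) (by rwa [dist_self]))
    (hv.eventually (a.1 + 2) (z := y) (r := α ^ (a.1 + 2)) (by rwa [dist_self]))
  refine ⟨N, fun j hj k hk => ?_⟩
  obtain ⟨hj1, hj2⟩ := (hN j hj).1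
  obtain ⟨hk1, hk2⟩ := (hN k hk).2
  have hfst := anc_fst (g := g) hj1
  have hd := dist_anc_le (g := g) hs hj1
  generalize hw : anc g (a.1 + 2) (u j) = w at hfst hd
  have hpw : α ^ w.1 = α ^ (a.1 + 2) := by rw [hfst]
  refine ⟨w, by rw [hfst]; exact hj1, by rw [hfst]; exact hw,
    Or.inr ⟨by rw [hfst]; exact hk1, ?_⟩, ?_⟩
  · rw [hpw]
    have h1 := dist_triangle4 x w.2.1 (v k).2.1 y
    have h2 := dist_triangle_left x w.2.1 (u j).2.1
    rw [dist_comm w.2.1 (v k).2.1] at h1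
    rw [dist_comm (u j).2.1 w.2.1] at h2
    linarith
  · have haw : a.1 ≤ w.1 := by omega
    have h1 : dist w.2.1 a.2.1 < 29 / 10 * α ^ a.1 := by
      have h2 := dist_triangle4 w.2.1 (u j).2.1 x a.2.1
      linarith [hs.pow_pos (a.1 + 1)]
    have h2 := dist_anc_lt (g := g) hs haw h1
    have h3 := anc_fst (g := g) haw
    have h5 : α ^ (anc g a.1 w).1 = α ^ a.1 := by rw [h3]
    rw [h5, dist_comm] at h2
    have h4 := pv_of_near (g := g) (σ := σ) hs h3.symm h2
    have h6 := mul_anc_le_pv (g := g) (σ := σ) hs haw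
    rw [show w.1 - a.1 = 2 by omega] at h6
    calc η ^ 3 * pv g σ η a = η ^ 2 * (η * pv g σ η a) := by ring
      _ ≤ η ^ 2 * pv g σ η (anc g a.1 w) := mul_le_mul_of_nonneg_left h4 (sq_nonneg _)
      _ ≤ _ := h6

/-- The constant in the bounds from below for sequences converging to points of `X`, in terms of
`π` at the scale of the distance of the points. The factor `η⁻¹ ^ 3` comes from `exists_isFar`. -/
def farConst (η : ℝ) : ℝ := η⁻¹ ^ 3 * lowConst η

lemma farConst_pos (hs : IsSmall α η) : 0 < farConst η := by
  have := hs.η_pos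
  have := lowConst_pos hs
  unfold farConst; positivity

lemma le_of_cube_mul_le (hs : IsSmall α η) {p q : ℝ} (h : η ^ 3 * p ≤ q) : p ≤ η⁻¹ ^ 3 * q := by
  rw [inv_pow, le_inv_mul_iff₀ (pow_pos hs.η_pos 3)]
  exact h

lemma exists_gromovProd_le (hs : IsSmall α η) (hσ : Admissible σ) (ho : IsRoot o)
    {u v : ℕ → F.Vertex} {x y : X} (hu : TendsToPoint u x) (hv : TendsToPoint v y) {a : F.Vertex}
    (hx : dist x a.2.1 < α ^ a.1) (hxy : α ^ (a.1 + 1) < dist x y) :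
    ∃ N, ∀ j ≥ N, ∀ k ≥ N, gromovProd (toZ g σ η o) (toZ g σ η (u j)) (toZ g σ η (v k)) ≤
      ht g σ η a + Real.log (farConst η) := by
  obtain ⟨N, hN⟩ := exists_isFar (g := g) (σ := σ) hs hu hv hx hxy
  refine ⟨N, fun j hj k hk => ?_⟩
  obtain ⟨w, h1, h2, h3, h4⟩ := hN j hj k hk
  refine le_add_of_pv_le hs (farConst_pos hs) ?_
  refine (le_of_cube_mul_le hs h4).trans ?_
  rw [farConst, mul_assoc]
  have := hs.η_pos
  exact mul_le_mul_of_nonneg_left (pv_le_exp_gromovProd hs hσ ho h1 h2 h3) (by positivity)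

lemma exists_le_deformDist (hs : IsSmall α η) (hσ : Admissible σ) (ho : IsRoot o)
    {u v : ℕ → F.Vertex} {x y : X} (hu : TendsToPoint u x) (hv : TendsToPoint v y) {a : F.Vertex}
    (hx : dist x a.2.1 < α ^ a.1) (hxy : α ^ (a.1 + 1) < dist x y) :
    ∃ N, ∀ j ≥ N, ∀ k ≥ N, ENNReal.ofReal (pv g σ η a) ≤ ENNReal.ofReal (farConst η) *
      deformDist (toZ g σ η o) 1 (toZ g σ η (u j)) (toZ g σ η (v k)) := by
  obtain ⟨N, hN⟩ := exists_isFar (g := g) (σ := σ) hs hu hv hx hxy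
  refine ⟨N, fun j hj k hk => ?_⟩
  obtain ⟨w, h1, h2, h3, h4⟩ := hN j hj k hk
  have hη := hs.η_pos
  refine (ENNReal.ofReal_le_ofReal (le_of_cube_mul_le hs h4)).trans ?_
  rw [farConst, ENNReal.ofReal_mul (by positivity), ENNReal.ofReal_mul (by positivity), mul_assoc]
  exact mul_le_mul_right (pv_le_deformDist hs hσ ho h1 h2 (Or.inl ⟨_, rfl, h3⟩)) _

/-! ### The Gromov boundary of the filling -/

variable (g σ) in
/-- The point of the Gromov boundary that corresponds to a point of `X`. -/
def toGromovBoundary (hs : IsSmall α η) (ho : IsRoot o) (x : X) :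
    GromovBoundary (toZ g σ η o) :=
  GromovBoundary.mk (fun j => toZ g σ η (nearVertex F x j))
    ((tendsToPoint_nearVertex hs x).isGromovSeq hs ho)

lemma mk_eq_toGromovBoundary (hs : IsSmall α η) (hσ : Admissible σ) (ho : IsRoot o)
    {s : ℕ → Z g σ η} {h : IsGromovSeq (toZ g σ η o) s} {x : X} :
    (GromovBoundary.mk s h : GromovBoundary (toZ g σ η o)) = toGromovBoundary g σ hs ho x ↔
      GromovRel (toZ g σ η o) s (fun j => toZ g σ η (nearVertex F x j)) :=
  GromovBoundary.mk_eq_mk (fourPoint hs hσ ho)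

lemma exists_pow_lt_dist (hs : IsSmall α η) {x y : X} (hxy : x ≠ y) :
    ∃ n : ℕ, α ^ (n + 1) < dist x y := by
  obtain ⟨n, hn⟩ := exists_pow_lt_of_lt_one (dist_pos.2 hxy)
    (show α < 1 by linarith [hs.α_le])
  exact ⟨n, (hs.pow_le_pow (Nat.le_succ n)).trans_lt hn⟩

lemma toGromovBoundary_injective (hs : IsSmall α η) (hσ : Admissible σ) (ho : IsRoot o) :
    Function.Injective (toGromovBoundary g σ hs ho) := by
  intro x y h
  by_contra hxy
  have h1 : GromovRel (toZ g σ η o) (fun j => toZ g σ η (nearVertex F x j))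
      (fun j => toZ g σ η (nearVertex F y j)) := (mk_eq_toGromovBoundary hs hσ ho).1 h
  obtain ⟨n, hn⟩ := exists_pow_lt_dist hs hxy
  obtain ⟨N, hN⟩ := exists_gromovProd_le (g := g) hs hσ ho (tendsToPoint_nearVertex hs x)
    (tendsToPoint_nearVertex hs y) (a := nearVertex F x n) (dist_nearVertex x n) hn
  unfold GromovRel at h1
  obtain ⟨j, hj1, hj2⟩ := ((Filter.tendsto_atTop.1 h1 (ht g σ η (nearVertex F x n) +
    Real.log (farConst η) + 1)).and (eventually_ge_atTop N)).exists
  linarith [hN j hj2 j hj2]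

lemma toGromovBoundary_surjective [CompactSpace X] (hs : IsSmall α η) (hσ : Admissible σ)
    (ho : IsRoot o) : Function.Surjective (toGromovBoundary g σ hs ho) := by
  rintro ⟨s, hs'⟩
  change ∃ x, toGromovBoundary g σ hs ho x = GromovBoundary.mk s hs'
  have hfin := edist_ne_top (σ := σ) (g := g) hs ho
  -- vertices near the points of the sequence have positions with a convergent subsequence
  choose u hu using fun j => exists_vertex_near hs (s j)
  have hu' := fun j => toReal_edist_le hs (hu j)
  have hlevel : Tendsto (fun j => (u j).1) atTop atTop := by
    refine Filter.tendsto_atTop.2 fun n => ?_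
    have h1 : GromovRel (toZ g σ η o) s s := by
      simpa using hs'.rel_comp (tendsto_id) (tendsto_id)
    unfold GromovRel at h1
    filter_upwards [Filter.tendsto_atTop.1 h1 (n * logInv η + 2 * logInv η)] with j hj
    have h2 := gromovProd_le (o := toZ g σ η o) hfin (s j) (s j)
    have h3 := toReal_edist_triangle hfin (s j) (toZ g σ η (u j)) (toZ g σ η o)
    rw [toReal_edist_root hs ho] at h3
    have h4 := ht_le_mul_level (g := g) (σ := σ) hs (u j)
    have hL := half_le_logInv hs
    have h5 : (n : ℝ) * logInv η ≤ (u j).1 * logInv η := by linarith [hu' j]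
    exact_mod_cast le_of_mul_le_mul_right h5 (by linarith)
  obtain ⟨x, -, φ, hφ, hx⟩ := isCompact_univ.tendsto_subseq (x := fun j => (u j).2.1)
    (fun _ => mem_univ _)
  refine ⟨x, ?_⟩
  have h1 : TendsToPoint (u ∘ φ) x := ⟨hlevel.comp hφ.tendsto_atTop, hx⟩
  have h2 := h1.gromovRel (g := g) (σ := σ) hs ho (tendsToPoint_nearVertex hs x)
  have h3 : GromovRel (toZ g σ η o) (s ∘ φ) (fun j => toZ g σ η (nearVertex F x j)) := by
    unfold GromovRel at h2 ⊢
    refine Filter.tendsto_atTop.2 fun b => ?_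
    filter_upwards [Filter.tendsto_atTop.1 h2 (b + 2 * (2 * logInv η))] with j hj
    have h4 := gromovProd_le_add (o := toZ g σ η o) hfin (x := toZ g σ η (u (φ j)))
      (x' := s (φ j)) (y := toZ g σ η (nearVertex F x j)) (y' := toZ g σ η (nearVertex F x j))
      (M := 2 * logInv η) (by rw [edist_comm]; exact hu' _)
      (by rw [edist_self, ENNReal.toReal_zero]; linarith [half_le_logInv hs])
    simp only [Function.comp_apply] at hj ⊢
    linarith
  have h4 : GromovRel (toZ g σ η o) s (s ∘ φ) := by
    simpa using hs'.rel_comp tendsto_id hφ.tendsto_atTop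
  exact ((mk_eq_toGromovBoundary hs hσ ho).2 (h4.trans (fourPoint hs hσ ho) h3)).symm

lemma boundaryProd_le (hs : IsSmall α η) (hσ : Admissible σ) (ho : IsRoot o) {x y : X}
    {a : F.Vertex} (hx : dist x a.2.1 < α ^ a.1) (hxy : α ^ (a.1 + 1) < dist x y) :
    boundaryProd (toGromovBoundary g σ hs ho x) (toGromovBoundary g σ hs ho y) ≤
      ((ht g σ η a + Real.log (farConst η) : ℝ) : EReal) := by
  obtain ⟨N, hN⟩ := exists_gromovProd_le (g := g) hs hσ ho (tendsToPoint_nearVertex hs x)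
    (tendsToPoint_nearVertex hs y) hx hxy
  refine iInf_le_of_le _ (iInf_le_of_le _ (iInf_le_of_le _ (iInf_le_of_le _
    (iInf_le_of_le rfl (iInf_le_of_le rfl ?_)))))
  refine liminf_le_of_frequently_le' (Eventually.frequently ?_)
  filter_upwards [eventually_ge_atTop N] with j hj
  exact EReal.coe_le_coe_iff.2 (hN j hj j hj)

/-- The boundary product is an infimum over all representing sequences; by the four point condition
it is at most `2 hypConst η` smaller than for the sequences of vertices `nearVertex`. -/
lemma le_boundaryProd (hs : IsSmall α η) (hσ : Admissible σ) (ho : IsRoot o) {x y : X}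
    {a : F.Vertex} (hx : dist x a.2.1 < 29 / 10 * α ^ a.1)
    (hy : dist y a.2.1 < 29 / 10 * α ^ a.1) :
    ((ht g σ η a - 3 * logInv η - 2 * hypConst η : ℝ) : EReal) ≤
    boundaryProd (toGromovBoundary g σ hs ho x) (toGromovBoundary g σ hs ho y) := by
  have hδ := fourPoint (g := g) hs hσ ho
  have hδ0 := hypConst_nonneg hs
  obtain ⟨N, hN⟩ := exists_le_gromovProd (g := g) (σ := σ) hs ho (tendsToPoint_nearVertex hs x)
    (tendsToPoint_nearVertex hs y) hx hy
  refine le_iInf fun s => le_iInf fun t => le_iInf fun hs' => le_iInf fun ht' => le_iInf fun h1 =>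
    le_iInf fun h2 => ?_
  have h3 := (mk_eq_toGromovBoundary hs hσ ho).1 h1
  have h4 := (mk_eq_toGromovBoundary hs hσ ho).1 h2
  unfold GromovRel at h3 h4
  refine le_liminf_of_le (by isBoundedDefault) ?_
  filter_upwards [eventually_ge_atTop N, Filter.tendsto_atTop.1 h3 (ht g σ η a),
    Filter.tendsto_atTop.1 h4 (ht g σ η a)] with j hj h5 h6
  refine EReal.coe_le_coe_iff.2 ?_
  have h7 := hN j hj j hj
  rw [gromovProd_comm] at h6
  have h8 := hδ (s j) (t j) (toZ g σ η (nearVertex F x j))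
  have h9 := hδ (toZ g σ η (nearVertex F x j)) (t j) (toZ g σ η (nearVertex F y j))
  have hL := half_le_logInv hs
  have h10 := le_min h7 (show ht g σ η a - 3 * logInv η ≤ _ from (by linarith : _ ≤ _).trans h6)
  have h11 := le_min (show ht g σ η a - 3 * logInv η - hypConst η ≤ _ from
    (by linarith : _ ≤ ht g σ η a).trans h5) (show ht g σ η a - 3 * logInv η - hypConst η ≤ _ from
    (by linarith [h10, h9] : _ ≤ _))
  linarith

lemma boundaryProd_self (hs : IsSmall α η) (hσ : Admissible σ) (ho : IsRoot o) (x : X) :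
    boundaryProd (toGromovBoundary g σ hs ho x) (toGromovBoundary g σ hs ho x) = ⊤ := by
  rw [EReal.eq_top_iff_forall_lt]
  intro b
  obtain ⟨n, hn⟩ := exists_nat_gt ((b + 3 * logInv η + 2 * hypConst η) / η)
  rw [div_lt_iff₀ hs.η_pos] at hn
  have hx := dist_nearVertex_lt (F := F) hs x n
  refine lt_of_lt_of_le (EReal.coe_lt_coe_iff.2 ?_) (le_boundaryProd hs hσ ho hx hx)
  have h1 := mul_le_ht (g := g) (σ := σ) hs (nearVertex F x n)
  change (n : ℝ) * η ≤ _ at h1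
  linarith

end Filling

/-! ### The completion of the deformed space -/

section Completion

variable {Z : Type u} [PseudoEMetricSpace Z] {o : Z} {ε : ℝ}

/-- The metric of the completion of `(Z, d_ε)`, if all distances are finite. It induces the uniform
structure that the completion carries as a completion. -/
@[reducible]
def completionMetricSpace (h : ∀ x y : Z, deformDist o ε x y ≠ ⊤) :
    MetricSpace (UniformSpace.Completion (Deformed o ε)) :=
  letI : PseudoMetricSpace (Deformed o ε) := PseudoEMetricSpace.toPseudoMetricSpace h
  UniformSpace.Completion.instMetricSpace

/-- The distance of two points in the completion of `(Z, d_ε)`. -/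
def completionEDist (h : ∀ x y : Z, deformDist o ε x y ≠ ⊤)
    (p q : UniformSpace.Completion (Deformed o ε)) : ℝ≥0∞ :=
  letI := completionMetricSpace h
  edist p q

lemma tendsto_completionEDist (h : ∀ x y : Z, deformDist o ε x y ≠ ⊤)
    {p q : UniformSpace.Completion (Deformed o ε)} {s t : ℕ → Z}
    (hs : Tendsto (fun j => toCompletion o ε (s j)) atTop (𝓝 p))
    (ht : Tendsto (fun j => toCompletion o ε (t j)) atTop (𝓝 q)) :
    Tendsto (fun j => deformDist o ε (s j) (t j)) atTop (𝓝 (completionEDist h p q)) := by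
  let : PseudoMetricSpace (Deformed o ε) := PseudoEMetricSpace.toPseudoMetricSpace h
  let := completionMetricSpace h
  have h1 := Tendsto.edist hs ht
  refine h1.congr fun j => ?_
  exact UniformSpace.Completion.edist_eq (α := Deformed o ε) (s j) (t j)

/-- The metric `d_ε` on `∂_ε Z`. -/
@[reducible]
def boundaryMetricSpace (h : ∀ x y : Z, deformDist o ε x y ≠ ⊤) :
    MetricSpace (DeformBoundary o ε) :=
  letI := completionMetricSpace h
  inferInstanceAs (MetricSpace {p : UniformSpace.Completion (Deformed o ε) //
    p ∉ range (toCompletion o ε)})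

lemma isBoundaryMetric_boundaryMetricSpace (h : ∀ x y : Z, deformDist o ε x y ≠ ⊤) :
    IsBoundaryMetric o ε (boundaryMetricSpace h) := by
  intro p q s t hs ht
  let := boundaryMetricSpace h
  rw [← edist_dist]
  exact tendsto_completionEDist h hs ht

lemma exists_tendsto_toCompletion {s : ℕ → Z}
    (hs : ∀ r > 0, ∃ N, ∀ j ≥ N, ∀ k ≥ N, deformDist o ε (s j) (s k) < r) :
    ∃ p, Tendsto (fun j => toCompletion o ε (s j)) atTop (𝓝 p) := by
  let t : ℕ → Deformed o ε := s
  have h1 : CauchySeq t := EMetric.cauchySeq_iff.2 fun r hr => by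
    obtain ⟨N, hN⟩ := hs r hr
    exact ⟨N, fun m hm n hn => hN m hm n hn⟩
  exact cauchySeq_tendsto_of_complete
    (h1.map (UniformSpace.Completion.uniformContinuous_coe (Deformed o ε)))

lemma tendsto_toCompletion_of_deformDist {p : UniformSpace.Completion (Deformed o ε)}
    {s t : ℕ → Z} (hs : Tendsto (fun j => toCompletion o ε (s j)) atTop (𝓝 p))
    (h : Tendsto (fun j => deformDist o ε (s j) (t j)) atTop (𝓝 0)) :
    Tendsto (fun j => toCompletion o ε (t j)) atTop (𝓝 p) := by
  let s' : ℕ → Deformed o ε := s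
  let t' : ℕ → Deformed o ε := t
  have h1 : Tendsto (fun j => (s' j, t' j)) atTop (uniformity (Deformed o ε)) := by
    rw [uniformity_basis_edist.tendsto_right_iff]
    intro r hr
    exact h.eventually (gt_mem_nhds hr)
  have h2 : Tendsto (fun p : Deformed o ε × Deformed o ε =>
      ((p.1 : UniformSpace.Completion (Deformed o ε)),
        (p.2 : UniformSpace.Completion (Deformed o ε)))) (uniformity _) (uniformity _) :=
    UniformSpace.Completion.uniformContinuous_coe (Deformed o ε)
  exact Filter.Tendsto.congr_uniformity (f := fun j => toCompletion o ε (s j)) hs (h2.comp h1)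

lemma exists_seq_tendsto_completion (h : ∀ x y : Z, deformDist o ε x y ≠ ⊤)
    (p : UniformSpace.Completion (Deformed o ε)) :
    ∃ s : ℕ → Z, Tendsto (fun j => toCompletion o ε (s j)) atTop (𝓝 p) := by
  have : FirstCountableTopology (UniformSpace.Completion (Deformed o ε)) := by
    let := completionMetricSpace h
    infer_instance
  have h1 : p ∈ closure (range (toCompletion o ε)) :=
    (UniformSpace.Completion.denseRange_coe (α := Deformed o ε)) p
  obtain ⟨x, hx, hlim⟩ := mem_closure_iff_seq_limit.1 h1
  choose s hs using hx
  exact ⟨s, by simpa only [hs] using hlim⟩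

lemma tendsto_deformDist_of_toCompletion (h : ∀ x y : Z, deformDist o ε x y ≠ ⊤) {z : Z}
    {s : ℕ → Z} (hs : Tendsto (fun j => toCompletion o ε (s j)) atTop (𝓝 (toCompletion o ε z))) :
    Tendsto (fun j => deformDist o ε (s j) z) atTop (𝓝 0) := by
  have h1 := tendsto_completionEDist h hs (t := fun _ => z) tendsto_const_nhds
  let := completionMetricSpace h
  have h2 : completionEDist h (toCompletion o ε z) (toCompletion o ε z) = 0 :=
    edist_self (toCompletion o ε z)
  rwa [h2] at h1

end Completion

namespace Filling

open MetricGraph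

variable {X : Type u} [MetricSpace X] {α η : ℝ} {F : Filling X α} {g : F.Parents} {σ : F.Weight}
  {o : F.Vertex}

/-! ### Stars of vertices -/

/-- The vertex `u` together with the edges at `u`. -/
def star (g : F.Parents) (σ : F.Weight) (η : ℝ) (u : F.Vertex) : Set (Z g σ η) :=
  {toZ g σ η u} ∪ {q | ∃ (v : F.Vertex) (h : (ZGraph g).Adj u v), ∃ s ∈ Icc (0 : ℝ) 1,
    q = edgeAt _ h s}

lemma exists_mem_star (q : Z g σ η) : ∃ u, q ∈ star g σ η u := by
  rcases exists_eq_vertex_or_edgeAt q with ⟨v, rfl⟩ | ⟨u, v, h, s, hs, rfl⟩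
  · exact ⟨v, Or.inl rfl⟩
  · exact ⟨u, Or.inr ⟨v, h, s, hs, rfl⟩⟩

lemma deformDist_star_le (hs : IsSmall α η) (ho : IsRoot o) {u : F.Vertex} {q : Z g σ η}
    (hq : q ∈ star g σ η u) : deformDist (toZ g σ η o) 1 (toZ g σ η u) q ≤
      ENNReal.ofReal (edgeConst η * pv g σ η u) := by
  rcases hq with rfl | ⟨v, h, s, hs', rfl⟩
  · rw [deformDist_self]; exact bot_le
  · have := deformDist_edge_le_pv (σ := σ) hs ho h (left_mem_Icc.2 zero_le_one) hs'
    rwa [edgeAt_zero] at this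

lemma deformDist_root_ne_top (hs : IsSmall α η) (ho : IsRoot o) (u : F.Vertex) :
    deformDist (toZ g σ η o) 1 (toZ g σ η u) (toZ g σ η o) ≠ ⊤ := by
  have := (deformDist_anc_le (g := g) (σ := σ) hs ho (Nat.zero_le u.1)).1
  rw [anc_zero ho] at this
  exact ne_top_of_le_ne_top ENNReal.ofReal_ne_top this

lemma deformDist_ne_top (hs : IsSmall α η) (ho : IsRoot o) (p q : Z g σ η) :
    deformDist (toZ g σ η o) 1 p q ≠ ⊤ := by
  have key : ∀ p : Z g σ η, deformDist (toZ g σ η o) 1 p (toZ g σ η o) ≠ ⊤ := by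
    intro p
    obtain ⟨u, hu⟩ := exists_mem_star p
    refine ne_top_of_le_ne_top (ENNReal.add_ne_top.2 ⟨?_, deformDist_root_ne_top hs ho u⟩)
      (deformDist_triangle _ _ p (toZ g σ η u) _)
    exact ne_top_of_le_ne_top ENNReal.ofReal_ne_top
      ((deformDist_comm_le _ _ _ _).trans (deformDist_star_le hs ho hu))
  refine ne_top_of_le_ne_top (ENNReal.add_ne_top.2 ⟨key p, ?_⟩)
    (deformDist_triangle _ _ p (toZ g σ η o) _)
  exact ne_top_of_le_ne_top (key q) (deformDist_comm_le _ _ _ _)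

lemma level_le_of_adj {u v : F.Vertex} (h : (ZGraph g).Adj u v) : v.1 ≤ u.1 + 1 := by
  rcases (SimpleGraph.fromRel_adj _ _ _).1 h with ⟨-, h | h⟩
  · rcases h with ⟨u, v, -⟩ | ⟨v⟩
    · exact Nat.le_succ _
    · exact le_rfl
  · rcases h with ⟨u, v, -⟩ | ⟨v⟩
    · exact Nat.le_succ _
    · exact Nat.le_succ_of_le (Nat.le_succ _)

lemma finite_level_le (F : Filling X α) (n : ℕ) : {u : F.Vertex | u.1 ≤ n}.Finite := by
  refine (((Finset.range (n + 1)).sigma fun n => (Finset.univ : Finset (F.V n))).finite_toSet).subset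
    fun u hu => ?_
  simpa [Nat.lt_succ_iff] using hu

/-- A star consists of finitely many edges, hence is compact in the completion. -/
lemma isCompact_image_star (hs : IsSmall α η) (ho : IsRoot o) (u : F.Vertex) :
    IsCompact (toCompletion (toZ g σ η o) 1 '' star g σ η u) := by
  have hsub : star g σ η u = {toZ g σ η u} ∪ ⋃ v ∈ {v : F.Vertex | v.1 ≤ u.1 + 1},
      {q | ∃ h : (ZGraph g).Adj u v, ∃ s ∈ Icc (0 : ℝ) 1, q = edgeAt _ h s} := by
    ext q
    simp only [star, mem_union, mem_singleton_iff, mem_ofPred_eq, mem_iUnion, exists_prop]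
    refine or_congr Iff.rfl ⟨?_, ?_⟩
    · rintro ⟨v, h, s⟩
      exact ⟨v, level_le_of_adj h, h, s⟩
    · rintro ⟨v, -, h, s⟩
      exact ⟨v, h, s⟩
  rw [hsub, image_union, image_iUnion₂]
  refine IsCompact.union (by simp) ((finite_level_le F _).isCompact_biUnion fun v _ => ?_)
  by_cases h : (ZGraph g).Adj u v
  · have heq : toCompletion (toZ g σ η o) 1 ''
        {q | ∃ h : (ZGraph g).Adj u v, ∃ s ∈ Icc (0 : ℝ) 1, q = edgeAt _ h s} =
        (fun s => toCompletion (toZ g σ η o) 1 (edgeAt (edgeLen g σ η) h s)) '' Icc 0 1 := by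
      ext p
      constructor
      · rintro ⟨q, ⟨h, s, hs', rfl⟩, rfl⟩
        exact ⟨s, hs', rfl⟩
      · rintro ⟨s, hs', rfl⟩
        exact ⟨_, ⟨h, s, hs', rfl⟩, rfl⟩
    rw [heq]
    refine isCompact_Icc.image_of_continuousOn ?_
    let e : ℝ → Deformed (toZ g σ η o) 1 := fun s => edgeAt (edgeLen g σ η) h s
    have h1 : LipschitzOnWith (edgeConst η * pv g σ η u).toNNReal e (Icc (0 : ℝ) 1) := by
      intro s hs' r hr
      have h2 := deformDist_edge_le_abs (σ := σ) hs ho h hs' hr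
      have h3 : 0 ≤ edgeConst η * pv g σ η u := mul_nonneg (edgeConst_pos hs).le (pv_pos hs u).le
      rw [ENNReal.ofReal_mul h3, ← Real.dist_eq, ← edist_dist] at h2
      exact h2
    exact (UniformSpace.Completion.continuous_coe (Deformed (toZ g σ η o) 1)).comp_continuousOn
      h1.continuousOn
  · have : {q : Z g σ η | ∃ h : (ZGraph g).Adj u v, ∃ s ∈ Icc (0 : ℝ) 1, q = edgeAt _ h s} = ∅ := by
      ext q; simp [h]
    rw [this, image_empty]
    exact isCompact_empty

/-- A sequence of points whose limit in the completion is not a point of `Z` leaves the stars of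
all vertices of bounded level. -/
lemma tendsto_level_of_tendsto (hs : IsSmall α η) (ho : IsRoot o)
    {p : UniformSpace.Completion (Deformed (toZ g σ η o) 1)}
    (hp : p ∉ range (toCompletion (toZ g σ η o) 1)) {s : ℕ → Z g σ η} {u : ℕ → F.Vertex}
    (hs' : Tendsto (fun j => toCompletion (toZ g σ η o) 1 (s j)) atTop (𝓝 p))
    (hu : ∀ j, s j ∈ star g σ η (u j)) : Tendsto (fun j => (u j).1) atTop atTop := by
  refine Filter.tendsto_atTop.2 fun n => ?_
  have hK : IsCompact (⋃ v ∈ {v : F.Vertex | v.1 ≤ n},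
      toCompletion (toZ g σ η o) 1 '' star g σ η v) :=
    (finite_level_le F n).isCompact_biUnion fun v _ => isCompact_image_star hs ho v
  have hpK : p ∉ ⋃ v ∈ {v : F.Vertex | v.1 ≤ n},
      toCompletion (toZ g σ η o) 1 '' star g σ η v := by
    intro h
    obtain ⟨v, -, q, -, rfl⟩ := mem_iUnion₂.1 h
    exact hp ⟨q, rfl⟩
  filter_upwards [hs'.eventually (hK.isClosed.isOpen_compl.mem_nhds hpK)] with j hj
  by_contra hlt
  exact hj (mem_iUnion₂.2 ⟨u j, (not_le.1 hlt).le, mem_image_of_mem _ (hu j)⟩)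

/-! ### The boundary of the deformed space -/

lemma deformDist_le_of_eventually_near (hs : IsSmall α η) (ho : IsRoot o) {u : ℕ → F.Vertex}
    {x : X} (hu : TendsToPoint u x) {a : F.Vertex} (hx : dist x a.2.1 < 29 / 10 * α ^ a.1) :
    ∀ᶠ j in atTop, deformDist (toZ g σ η o) 1 (toZ g σ η (u j)) (toZ g σ η a) ≤
      ENNReal.ofReal (upConst η * pv g σ η a) := by
  filter_upwards [hu.eventually a.1 hx] with j hj
  exact deformDist_le_of_near hs ho hj.1 hj.2

lemma tendsto_pow_one_sub (hs : IsSmall α η) (c : ℝ) :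
    Tendsto (fun n : ℕ => ENNReal.ofReal (c * (1 - η) ^ n)) atTop (𝓝 0) := by
  rw [← ENNReal.ofReal_zero]
  refine ENNReal.tendsto_ofReal ?_
  have := (tendsto_pow_atTop_nhds_zero_of_lt_one (r := 1 - η) (by linarith [hs.η_le])
    (by linarith [hs.η_pos])).const_mul c
  rwa [mul_zero] at this

/-- All sequences of vertices converging to `x` are close to each other in the deformed metric. -/
lemma exists_deformDist_lt (hs : IsSmall α η) (ho : IsRoot o) {u v : ℕ → F.Vertex}
    {x : X} (hu : TendsToPoint u x) (hv : TendsToPoint v x) {r : ℝ≥0∞} (hr : 0 < r) :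
    ∃ N, ∀ j ≥ N, ∀ k ≥ N,
      deformDist (toZ g σ η o) 1 (toZ g σ η (u j)) (toZ g σ η (v k)) < r := by
  have h2 := (tendsto_pow_one_sub (α := α) hs (upConst η)).add
    (tendsto_pow_one_sub (α := α) hs (upConst η))
  rw [add_zero] at h2
  obtain ⟨n, hn⟩ := (h2.eventually (gt_mem_nhds hr)).exists
  have hx := dist_nearVertex_lt (F := F) hs x n
  obtain ⟨N, hN⟩ := exists_forall_ge_and
    (deformDist_le_of_eventually_near (g := g) (σ := σ) hs ho hu hx)
    (deformDist_le_of_eventually_near (g := g) (σ := σ) hs ho hv hx)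
  refine ⟨N, fun j hj k hk => lt_of_le_of_lt ?_ hn⟩
  have h3 : pv g σ η (nearVertex F x n) ≤ (1 - η) ^ n := piLevel_le_pow g σ hs n _
  have h4 : ENNReal.ofReal (upConst η * pv g σ η (nearVertex F x n)) ≤
      ENNReal.ofReal (upConst η * (1 - η) ^ n) :=
    ENNReal.ofReal_le_ofReal (mul_le_mul_of_nonneg_left h3 (upConst_pos hs).le)
  refine (deformDist_triangle _ _ _ (toZ g σ η (nearVertex F x n)) _).trans (add_le_add ?_ ?_)
  · exact (hN j hj).1.trans h4
  · exact (deformDist_comm_le _ _ _ _).trans ((hN k hk).2.trans h4)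

lemma exists_limit (hs : IsSmall α η) (ho : IsRoot o) (x : X) :
    ∃ p, ∀ u : ℕ → F.Vertex, TendsToPoint u x →
      Tendsto (fun j => toCompletion (toZ g σ η o) 1 (toZ g σ η (u j))) atTop (𝓝 p) := by
  have h0 := tendsToPoint_nearVertex (F := F) hs x
  obtain ⟨p, hp⟩ := exists_tendsto_toCompletion (o := toZ g σ η o) (ε := 1)
    (s := fun j => toZ g σ η (nearVertex F x j)) fun r hr => exists_deformDist_lt hs ho h0 h0 hr
  refine ⟨p, fun u hu => tendsto_toCompletion_of_deformDist hp ?_⟩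
  refine ENNReal.tendsto_nhds_zero.2 fun r hr => ?_
  obtain ⟨N, hN⟩ := exists_deformDist_lt (g := g) (σ := σ) hs ho h0 hu hr
  filter_upwards [eventually_ge_atTop N] with j hj
  exact (hN j hj j hj).le

/-- The lower bound for `d₁` at a fixed scale keeps the limit away from every point of `Z`. -/
lemma limit_notMem_range (hs : IsSmall α η) (hσ : Admissible σ) (ho : IsRoot o) {x : X}
    {u : ℕ → F.Vertex} (hu : TendsToPoint u x)
    {p : UniformSpace.Completion (Deformed (toZ g σ η o) 1)}
    (hp : Tendsto (fun j => toCompletion (toZ g σ η o) 1 (toZ g σ η (u j))) atTop (𝓝 p)) :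
    p ∉ range (toCompletion (toZ g σ η o) 1) := by
  rintro ⟨z, rfl⟩
  have h1 := tendsto_deformDist_of_toCompletion (deformDist_ne_top hs ho) hp
  obtain ⟨v, hv⟩ := exists_mem_star z
  have h2 : ∀ w : F.Vertex, v.1 + 1 < w.1 → (∃ v, z = toZ g σ η v ∧ IsFar v w) ∨
      ∃ (v v' : F.Vertex) (h : (ZGraph g).Adj v v') (s : ℝ),
      s ∈ Icc (0 : ℝ) 1 ∧ z = edgeAt _ h s ∧ IsFar v w ∧ IsFar v' w := by
    intro w hw
    rcases hv with h | ⟨v', h, s, hs', hz⟩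
    · exact Or.inl ⟨v, h, Or.inl (by omega)⟩
    · exact Or.inr ⟨v, v', h, s, hs', hz, Or.inl (by omega),
        Or.inl ((level_le_of_adj h).trans_lt hw)⟩
  have hη := hs.η_pos
  have hpos : 0 < ENNReal.ofReal (η ^ (v.1 + 2)) / ENNReal.ofReal (lowConst η) :=
    ENNReal.div_pos (by simpa using pow_pos hη _) ENNReal.ofReal_ne_top
  obtain ⟨j, hj1, hj2⟩ := ((h1.eventually (gt_mem_nhds hpos)).and
    (hu.level.eventually_ge_atTop (v.1 + 2))).exists
  have hfst := anc_fst (g := g) hj2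
  have h3 := pv_le_deformDist (g := g) hs hσ ho (u := u j) (w := anc g (v.1 + 2) (u j))
    (by rw [hfst]; exact hj2) (by rw [hfst]) (h2 _ (by rw [hfst]; omega))
  have h4 : η ^ (v.1 + 2) ≤ pv g σ η (anc g (v.1 + 2) (u j)) := by
    have := pow_le_piLevel g σ hs (anc g (v.1 + 2) (u j)).1 (anc g (v.1 + 2) (u j)).2
    have h5 : η ^ (anc g (v.1 + 2) (u j)).1 = η ^ (v.1 + 2) := by rw [hfst]
    rwa [h5] at this
  have h6 := (ENNReal.ofReal_le_ofReal h4).trans h3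
  have hL := lowConst_pos hs
  rw [mul_comm, ← ENNReal.div_le_iff (by simpa using hL) ENNReal.ofReal_ne_top] at h6
  exact absurd hj1 (not_lt.2 h6)

variable (g) in
/-- The point of `∂₁ Z` that corresponds to a point of `X`. -/
def toDeformBoundary (hs : IsSmall α η) (hσ : Admissible σ) (ho : IsRoot o) (x : X) :
    DeformBoundary (toZ g σ η o) 1 :=
  ⟨(exists_limit hs ho x).choose, limit_notMem_range hs hσ ho (tendsToPoint_nearVertex hs x)
    ((exists_limit hs ho x).choose_spec _ (tendsToPoint_nearVertex hs x))⟩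

lemma TendsToPoint.tendsto (hs : IsSmall α η) (hσ : Admissible σ) (ho : IsRoot o)
    {u : ℕ → F.Vertex} {x : X} (hu : TendsToPoint u x) :
    Tendsto (fun j => toCompletion (toZ g σ η o) 1 (toZ g σ η (u j))) atTop
      (𝓝 (toDeformBoundary g hs hσ ho x).1) :=
  (exists_limit hs ho x).choose_spec u hu

/-- The distance `d₁` of the boundary points that correspond to two points of `X`, with values in
`[0, ∞]`. -/
def edistOne (hs : IsSmall α η) (hσ : Admissible σ) (ho : IsRoot o) (g : F.Parents) (x y : X) :
    ℝ≥0∞ :=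
  completionEDist (deformDist_ne_top hs ho) (toDeformBoundary g hs hσ ho x).1
    (toDeformBoundary g hs hσ ho y).1

lemma edistOne_le (hs : IsSmall α η) (hσ : Admissible σ) (ho : IsRoot o) {x y : X} {a : F.Vertex}
    (hx : dist x a.2.1 < 29 / 10 * α ^ a.1) (hy : dist y a.2.1 < 29 / 10 * α ^ a.1) :
    edistOne hs hσ ho g x y ≤ ENNReal.ofReal (2 * upConst η * pv g σ η a) := by
  have hX := tendsToPoint_nearVertex (F := F) hs x
  have hY := tendsToPoint_nearVertex (F := F) hs y
  refine le_of_tendsto (tendsto_completionEDist (deformDist_ne_top hs ho)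
    (hX.tendsto hs hσ ho) (hY.tendsto hs hσ ho)) ?_
  filter_upwards [deformDist_le_of_eventually_near (g := g) (σ := σ) hs ho hX hx,
    deformDist_le_of_eventually_near (g := g) (σ := σ) hs ho hY hy] with j h1 h2
  have h3 : 0 ≤ upConst η * pv g σ η a := mul_nonneg (upConst_pos hs).le (pv_pos hs a).le
  refine (deformDist_triangle _ _ _ (toZ g σ η a) _).trans ((add_le_add h1
    ((deformDist_comm_le _ _ _ _).trans h2)).trans ?_)
  rw [← ENNReal.ofReal_add h3 h3]
  exact ENNReal.ofReal_le_ofReal (le_of_eq (by ring))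

lemma le_edistOne (hs : IsSmall α η) (hσ : Admissible σ) (ho : IsRoot o) {x y : X} {a : F.Vertex}
    (hx : dist x a.2.1 < α ^ a.1) (hxy : α ^ (a.1 + 1) < dist x y) :
    ENNReal.ofReal (pv g σ η a) ≤ ENNReal.ofReal (farConst η) * edistOne hs hσ ho g x y := by
  have hX := tendsToPoint_nearVertex (F := F) hs x
  have hY := tendsToPoint_nearVertex (F := F) hs y
  obtain ⟨N, hN⟩ := exists_le_deformDist (g := g) hs hσ ho hX hY hx hxy
  refine ge_of_tendsto (ENNReal.Tendsto.const_mul (tendsto_completionEDist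
    (deformDist_ne_top hs ho) (hX.tendsto hs hσ ho) (hY.tendsto hs hσ ho))
    (Or.inr ENNReal.ofReal_ne_top)) ?_
  filter_upwards [eventually_ge_atTop N] with j hj
  exact hN j hj j hj

lemma toDeformBoundary_injective (hs : IsSmall α η) (hσ : Admissible σ) (ho : IsRoot o) :
    Function.Injective (toDeformBoundary g hs hσ ho) := by
  intro x y h
  by_contra hxy
  obtain ⟨n, hn⟩ := exists_pow_lt_dist hs hxy
  have h1 := le_edistOne (g := g) hs hσ ho (a := nearVertex F x n) (dist_nearVertex x n) hn
  have h2 : edistOne hs hσ ho g x y = 0 := by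
    let := completionMetricSpace (deformDist_ne_top (g := g) (σ := σ) hs ho)
    rw [edistOne, h]
    exact edist_self _
  rw [h2, mul_zero, nonpos_iff_eq_zero, ENNReal.ofReal_eq_zero] at h1
  exact absurd (pv_pos hs _) (not_lt.2 h1)

/-- Surjectivity: the stars of a sequence of points converging to `∂₁ Z` shrink, and the positions
of their centers have a convergent subsequence. -/
lemma toDeformBoundary_surjective [CompactSpace X] (hs : IsSmall α η) (hσ : Admissible σ)
    (ho : IsRoot o) : Function.Surjective (toDeformBoundary g hs hσ ho) := by
  rintro ⟨p, hp⟩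
  obtain ⟨s, hs'⟩ := exists_seq_tendsto_completion (deformDist_ne_top (g := g) (σ := σ) hs ho) p
  choose u hu using fun j => exists_mem_star (s j)
  have hlevel := tendsto_level_of_tendsto hs ho hp hs' hu
  obtain ⟨x, -, φ, hφ, hx⟩ := isCompact_univ.tendsto_subseq (x := fun j => (u j).2.1)
    (fun _ => mem_univ _)
  have h1 : TendsToPoint (u ∘ φ) x := ⟨hlevel.comp hφ.tendsto_atTop, hx⟩
  refine ⟨x, Subtype.ext (tendsto_nhds_unique (h1.tendsto hs hσ ho) ?_)⟩
  refine tendsto_toCompletion_of_deformDist (hs'.comp hφ.tendsto_atTop) ?_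
  have h2 := (tendsto_pow_one_sub (α := α) hs (edgeConst η)).comp h1.level
  refine tendsto_of_tendsto_of_tendsto_of_le_of_le tendsto_const_nhds h2 (fun _ => bot_le)
    fun j => ?_
  refine (deformDist_comm_le _ _ _ _).trans ((deformDist_star_le hs ho (hu (φ j))).trans ?_)
  exact ENNReal.ofReal_le_ofReal (mul_le_mul_of_nonneg_left (piLevel_le_pow g σ hs _ _)
    (edgeConst_pos hs).le)

end Filling

/-! ### Coverings and Hausdorff dimension -/

/-- If there are finite coverings with mesh tending to zero and with `p`-th power sums of the
diameters tending to zero, then the Hausdorff dimension is at most `p`. -/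
lemma dimH_univ_le_of_cover {Y : Type u} [MetricSpace Y] {J : ℕ → Type v} [∀ n, Fintype (J n)]
    {p : ℝ} (hp : 0 ≤ p) (t : ∀ n, J n → Set Y) {r : ℕ → ℝ≥0∞} (hr : Tendsto r atTop (𝓝 0))
    (ht : ∀ n i, ediam (t n i) ≤ r n) (hcov : ∀ n, ⋃ i, t n i = univ)
    (hsum : Tendsto (fun n => ∑ i, ediam (t n i) ^ p) atTop (𝓝 0)) :
    dimH (univ : Set Y) ≤ ENNReal.ofReal p := by
  borelize Y
  have h1 := Measure.hausdorffMeasure_le_liminf_sum p (univ : Set Y) r hr t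
    (Eventually.of_forall ht) (Eventually.of_forall fun n => (hcov n).ge)
  rw [hsum.liminf_eq] at h1
  refine dimH_le_of_hausdorffMeasure_ne_top (d := p.toNNReal) ?_
  rw [Real.coe_toNNReal p hp]
  exact ne_top_of_le_ne_top ENNReal.zero_ne_top h1

/-! ### Power gauges -/

/-- The increasing homeomorphism `t ↦ A (t ^ p + t ^ q)` of `[0, ∞)`. -/
lemma exists_orderIso_rpow_add {A : ℝ≥0} {p q : ℝ} (hA : 0 < A) (hp : 0 < p) (hq : 0 < q) :
    ∃ θ : ℝ≥0 ≃o ℝ≥0, ∀ t, θ t = A * (t ^ p + t ^ q) := by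
  have hmono : StrictMono fun t : ℝ≥0 => A * (t ^ p + t ^ q) := fun s t hst =>
    mul_lt_mul_of_pos_left (add_lt_add (NNReal.rpow_lt_rpow hst hp) (NNReal.rpow_lt_rpow hst hq)) hA
  have hcont : Continuous fun t : ℝ≥0 => A * (t ^ p + t ^ q) :=
    continuous_const.mul ((NNReal.continuous_rpow_const hp.le).add
      (NNReal.continuous_rpow_const hq.le))
  refine ⟨StrictMono.orderIsoOfSurjective _ hmono fun c =>
    mem_range_of_exists_le_of_exists_ge hcont ⟨0, ?_⟩ ⟨(c / A) ^ p⁻¹, ?_⟩, fun t => rfl⟩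
  · simp [NNReal.zero_rpow hp.ne', NNReal.zero_rpow hq.ne']
  · rw [NNReal.rpow_inv_rpow hp.ne', mul_add, mul_div_cancel₀ _ hA.ne']
    exact le_self_add

namespace Filling

variable {X : Type u} [MetricSpace X] {α η : ℝ} {F : Filling X α} {g : F.Parents} {σ : F.Weight}
  {o : F.Vertex}

/-! ### The metric `d₁` on `X` -/

/-- The distance `d₁` of two points of `X`. (All distances are finite, see `edistOne_eq`.) -/
def distOne (hs : IsSmall α η) (hσ : Admissible σ) (ho : IsRoot o) (g : F.Parents) (x y : X) : ℝ :=
  (edistOne hs hσ ho g x y).toReal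

lemma dist_toDeformBoundary (hs : IsSmall α η) (hσ : Admissible σ) (ho : IsRoot o) (x y : X) :
    (boundaryMetricSpace (deformDist_ne_top hs ho)).toDist.dist
      (toDeformBoundary g hs hσ ho x) (toDeformBoundary g hs hσ ho y) = distOne hs hσ ho g x y := by
  let := boundaryMetricSpace (deformDist_ne_top (g := g) (σ := σ) hs ho)
  exact dist_edist _ _

lemma edistOne_eq (hs : IsSmall α η) (hσ : Admissible σ) (ho : IsRoot o) (x y : X) :
    edistOne hs hσ ho g x y = ENNReal.ofReal (distOne hs hσ ho g x y) := by
  let := boundaryMetricSpace (deformDist_ne_top (g := g) (σ := σ) hs ho)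
  exact (ENNReal.ofReal_toReal (_root_.edist_ne_top (toDeformBoundary g hs hσ ho x) _)).symm

lemma distOne_nonneg (hs : IsSmall α η) (hσ : Admissible σ) (ho : IsRoot o) (x y : X) :
    0 ≤ distOne hs hσ ho g x y := ENNReal.toReal_nonneg

lemma distOne_self (hs : IsSmall α η) (hσ : Admissible σ) (ho : IsRoot o) (x : X) :
    distOne hs hσ ho g x x = 0 := by
  let := boundaryMetricSpace (deformDist_ne_top (g := g) (σ := σ) hs ho)
  rw [← dist_toDeformBoundary]
  exact dist_self _

lemma distOne_comm (hs : IsSmall α η) (hσ : Admissible σ) (ho : IsRoot o) (x y : X) :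
    distOne hs hσ ho g x y = distOne hs hσ ho g y x := by
  let := boundaryMetricSpace (deformDist_ne_top (g := g) (σ := σ) hs ho)
  rw [← dist_toDeformBoundary, ← dist_toDeformBoundary]
  exact dist_comm _ _

lemma distOne_le (hs : IsSmall α η) (hσ : Admissible σ) (ho : IsRoot o) {x y : X} {a : F.Vertex}
    (hx : dist x a.2.1 < 29 / 10 * α ^ a.1) (hy : dist y a.2.1 < 29 / 10 * α ^ a.1) :
    distOne hs hσ ho g x y ≤ 2 * upConst η * pv g σ η a :=
  ENNReal.toReal_le_of_le_ofReal (mul_nonneg (mul_nonneg zero_le_two (upConst_pos hs).le)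
    (pv_pos hs a).le) (edistOne_le hs hσ ho hx hy)

lemma le_distOne (hs : IsSmall α η) (hσ : Admissible σ) (ho : IsRoot o) {x y : X} {a : F.Vertex}
    (hx : dist x a.2.1 < α ^ a.1) (hxy : α ^ (a.1 + 1) < dist x y) :
    pv g σ η a ≤ farConst η * distOne hs hσ ho g x y := by
  have h := le_edistOne (g := g) hs hσ ho hx hxy
  rw [edistOne_eq, ← ENNReal.ofReal_mul (farConst_pos hs).le] at h
  exact (ENNReal.ofReal_le_ofReal_iff
    (mul_nonneg (farConst_pos hs).le (distOne_nonneg hs hσ ho x y))).1 h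

lemma exists_scale [CompactSpace X] (hs : IsSmall α η) (hd : diam (univ : Set X) < 1) {x y : X}
    (hxy : x ≠ y) : ∃ n : ℕ, α ^ (n + 1) < dist x y ∧ dist x y ≤ α ^ n :=
  exists_nat_pow_near_of_lt_one (dist_pos.2 hxy)
    ((dist_le_diam_of_mem isCompact_univ.isBounded (mem_univ x) (mem_univ y)).trans hd.le)
    hs.α_pos (by linarith [hs.α_le])

lemma dist_nearVertex_lt_of_dist_le (hs : IsSmall α η) {x y : X} {n : ℕ} (h : dist x y ≤ α ^ n) :
    dist y (nearVertex F x n).2.1 < 29 / 10 * α ^ (nearVertex F x n).1 := by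
  have h1 : dist y (nearVertex F x n).2.1 < 29 / 10 * α ^ n := by
    linarith [dist_triangle_left y (nearVertex F x n).2.1 x, dist_nearVertex (F := F) x n,
      hs.pow_pos n]
  exact h1

/-! ### Visuality -/

/-- The constant in the comparison of `d₁` with the Gromov product, and in the estimate of the
diameters of balls; a sum, so that it dominates each of the constants that occur. -/
def visualConst (η : ℝ) : ℝ :=
  1 + 2 * upConst η + 2 * upConst η * farConst η +
    farConst η * Real.exp (3 * logInv η + 2 * hypConst η)

lemma one_le_visualConst (hs : IsSmall α η) : 1 ≤ visualConst η := by
  have := upConst_pos hs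
  have := farConst_pos hs
  unfold visualConst
  have : 0 ≤ 2 * upConst η + 2 * upConst η * farConst η +
    farConst η * Real.exp (3 * logInv η + 2 * hypConst η) := by positivity
  linarith

lemma upConst_le_visualConst (hs : IsSmall α η) : 2 * upConst η ≤ visualConst η := by
  have := upConst_pos hs
  have := farConst_pos hs
  unfold visualConst
  have : 0 ≤ 2 * upConst η * farConst η +
    farConst η * Real.exp (3 * logInv η + 2 * hypConst η) := by positivity
  linarith

lemma upConst_mul_le_visualConst (hs : IsSmall α η) : 2 * upConst η * farConst η ≤ visualConst η := by
  have := upConst_pos hs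
  have := farConst_pos hs
  unfold visualConst
  have : 0 ≤ farConst η * Real.exp (3 * logInv η + 2 * hypConst η) := by positivity
  linarith

lemma farConst_mul_le_visualConst (hs : IsSmall α η) :
    farConst η * Real.exp (3 * logInv η + 2 * hypConst η) ≤ visualConst η := by
  have := upConst_pos hs
  have := farConst_pos hs
  unfold visualConst
  have : 0 ≤ 2 * upConst η * farConst η := by positivity
  linarith

lemma exp_neg_coe (r : ℝ) : EReal.exp (-(r : EReal)) = ENNReal.ofReal (Real.exp (-r)) := by
  rw [← EReal.coe_neg, EReal.exp_coe]

lemma exp_neg_boundaryProd_le [CompactSpace X] (hs : IsSmall α η) (hσ : Admissible σ)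
    (ho : IsRoot o) (hd : diam (univ : Set X) < 1) {x y : X} (hxy : x ≠ y) :
    EReal.exp (-boundaryProd (toGromovBoundary g σ hs ho x) (toGromovBoundary g σ hs ho y)) ≤
      ENNReal.ofReal (visualConst η * distOne hs hσ ho g x y) := by
  obtain ⟨n, h1, h2⟩ := exists_scale hs hd hxy
  refine (EReal.exp_monotone (EReal.neg_le_neg_iff.2 (le_boundaryProd hs hσ ho
    (dist_nearVertex_lt hs x n) (dist_nearVertex_lt_of_dist_le hs h2)))).trans ?_
  rw [exp_neg_coe]
  refine ENNReal.ofReal_le_ofReal ?_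
  have h3 := le_distOne (g := g) hs hσ ho (a := nearVertex F x n) (dist_nearVertex x n) h1
  rw [← exp_neg_ht hs] at h3
  calc Real.exp (-(ht g σ η (nearVertex F x n) - 3 * logInv η - 2 * hypConst η))
      = Real.exp (3 * logInv η + 2 * hypConst η) * Real.exp (-ht g σ η (nearVertex F x n)) := by
        rw [← Real.exp_add]; congr 1; ring
    _ ≤ Real.exp (3 * logInv η + 2 * hypConst η) * (farConst η * distOne hs hσ ho g x y) :=
        mul_le_mul_of_nonneg_left h3 (Real.exp_pos _).le
    _ = farConst η * Real.exp (3 * logInv η + 2 * hypConst η) * distOne hs hσ ho g x y := by ring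
    _ ≤ _ := mul_le_mul_of_nonneg_right (farConst_mul_le_visualConst hs)
        (distOne_nonneg hs hσ ho x y)

lemma distOne_le_exp_neg_boundaryProd [CompactSpace X] (hs : IsSmall α η) (hσ : Admissible σ)
    (ho : IsRoot o) (hd : diam (univ : Set X) < 1) {x y : X} (hxy : x ≠ y) :
    ENNReal.ofReal (distOne hs hσ ho g x y) ≤ ENNReal.ofReal (visualConst η) *
      EReal.exp (-boundaryProd (toGromovBoundary g σ hs ho x) (toGromovBoundary g σ hs ho y)) := by
  obtain ⟨n, h1, h2⟩ := exists_scale hs hd hxy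
  have hU := upConst_pos hs
  have hL := farConst_pos hs
  have h3 := EReal.exp_monotone (EReal.neg_le_neg_iff.2 (boundaryProd_le (g := g) hs hσ ho
    (a := nearVertex F x n) (dist_nearVertex x n) h1))
  rw [exp_neg_coe] at h3
  refine le_trans ?_ (mul_le_mul_right h3 _)
  rw [← ENNReal.ofReal_mul (by linarith [one_le_visualConst hs])]
  refine ENNReal.ofReal_le_ofReal ?_
  have h4 := distOne_le (g := g) hs hσ ho (dist_nearVertex_lt hs x n)
    (dist_nearVertex_lt_of_dist_le hs h2)
  rw [← exp_neg_ht hs] at h4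
  have h5 : Real.exp (-ht g σ η (nearVertex F x n)) = farConst η *
      Real.exp (-(ht g σ η (nearVertex F x n) + Real.log (farConst η))) := by
    rw [neg_add, Real.exp_add, Real.exp_neg (Real.log _), Real.exp_log hL]
    field_simp
  rw [h5, ← mul_assoc] at h4
  exact h4.trans (mul_le_mul_of_nonneg_right (upConst_mul_le_visualConst hs) (Real.exp_pos _).le)

lemma isVisual [CompactSpace X] (hs : IsSmall α η) (hσ : Admissible σ) (ho : IsRoot o)
    (hd : diam (univ : Set X) < 1) {d : GromovBoundary (toZ g σ η o) →
      GromovBoundary (toZ g σ η o) → ℝ} (h : ∀ x y, d (toGromovBoundary g σ hs ho x)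
      (toGromovBoundary g σ hs ho y) = distOne hs hσ ho g x y) :
    IsVisual (toZ g σ η o) 1 (visualConst η) d := by
  have hC := zero_lt_one.trans_le (one_le_visualConst hs)
  refine ⟨(fourPoint hs hσ ho).isGromovHyperbolic (edist_ne_top hs ho)
    (hypConst_nonneg hs), fun a b => ?_,
    fun a b => ?_⟩
  all_goals
    obtain ⟨x, rfl⟩ := toGromovBoundary_surjective hs hσ ho a
    obtain ⟨y, rfl⟩ := toGromovBoundary_surjective hs hσ ho b
    rw [EReal.coe_one, one_mul, h]
    rcases eq_or_ne x y with rfl | hxy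
    · rw [distOne_self, boundaryProd_self hs hσ ho]
      simp
  · refine (mul_le_mul_right (exp_neg_boundaryProd_le hs hσ ho hd hxy) _).trans ?_
    rw [← ENNReal.ofReal_mul (inv_nonneg.2 hC.le), inv_mul_cancel_left₀ hC.ne']
  · exact distOne_le_exp_neg_boundaryProd hs hσ ho hd hxy

/-! ### Quasisymmetry -/

lemma dist_nearVertex_nearVertex_lt (hs : IsSmall α η) (z : X) {m n : ℕ} (h : m ≤ n) :
    dist (nearVertex F z n).2.1 (nearVertex F z m).2.1 < 29 / 10 * α ^ (nearVertex F z m).1 := by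
  have h1 : dist (nearVertex F z n).2.1 (nearVertex F z m).2.1 < 29 / 10 * α ^ m := by
    linarith [dist_triangle_left (nearVertex F z n).2.1 (nearVertex F z m).2.1 z,
      dist_nearVertex (F := F) z n, dist_nearVertex (F := F) z m, hs.pow_le_pow h, hs.pow_pos m]
  exact h1

/-- Towards higher levels `π` decreases at least geometrically near a point. -/
lemma pv_nearVertex_le (hs : IsSmall α η) (z : X) {m n : ℕ} (h : m ≤ n) :
    pv g σ η (nearVertex F z n) ≤ (1 - η) ^ (n - m) * η⁻¹ * pv g σ η (nearVertex F z m) := by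
  have hd := dist_anc_lt (g := g) hs (u := nearVertex F z n) (a := nearVertex F z m) h
    (dist_nearVertex_nearVertex_lt hs z h)
  have h1 := pv_of_near (g := g) (σ := σ) hs (anc_fst h) hd
  have h2 := pv_le_anc (g := g) (σ := σ) hs (u := nearVertex F z n) h
  rw [← le_inv_mul_iff₀ hs.η_pos] at h1
  rw [mul_assoc]
  exact h2.trans (mul_le_mul_of_nonneg_left h1 (pow_nonneg (by linarith [hs.η_le]) _))

/-- Towards higher levels `π` decreases at most geometrically near a point. -/
lemma mul_pv_nearVertex_le (hs : IsSmall α η) (z : X) {m n : ℕ} (h : m ≤ n) :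
    η ^ (n - m) * η * pv g σ η (nearVertex F z m) ≤ pv g σ η (nearVertex F z n) := by
  have hd := dist_anc_lt (g := g) hs (u := nearVertex F z n) (a := nearVertex F z m) h
    (dist_nearVertex_nearVertex_lt hs z h)
  have hfst : (anc g m (nearVertex F z n)).1 = m := anc_fst h
  have h1 := pv_of_near (g := g) (σ := σ) hs (u := nearVertex F z m)
    (v := anc g m (nearVertex F z n)) hfst.symm (by
      rw [dist_comm]; refine hd.trans_le (le_of_eq ?_); exact congrArg (fun k => 4 * α ^ k) hfst)
  refine le_trans ?_ (mul_anc_le_pv (g := g) (σ := σ) hs (u := nearVertex F z n) h)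
  rw [mul_assoc]
  exact mul_le_mul_of_nonneg_left h1 (pow_nonneg hs.η_pos.le _)

/-- The exponent `r` with `α ^ r = c`. -/
def gaugeExp (α c : ℝ) : ℝ := Real.log c / Real.log α

lemma gaugeExp_pos (hs : IsSmall α η) {c : ℝ} (hc : 0 < c) (hc' : c < 1) : 0 < gaugeExp α c :=
  div_pos_of_neg_of_neg (Real.log_neg hc hc') (Real.log_neg hs.α_pos (by linarith [hs.α_le]))

lemma rpow_gaugeExp (hs : IsSmall α η) {c : ℝ} (hc : 0 < c) : α ^ gaugeExp α c = c := by
  have hα : Real.log α < 0 := Real.log_neg hs.α_pos (by linarith [hs.α_le])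
  rw [Real.rpow_def_of_pos hs.α_pos, gaugeExp, mul_div_cancel₀ _ hα.ne, Real.exp_log hc]

lemma pow_rpow_gaugeExp (hs : IsSmall α η) {c : ℝ} (hc : 0 < c) (k : ℕ) :
    (α ^ k) ^ gaugeExp α c = c ^ k := by
  rw [← Real.rpow_natCast, ← Real.rpow_mul hs.α_pos.le, mul_comm, Real.rpow_mul hs.α_pos.le,
    rpow_gaugeExp hs hc, Real.rpow_natCast]

/-- The ratio of the values of `π` at two scales is controlled by powers of the ratio `t` of the
scales: the first power is needed for small `t`, the second one for large `t`. -/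
lemma pv_nearVertex_ratio_le (hs : IsSmall α η) (z : X) {m n : ℕ} {t : ℝ} (ht : 0 < t)
    (h : α ^ (n + 1) ≤ t * α ^ m) :
    pv g σ η (nearVertex F z n) ≤ η⁻¹ ^ 2 * (t ^ gaugeExp α (1 - η) + t ^ gaugeExp α η) *
      pv g σ η (nearVertex F z m) := by
  have hη := hs.η_pos
  have h1η : 0 < 1 - η := by linarith [hs.η_le]
  have hp := gaugeExp_pos hs h1η (by linarith)
  have hq := gaugeExp_pos hs hη (by linarith [hs.η_le])
  have htp := Real.rpow_pos_of_pos ht (gaugeExp α (1 - η))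
  have htq := Real.rpow_pos_of_pos ht (gaugeExp α η)
  have hpv := pv_pos (g := g) (σ := σ) hs (nearVertex F z m)
  rcases le_total m n with hmn | hmn
  · refine (pv_nearVertex_le hs z hmn).trans (mul_le_mul_of_nonneg_right ?_ hpv.le)
    obtain ⟨k, rfl⟩ := Nat.exists_eq_add_of_le hmn
    rw [Nat.add_sub_cancel_left]
    have h1 : α ^ (k + 1) ≤ t := by
      rw [show m + k + 1 = (k + 1) + m by ring, pow_add] at h
      exact le_of_mul_le_mul_right h (hs.pow_pos m)
    have h2 := Real.rpow_le_rpow (hs.pow_pos _).le h1 hp.le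
    rw [pow_rpow_gaugeExp hs h1η] at h2
    have h3 : η * (1 - η) ^ k ≤ t ^ gaugeExp α (1 - η) := by
      refine le_trans ?_ h2
      rw [pow_succ']
      exact mul_le_mul_of_nonneg_right (by linarith [hs.η_le]) (pow_nonneg h1η.le _)
    rw [← le_inv_mul_iff₀ hη] at h3
    calc (1 - η) ^ k * η⁻¹ ≤ η⁻¹ * t ^ gaugeExp α (1 - η) * η⁻¹ :=
          mul_le_mul_of_nonneg_right h3 (inv_nonneg.2 hη.le)
      _ = η⁻¹ ^ 2 * t ^ gaugeExp α (1 - η) := by ring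
      _ ≤ _ := mul_le_mul_of_nonneg_left (by linarith) (by positivity)
  · have h0 := mul_pv_nearVertex_le (g := g) (σ := σ) hs z hmn
    obtain ⟨k, rfl⟩ := Nat.exists_eq_add_of_le hmn
    rw [Nat.add_sub_cancel_left] at h0
    have h1 : α ≤ t * α ^ k := by
      rw [pow_succ', pow_add, mul_comm (α ^ n), ← mul_assoc] at h
      exact le_of_mul_le_mul_right h (hs.pow_pos n)
    have h2 := Real.rpow_le_rpow hs.α_pos.le h1 hq.le
    rw [Real.mul_rpow ht.le (hs.pow_pos k).le, pow_rpow_gaugeExp hs hη, rpow_gaugeExp hs hη] at h2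
    have hn := pv_pos (g := g) (σ := σ) hs (nearVertex F z n)
    calc pv g σ η (nearVertex F z n)
        = η⁻¹ ^ 2 * (η * (η * pv g σ η (nearVertex F z n))) := by field_simp
      _ ≤ η⁻¹ ^ 2 * (t ^ gaugeExp α η * η ^ k * (η * pv g σ η (nearVertex F z n))) := by gcongr
      _ = η⁻¹ ^ 2 * t ^ gaugeExp α η * (η ^ k * η * pv g σ η (nearVertex F z n)) := by ring
      _ ≤ η⁻¹ ^ 2 * t ^ gaugeExp α η * pv g σ η (nearVertex F z (n + k)) := by gcongr
      _ ≤ η⁻¹ ^ 2 * (t ^ gaugeExp α (1 - η) + t ^ gaugeExp α η) *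
          pv g σ η (nearVertex F z (n + k)) := by gcongr; linarith

/-- The distortion inequality: both distances are comparable with `π` at vertices near `z`. -/
lemma distOne_ratio_le [CompactSpace X] (hs : IsSmall α η) (hσ : Admissible σ) (ho : IsRoot o)
    (hd : diam (univ : Set X) < 1) {x y z : X} (hxz : x ≠ z) (hyz : y ≠ z) :
    distOne hs hσ ho g x z ≤ 2 * upConst η * farConst η * η⁻¹ ^ 2 *
      ((dist x z / dist y z) ^ gaugeExp α (1 - η) + (dist x z / dist y z) ^ gaugeExp α η) *
      distOne hs hσ ho g y z := by
  obtain ⟨n, h1, h2⟩ := exists_scale hs hd hxz.symm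
  obtain ⟨m, h3, h4⟩ := exists_scale hs hd hyz.symm
  have hU := upConst_pos hs
  have h5 := distOne_le (g := g) hs hσ ho (dist_nearVertex_lt hs z n)
    (dist_nearVertex_lt_of_dist_le hs h2)
  have h6 := le_distOne (g := g) hs hσ ho (a := nearVertex F z m) (dist_nearVertex z m) h3
  rw [distOne_comm] at h5 h6
  rw [dist_comm] at h1 h2 h3 h4
  have hx := dist_pos.2 hxz
  have hy := dist_pos.2 hyz
  have ht : 0 < dist x z / dist y z := div_pos hx hy
  have h7 : α ^ (n + 1) ≤ dist x z / dist y z * α ^ m := by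
    rw [div_mul_eq_mul_div, le_div_iff₀ hy]
    exact mul_le_mul h1.le h4 hy.le hx.le
  have h8 := pv_nearVertex_ratio_le (g := g) (σ := σ) hs z ht h7
  have h9 := Real.rpow_pos_of_pos ht (gaugeExp α (1 - η))
  have h10 := Real.rpow_pos_of_pos ht (gaugeExp α η)
  have hη := hs.η_pos
  calc distOne hs hσ ho g x z ≤ 2 * upConst η * pv g σ η (nearVertex F z n) := h5
    _ ≤ 2 * upConst η * (η⁻¹ ^ 2 * ((dist x z / dist y z) ^ gaugeExp α (1 - η) +
        (dist x z / dist y z) ^ gaugeExp α η) * (farConst η * distOne hs hσ ho g y z)) := by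
      gcongr
      exact h8.trans (mul_le_mul_of_nonneg_left h6 (by positivity))
    _ = _ := by ring

/-- A continuous bijection of a compact space onto a Hausdorff space is a homeomorphism. -/
lemma isHomeomorph_toDeformBoundary [CompactSpace X] (hs : IsSmall α η) (hσ : Admissible σ)
    (ho : IsRoot o) :
    letI := boundaryMetricSpace (deformDist_ne_top (g := g) (σ := σ) hs ho)
    IsHomeomorph (toDeformBoundary g hs hσ ho) := by
  let := boundaryMetricSpace (deformDist_ne_top (g := g) (σ := σ) hs ho)
  refine isHomeomorph_iff_continuous_bijective.2 ⟨Metric.continuous_iff.2 fun x r hr => ?_,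
    toDeformBoundary_injective hs hσ ho, toDeformBoundary_surjective hs hσ ho⟩
  have h1 := (tendsto_pow_atTop_nhds_zero_of_lt_one (r := 1 - η) (by linarith [hs.η_le])
    (by linarith [hs.η_pos])).const_mul (2 * upConst η)
  rw [mul_zero] at h1
  obtain ⟨n, hn⟩ := (h1.eventually (gt_mem_nhds hr)).exists
  refine ⟨α ^ n, hs.pow_pos n, fun y hy => lt_of_le_of_lt ?_ hn⟩
  refine (dist_toDeformBoundary hs hσ ho y x).trans_le ?_
  rw [dist_comm] at hy
  refine (distOne_le (g := g) hs hσ ho (dist_nearVertex_lt_of_dist_le hs hy.le)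
    (dist_nearVertex_lt hs x n)).trans ?_
  exact mul_le_mul_of_nonneg_left (piLevel_le_pow g σ hs _ _) (by linarith [upConst_pos hs])

lemma isQuasisymmetric_toDeformBoundary [CompactSpace X] (hs : IsSmall α η) (hσ : Admissible σ)
    (ho : IsRoot o) (hd : diam (univ : Set X) < 1) :
    IsQuasisymmetric ‹MetricSpace X› (boundaryMetricSpace (deformDist_ne_top (g := g) (σ := σ) hs ho))
      (toDeformBoundary g hs hσ ho) := by
  refine ⟨isHomeomorph_toDeformBoundary hs hσ ho, ?_⟩
  have hη := hs.η_pos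
  have hA : 0 < 2 * upConst η * farConst η * η⁻¹ ^ 2 := by
    have := upConst_pos hs
    have := farConst_pos hs
    positivity
  obtain ⟨θ, hθ⟩ := exists_orderIso_rpow_add (Real.toNNReal_pos.2 hA)
    (gaugeExp_pos hs (c := 1 - η) (by linarith [hs.η_le]) (by linarith))
    (gaugeExp_pos hs (c := η) hη (by linarith [hs.η_le]))
  refine ⟨θ, fun x y z _ hyz hxz => ?_⟩
  let := boundaryMetricSpace (deformDist_ne_top (g := g) (σ := σ) hs ho)
  have hne : 0 < dist (toDeformBoundary g hs hσ ho y) (toDeformBoundary g hs hσ ho z) :=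
    dist_pos.2 ((toDeformBoundary_injective hs hσ ho).ne hyz)
  rw [hθ, ← NNReal.coe_le_coe]
  push_cast
  rw [Real.coe_toNNReal _ hA.le, div_le_iff₀ hne]
  refine (dist_toDeformBoundary hs hσ ho x z).trans_le ((distOne_ratio_le hs hσ ho hd hxz
    hyz).trans (le_of_eq ?_))
  rw [← dist_toDeformBoundary hs hσ ho y z]

/-! ### Diameters of balls and dimension -/

lemma ediam_image_ball_le (hs : IsSmall α η) (hσ : Admissible σ) (ho : IsRoot o) (n : ℕ)
    (u : F.V n) :
    letI := boundaryMetricSpace (deformDist_ne_top (g := g) (σ := σ) hs ho)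
    ediam (toDeformBoundary g hs hσ ho '' ball u.1 (α ^ n)) ≤
      ENNReal.ofReal (visualConst η * piLevel g σ η n u) := by
  let := boundaryMetricSpace (deformDist_ne_top (g := g) (σ := σ) hs ho)
  refine ediam_le ?_
  rintro _ ⟨x, hx, rfl⟩ _ ⟨y, hy, rfl⟩
  have hlt : α ^ n ≤ 29 / 10 * α ^ n := by linarith [hs.pow_pos n]
  refine (edistOne_le (g := g) hs hσ ho (a := ⟨n, u⟩) (lt_of_lt_of_le hx hlt)
    (lt_of_lt_of_le hy hlt)).trans (ENNReal.ofReal_le_ofReal ?_)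
  exact mul_le_mul_of_nonneg_right (upConst_le_visualConst hs) (pv_pos hs ⟨n, u⟩).le

/-- For `p ≤ 0` the sums of `π ^ p` over the levels do not tend to zero. -/
lemma pos_of_tendsto_sum (hs : IsSmall α η) [Nonempty X] {p : ℝ}
    (hp : Tendsto (fun n => ∑ u : F.V n, piLevel g σ η n u ^ p) atTop (𝓝 0)) : 0 < p := by
  by_contra hp0
  obtain ⟨n, hn⟩ := (hp.eventually (gt_mem_nhds zero_lt_one)).exists
  let u : F.V n := (nearVertex F (Classical.arbitrary X) n).2
  have h1 : 1 ≤ piLevel g σ η n u ^ p :=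
    Real.one_le_rpow_of_pos_of_le_one_of_nonpos (piLevel_pos g σ hs n u)
      (pv_le_one hs ⟨n, u⟩) (not_lt.1 hp0)
  have h2 := Finset.single_le_sum (f := fun u : F.V n => piLevel g σ η n u ^ p)
    (fun v _ => Real.rpow_nonneg (piLevel_pos g σ hs n v).le p) (Finset.mem_univ u)
  linarith

lemma hausdorffDim_le [CompactSpace X] [Nonempty X] (hs : IsSmall α η) (hσ : Admissible σ)
    (ho : IsRoot o) {p : ℝ}
    (hp : Tendsto (fun n => ∑ u : F.V n, piLevel g σ η n u ^ p) atTop (𝓝 0)) :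
    hausdorffDim (DeformBoundary (toZ g σ η o) 1)
      (boundaryMetricSpace (deformDist_ne_top (g := g) (σ := σ) hs ho)) ≤ ENNReal.ofReal p := by
  have hp0 := pos_of_tendsto_sum hs hp
  have hC := zero_lt_one.trans_le (one_le_visualConst hs)
  let := boundaryMetricSpace (deformDist_ne_top (g := g) (σ := σ) hs ho)
  refine dimH_univ_le_of_cover hp0.le
    (fun n (u : F.V n) => toDeformBoundary g hs hσ ho '' ball u.1 (α ^ n))
    (tendsto_pow_one_sub (α := α) hs (visualConst η))
    (fun n u => (ediam_image_ball_le hs hσ ho n u).trans (ENNReal.ofReal_le_ofReal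
      (mul_le_mul_of_nonneg_left (piLevel_le_pow g σ hs n u) hC.le))) (fun n => ?_) ?_
  · refine eq_univ_of_forall fun q => ?_
    obtain ⟨x, rfl⟩ := toDeformBoundary_surjective hs hσ ho q
    exact mem_iUnion.2 ⟨(nearVertex F x n).2, x, dist_nearVertex x n, rfl⟩
  · have h1 := ENNReal.tendsto_ofReal (hp.const_mul (visualConst η ^ p))
    rw [mul_zero, ENNReal.ofReal_zero] at h1
    refine tendsto_of_tendsto_of_tendsto_of_le_of_le tendsto_const_nhds h1 (fun _ => bot_le)
      fun n => ?_
    change _ ≤ ENNReal.ofReal (visualConst η ^ p * ∑ u : F.V n, piLevel g σ η n u ^ p)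
    rw [Finset.mul_sum, ENNReal.ofReal_sum_of_nonneg fun u _ =>
      mul_nonneg (Real.rpow_nonneg hC.le _) (Real.rpow_nonneg (piLevel_pos g σ hs n u).le _)]
    refine Finset.sum_le_sum fun u _ => ?_
    refine (ENNReal.rpow_le_rpow (ediam_image_ball_le hs hσ ho n u) hp0.le).trans (le_of_eq ?_)
    rw [ENNReal.ofReal_rpow_of_nonneg (mul_nonneg hC.le (piLevel_pos g σ hs n u).le) hp0.le,
      Real.mul_rpow hC.le (piLevel_pos g σ hs n u).le]

end Filling

end

theorem mainTheorem4 :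
    ∃ α₀ ∈ Ioo (0 : ℝ) 1, ∃ η₀ ∈ Ioo (0 : ℝ) 1, ∀ α ∈ Ioc (0 : ℝ) α₀, ∀ η ∈ Ioc (0 : ℝ) η₀,
    ∃ C : ℝ, 1 ≤ C ∧
    ∀ (X : Type u) [D : MetricSpace X] [CompactSpace X], diam (univ : Set X) < 1 →
    ∀ (F : Filling X α) (g : F.Parents) (σ : F.Weight), Filling.Admissible σ →
    ∀ o : F.Vertex, o.1 = 0 →
    ∃ (Ψ : X ≃ GromovBoundary (Filling.toZ g σ η o))
      (ι : X ≃ DeformBoundary (Filling.toZ g σ η o) 1)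
      (d₁ : MetricSpace (DeformBoundary (Filling.toZ g σ η o) 1)),
      Filling.IsNatural g σ η o 1 Ψ ι ∧
      IsBoundaryMetric (Filling.toZ g σ η o) 1 d₁ ∧
      IsVisual (Filling.toZ g σ η o) 1 C (fun a b => dist (ι (Ψ.symm a)) (ι (Ψ.symm b))) ∧
      IsQuasisymmetric D d₁ ι ∧
      (∀ (n : ℕ) (u : F.V n),
        ediam (ι '' ball u.1 (α ^ n)) ≤ ENNReal.ofReal (C * Filling.piLevel g σ η n u)) ∧
      (∀ (n : ℕ) (u : F.V n), Filling.piLevel g σ η n u ≤ (1 - η) ^ n) ∧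
      ∀ p : ℝ,
        Tendsto (fun n => ∑ u : F.V n, Filling.piLevel g σ η n u ^ p) atTop (𝓝 0) →
        hausdorffDim (DeformBoundary (Filling.toZ g σ η o) 1) d₁ ≤ ENNReal.ofReal p ∧
        conformalDim X D ≤ ENNReal.ofReal p := by
  refine ⟨1 / 100, ⟨by norm_num, by norm_num⟩, 1 / 4, ⟨by norm_num, by norm_num⟩,
    fun α hα η hη => ?_⟩
  have hs : Filling.IsSmall α η := ⟨hα.1, hα.2, hη.1, hη.2⟩
  refine ⟨Filling.visualConst η, Filling.one_le_visualConst hs,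
    fun X _ _ hd F g σ hσ o ho₀ => ?_⟩
  have ho := Filling.isRoot_of_diam_lt hd ho₀
  have : Nonempty X := ⟨o.2.1⟩
  let Ψ : X ≃ GromovBoundary (Filling.toZ g σ η o) := Equiv.ofBijective _
    ⟨Filling.toGromovBoundary_injective hs hσ ho, Filling.toGromovBoundary_surjective hs hσ ho⟩
  let ι : X ≃ DeformBoundary (Filling.toZ g σ η o) 1 := Equiv.ofBijective _
    ⟨Filling.toDeformBoundary_injective hs hσ ho, Filling.toDeformBoundary_surjective hs hσ ho⟩
  have hqs := Filling.isQuasisymmetric_toDeformBoundary (g := g) hs hσ ho hd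
  refine ⟨Ψ, ι, boundaryMetricSpace (Filling.deformDist_ne_top hs ho), fun x u hu hx => ?_,
    isBoundaryMetric_boundaryMetricSpace _, Filling.isVisual hs hσ ho hd fun x y => ?_, hqs,
    Filling.ediam_image_ball_le hs hσ ho, Filling.piLevel_le_pow g σ hs, fun p hp => ?_⟩
  · have h : Filling.TendsToPoint u x := ⟨hu, hx⟩
    exact ⟨⟨h.isGromovSeq hs ho, (Filling.mk_eq_toGromovBoundary hs hσ ho).2
      (h.gromovRel hs ho (Filling.tendsToPoint_nearVertex hs x))⟩, h.tendsto hs hσ ho⟩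
  · have h (x : X) : Ψ.symm (Filling.toGromovBoundary g σ hs ho x) = x := Ψ.symm_apply_apply x
    rw [h, h]
    exact Filling.dist_toDeformBoundary hs hσ ho x y
  · have h := Filling.hausdorffDim_le (g := g) hs hσ ho hp
    exact ⟨h, iInf_le_of_le (DeformBoundary (Filling.toZ g σ η o) 1) (iInf_le_of_le
      (boundaryMetricSpace (Filling.deformDist_ne_top hs ho)) (iInf_le_of_le ⟨_, hqs⟩ h))⟩
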